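/- Fix $T>0$, $U>0$ and $\Delta t\in\,]0,T[$. Let $v:[0,T]\times\mathbb R^N\times\mathbb R^N\to\mathbb R^N$, $(t,x,P)\mapsto v(t,x,P)$, be Lipschitz continuous. Let $\bar P\in\mathbb R^N$, let $u:[0,T]\to\mathbb R^N$ be measurable with $\|u\|\le U$ a.e., put $P(t)=\bar P+\int_0^t u(s)\,ds$, and let $t\in[0,T-\Delta t[$. Let $r\in L^1(\mathbb R^N;\mathbb R)$ be any datum at time $t$ (for instance $r=\rho(t,\cdot)$, where $\rho$ solves $\partial_t\rho+\mathrm{div}_x(\rho\,v(t,x,P(t)))=0$ with $\rho(0,\cdot)=\bar\rho\in L^1$). For $w\in\mathbb R^N$ consider the frozen-time problem $$\partial_\tau\rho_w+\mathrm{div}_x\bigl(\rho_w\,V_w(\tau,x)\bigr)=0,\qquad \rho_w(t,\cdot)=r,\qquad \tau\in[t,t+\Delta t],\qquad V_w(\tau,x)=v\bigl(t,x,P(t)+(\tau-t)w\bigr).\tag{1}$$ A (Kružkov) solution of (1) is a function $\rho_w\in L^1_{loc}([t,t+\Delta t]\times\mathbb R^N)$ such that $$\int_t^{t+\Delta t}\!\!\int_{\mathbb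 R^N}\Bigl(|\rho_w-k|\,(\partial_\tau\varphi+V_w\cdot\nabla_x\varphi)-\mathrm{sign}(\rho_w-k)\,k\,\mathrm{div}_xV_w\,\varphi\Bigr)\,dx\,d\tau\ \ge\ 0$$ for all $k\in\mathbb R$ and all $\varphi\in C_c^\infty(]t,t+\Delta t[\times\mathbb R^N;[0,\infty[)$, and such that, for every $R>0$, $\int_{B(0,R)}|\rho_w(\tau,x)-r(x)|\,dx\to0$ as $\tau\to t^+$ outside a null set of times. **Well-posedness.** For every $w\in\mathbb R^N$, and all $\bar t\in[t,t+\Delta t]$, $x\in\mathbb R^N$, the Cauchy problem $\xi'=V_w(\tau,\xi)$, $\xi(\bar t)=x$ has a unique solution $\tau\mapsto X_{t,w}(\tau;\bar t,x)$ on $[t,t+\Delta t]$, and (1) has a solution, unique up to equality a.e. in $[t,t+\Delta t]\times\mathbb R^N$, given by $$\rho_w(\tau,x)=r\bigl(X_{t,w}(t;\tau,x)\bigr)\,\exp\Bigl(-\int_t^\tau \mathrm{div}_x v\bigl(t,X_{t,w}(s;\tau,x),P(t)+(s-t)w\bigr)\,ds\Bigr).\tag{2}$$ The function (2) belongs to $C^0([t,t+\Delta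 t];L^1(\mathbb R^N;\mathbb R))$. **Stability.** Assume moreover that $r\in C^{1,1}(\mathbb R^N;\mathbb R)$ (i.e. $r$ is $C^1$ with Lipschitz continuous derivative) and that its support $\mathrm{spt}\,r$ has finite Lebesgue measure. Let $w_1,w_2\in\mathbb R^N$, $M=\max\{U,\|w_1\|,\|w_2\|\}$, $B=B(P(t),\Delta t\,M)$, $I=[t,t+\Delta t]$, and $$C=\max\Bigl\{\|v\|_{L^\infty(I\times\mathbb R^N\times B)},\ \|D_xv\|_{L^\infty(I\times\mathbb R^N\times B)},\ \tfrac12\|D_Pv\|_{L^\infty(I\times\mathbb R^N\times\mathbb R^N)},\ \|D_P\,\mathrm{div}_xv\|_{L^\infty(I\times\mathbb R^N\times\mathbb R^N)},\ \|\mathrm{grad}_x\,\mathrm{div}_xv\|_{L^\infty(I\times\mathbb R^N\times B)}\Bigr\}.$$ Here matrices carry the operator norm, and the derivatives of $\mathrm{div}_xv$ are weak derivatives, whose $L^\infty$ norm is $+\infty$ if they do not exist as locally integrable functions. If $C<+\infty$, the solutions (2) for $w=w_1,w_2$ satisfy $$\|\rho_{w_1}(t+\Delta t)-\rho_{w_2}(t+\Delta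 t)\|_{L^1}\le\Bigl(\|\mathrm{grad}_x\,r\|_{L^\infty}\,\mathcal L^N\bigl(B(\mathrm{spt}\,r,\,Ce^{C\Delta t}\Delta t)\bigr)+(1+C\Delta t)\,\|r\|_{L^1}\Bigr)\,C\,e^{2C\Delta t}\,(\Delta t)^2\,\|w_1-w_2\|,$$ where $B(A,\delta)=\{x:\mathrm{dist}(x,A)<\delta\}$, $\mathcal L^N$ is Lebesgue measure and $0\cdot\infty=0$ on the right-hand side. -/

import Mathlib

open Set Filter Topology MeasureTheory

noncomputable section

/-- The Euclidean space `ℝ^N`. -/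
abbrev Space (N : ℕ) := EuclideanSpace ℝ (Fin N)

/-- The divergence of a vector field. For a Lipschitz field it is defined almost everywhere; the
value at a point of non-differentiability is irrelevant below. -/
def divergence {N : ℕ} (f : Space N → Space N) (x : Space N) : ℝ :=
  ∑ i, fderiv ℝ f x (EuclideanSpace.single i 1) i

/-- `X τ s x` is the value at time `τ` of a solution on `[a, b]` of `ξ' = V (τ, ξ)`, `ξ s = x`,
for all initial times `s ∈ [a, b]` and all initial positions `x`. -/
def IsFlow {N : ℕ} (V : ℝ → Space N → Space N) (a b : ℝ)
    (X : ℝ → ℝ → Space N → Space N) : Prop :=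
  ∀ s ∈ Icc a b, ∀ x : Space N, X s s x = x ∧
    ∀ τ ∈ Icc a b, HasDerivWithinAt (fun σ => X σ s x) (V τ (X τ s x)) (Icc a b) τ

/-- The density transported along the characteristics `X` of `V` from the datum `r` at time `a`. -/
def charDensity {N : ℕ} (V : ℝ → Space N → Space N) (X : ℝ → ℝ → Space N → Space N)
    (a : ℝ) (r : Space N → ℝ) (τ : ℝ) (x : Space N) : ℝ :=
  r (X a τ x) * Real.exp (-∫ s in a..τ, divergence (V s) (X s τ x))

/-- Kružkov solutions on `[a, b]` of `∂_τ ρ + div_x (ρ V(τ, x)) = 0`, `ρ(a, ·) = r`.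
Kružkov's definition is for bounded functions; since integrable data need not be bounded, local
integrability on the set `[a, b] × ℝ^N` is required here instead. -/
structure IsKruzkovSolution {N : ℕ} (V : ℝ → Space N → Space N) (a b : ℝ)
    (r : Space N → ℝ) (ρ : ℝ → Space N → ℝ) : Prop where
  locallyIntegrable :
    LocallyIntegrableOn (fun z : ℝ × Space N => ρ z.1 z.2) (Icc a b ×ˢ univ) volume
  /-- The entropy inequality, for all constants `k` and all nonnegative test functions supported
  in `]a, b[ × ℝ^N`; `fderiv ℝ φ z (1, V z)` is `∂_τ φ + V · grad_x φ`. -/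
  entropy : ∀ (k : ℝ) (φ : ℝ × Space N → ℝ), ContDiff ℝ (⊤ : ℕ∞) φ → HasCompactSupport φ →
    tsupport φ ⊆ Ioo a b ×ˢ univ → (∀ z, 0 ≤ φ z) →
    0 ≤ ∫ z in Icc a b ×ˢ (univ : Set (Space N)),
      (|ρ z.1 z.2 - k| * fderiv ℝ φ z (1, V z.1 z.2)
        - Real.sign (ρ z.1 z.2 - k) * (k * divergence (V z.1) z.2) * φ z)
  /-- The datum is attained in `L^1` on every ball, as `τ → a+` outside a null set of times. -/
  initial : ∀ R : ℝ, Tendsto (fun τ => ∫⁻ x in Metric.ball 0 R, ‖ρ τ x - r x‖ₑ)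
    (𝓝[>] a ⊓ ae volume) (𝓝 0)

/-- `ρ ∈ C^0([a, b]; L^1(ℝ^N))`. -/
def IsContinuousL1 {N : ℕ} (a b : ℝ) (ρ : ℝ → Space N → ℝ) : Prop :=
  (∀ τ ∈ Icc a b, Integrable (ρ τ) volume) ∧
  ∀ s ∈ Icc a b, Tendsto (fun τ => eLpNorm (fun x => ρ τ x - ρ s x) 1 volume)
    (𝓝[Icc a b] s) (𝓝 0)

/-- The class `C^{1,1}(ℝ^N; ℝ)`: continuously differentiable with Lipschitz derivative. -/
def IsC11 {N : ℕ} (r : Space N → ℝ) : Prop :=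
  ContDiff ℝ 1 r ∧ ∃ K : NNReal, LipschitzWith K (fderiv ℝ r)

/-- `G` is the weak gradient of `g` on the open set `Ω`, with respect to the variable that is
embedded in the full space `F` by `ι`. -/
def HasWeakPartialGradient {N : ℕ} {F : Type*} [NormedAddCommGroup F] [NormedSpace ℝ F]
    [MeasureSpace F] (ι : Space N →L[ℝ] F) (Ω : Set F) (g : F → ℝ) (G : F → Space N) : Prop :=
  LocallyIntegrableOn g Ω volume ∧ LocallyIntegrableOn G Ω volume ∧
  ∀ φ : F → ℝ, ContDiff ℝ (⊤ : ℕ∞) φ → HasCompactSupport φ → tsupport φ ⊆ Ω →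
    ∀ e : Space N, ∫ y, g y * fderiv ℝ φ y (ι e) = -∫ y, inner ℝ (G y) e * φ y

/-- The `L^∞(Ω)` norm of the weak partial gradient of `g`; it is `∞` if there is no weak partial
gradient. -/
def weakPartialGradientNorm {N : ℕ} {F : Type*} [NormedAddCommGroup F] [NormedSpace ℝ F]
    [MeasureSpace F] (ι : Space N →L[ℝ] F) (Ω : Set F) (g : F → ℝ) : ENNReal :=
  ⨅ (G : F → Space N) (_ : HasWeakPartialGradient ι Ω g G), eLpNorm G ⊤ (volume.restrict Ω)

/-- The inclusion of the variable `x` in the space of all `(t, x, P)`. -/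
def inclX (N : ℕ) : Space N →L[ℝ] ℝ × Space N × Space N :=
  (ContinuousLinearMap.inr ℝ ℝ (Space N × Space N)).comp
    (ContinuousLinearMap.inl ℝ (Space N) (Space N))

/-- The inclusion of the variable `P` in the space of all `(t, x, P)`. -/
def inclP (N : ℕ) : Space N →L[ℝ] ℝ × Space N × Space N :=
  (ContinuousLinearMap.inr ℝ ℝ (Space N × Space N)).comp
    (ContinuousLinearMap.inr ℝ (Space N) (Space N))

/-- `]t, t + δ[ × ℝ^N × B`. For `L^∞` norms the end points of the time interval are irrelevant. -/
def slab {N : ℕ} (t δ : ℝ) (B : Set (Space N)) : Set (ℝ × Space N × Space N) :=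
  Ioo t (t + δ) ×ˢ (univ ×ˢ B)

/-- The function `(t, x, P) ↦ div_x v (t, x, P)`. -/
def divX {N : ℕ} (v : ℝ → Space N → Space N → Space N) (z : ℝ × Space N × Space N) : ℝ :=
  divergence (fun x => v z.1 x z.2.2) z.2.1

/-- The maximum of the `L^∞` norms of `v`, `D_x v`, `grad_x div_x v` for `P ∈ B(p, R)`, and of
`(1/2) D_P v`, `D_P div_x v` for `P ∈ ℝ^N`, on the time interval `[t, t + δ]`. Matrices have the
operator norm. -/
def stabilityConst {N : ℕ} (v : ℝ → Space N → Space N → Space N) (t δ : ℝ) (p : Space N)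
    (R : ℝ) : ENNReal :=
  max (eLpNorm (fun z : ℝ × Space N × Space N => v z.1 z.2.1 z.2.2) ⊤
      (volume.restrict (slab t δ (Metric.ball p R)))) <|
  max (eLpNorm (fun z : ℝ × Space N × Space N => fderiv ℝ (fun x => v z.1 x z.2.2) z.2.1) ⊤
      (volume.restrict (slab t δ (Metric.ball p R)))) <|
  max (eLpNorm (fun z : ℝ × Space N × Space N => fderiv ℝ (fun P => v z.1 z.2.1 P) z.2.2) ⊤
      (volume.restrict (slab t δ univ)) / 2) <|
  max (weakPartialGradientNorm (inclP N) (slab t δ univ) (divX v))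
    (weakPartialGradientNorm (inclX N) (slab t δ (Metric.ball p R)) (divX v))

/-- The leader's trajectory `P(t) = P̄ + ∫_0^t u`. -/
def leaderPos {N : ℕ} (Pbar : Space N) (u : ℝ → Space N) (t : ℝ) : Space N :=
  Pbar + ∫ s in (0 : ℝ)..t, u s

/-- The velocity field `(τ, x) ↦ v (t, x, p + (τ - t) w)`, frozen at time `t`, for a leader that
moves with constant speed `w` from the position `p`. -/
def frozenField {N : ℕ} (v : ℝ → Space N → Space N → Space N) (t : ℝ) (p w : Space N)
    (τ : ℝ) (x : Space N) : Space N :=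
  v t x (p + (τ - t) • w)

end

set_option linter.unusedSectionVars false

/-! The frozen field is globally Lipschitz, so its characteristics form a bi-Lipschitz flow and
formula (2) is the transport of the measure `r dx` along it. The flow is differentiable only almost
everywhere. Rademacher's theorem and Fubini's theorem still give the linearized equation for almost
every starting point, Liouville's formula then identifies the Jacobian with `flowJac`
(`ae_det_fderiv_eq`), and the area formula gives the change of variables `lintegral_eq`. In
Lagrangian coordinates conservation of mass is immediate, continuity in `L^1` follows from
continuity of composition with the flow, and the entropy inequality is an equality along each single
characteristic (`integral_entropy_along_line`).

Uniqueness holds among merely locally integrable solutions by duality. Constants `k` tending to `±∞`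
turn the entropy inequality into the weak equation, which extends to Lipschitz test functions. The
dual problem `∂_τ φ + V · grad φ = -h` is solved explicitly along characteristics (`exists_dual`).
Testing the difference of two solutions with `φ` times a time cutoff leaves only a layer near the
initial time, and the common datum makes that layer vanish (`ae_eq`).

For stability, the bounds in `C` hold almost everywhere in a slab, whereas the problem sees only the
null slice at time `t`. Continuity of `v`, and for `div_x v` integration by parts against test
functions, carry the bounds to that slice (`frozenBounds_of_stabilityConst`). Grönwall's argument
then compares the two flows (`dist_flow_le`), and with them the two exponents. For close speeds the
difference of the densities splits into an increment of `r`, supported near its support, and a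
relative error of the exponentials. General speeds are joined by a segment cut into short pieces:
the estimate is linear in the length of a piece, so the pieces add up, while the radius of the
thickening does not depend on the distance of the speeds (`FrozenBounds.eLpNorm_sub_le`). -/

noncomputable section

/-! ### Global flows of Lipschitz fields. -/

section GlobalFlow

variable {E : Type*} [NormedAddCommGroup E] [NormedSpace ℝ E]

lemma norm_intervalIntegral_le_of_norm_le_exp {f : ℝ → E} {M l : ℝ} (hl : 0 < l) (hM : 0 ≤ M)
    (hf : ∀ σ, ‖f σ‖ ≤ M * Real.exp (l * |σ|)) (t : ℝ) :
    ‖∫ σ in (0 : ℝ)..t, f σ‖ ≤ M / l * Real.exp (l * |t|) := by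
  have key : ∀ (g : ℝ → E), (∀ σ, ‖g σ‖ ≤ M * Real.exp (l * |σ|)) → ∀ t, 0 ≤ t →
      ‖∫ σ in (0 : ℝ)..t, g σ‖ ≤ M / l * Real.exp (l * |t|) := by
    intro g hg t ht
    have h1 : ‖∫ σ in (0 : ℝ)..t, g σ‖ ≤ ∫ σ in (0 : ℝ)..t, M * Real.exp (l * σ) := by
      refine intervalIntegral.norm_integral_le_of_norm_le ht
        (Eventually.of_forall fun σ hσ => ?_) ?_
      · simpa [abs_of_pos hσ.1] using hg σ
      · exact (by fun_prop : Continuous fun σ => M * Real.exp (l * σ)).intervalIntegrable _ _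
    refine h1.trans ?_
    rw [intervalIntegral.integral_const_mul, intervalIntegral.integral_comp_mul_left _ hl.ne',
      integral_exp, abs_of_nonneg ht, smul_eq_mul, div_mul_eq_mul_div, mul_div_assoc]
    refine mul_le_mul_of_nonneg_left ?_ hM
    rw [inv_mul_eq_div]
    gcongr
    simp
  rcases le_total 0 t with ht | ht
  · exact key f hf t ht
  · have h2 := key (fun σ => f (-σ)) (fun σ => by simpa using hf (-σ)) (-t) (by linarith)
    rw [intervalIntegral.integral_comp_neg, neg_neg, neg_zero, intervalIntegral.integral_symm,
      norm_neg, abs_neg] at h2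
    exact h2

variable [CompleteSpace E]

/-- A globally Lipschitz time-dependent vector field has a global integral curve through the
origin. -/
lemma exists_global_integralCurve_zero {W : ℝ → E → E} {K : NNReal}
    (hW : LipschitzWith K (fun z : ℝ × E => W z.1 z.2)) :
    ∃ α : ℝ → E, α 0 = 0 ∧ ∀ t, HasDerivAt α (W t (α t)) t := by
  -- Adding 1 makes the rate positive even when `K = 0`. With the weight `exp (l |t|)`, `l = 2 k`,
  -- the Picard operator contracts by `k / l = 1/2` on the whole line at once, so no local solutions
  -- have to be glued.
  set k : ℝ := K + 1 with hk
  have hk0 : 0 < k := by positivity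
  set l : ℝ := 2 * k with hl
  have hl0 : 0 < l := by positivity
  have hWd : ∀ s s' y y', ‖W s y - W s' y'‖ ≤ k * max |s - s'| ‖y - y'‖ := by
    intro s s' y y'
    have := hW.dist_le_mul (s, y) (s', y')
    rw [dist_eq_norm, Prod.dist_eq, Real.dist_eq, dist_eq_norm] at this
    refine this.trans (mul_le_mul_of_nonneg_right (by simp [hk]) (by positivity))
  have hWc : Continuous fun z : ℝ × E => W z.1 z.2 := hW.continuous
  set c : ℝ := ‖W 0 0‖
  -- The curve sought is `exp (l |σ|) • g σ` with `g` bounded: the weight absorbs its exponential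
  -- growth.
  let F : (BoundedContinuousFunction ℝ E) → ℝ → E := fun g σ => W σ (Real.exp (l * |σ|) • g σ)
  have hFc : ∀ g, Continuous (F g) := fun g => by
    have : Continuous fun σ : ℝ => (σ, Real.exp (l * |σ|) • g σ) := by fun_prop
    exact hWc.comp this
  have hFb : ∀ g : BoundedContinuousFunction ℝ E, ∀ σ,
      ‖F g σ‖ ≤ (c + 1 + k * ‖g‖) * Real.exp (l * |σ|) := by
    intro g σ
    have h1 := hWd σ 0 (Real.exp (l * |σ|) • g σ) 0
    have h2 : ‖F g σ‖ ≤ c + ‖F g σ - W 0 0‖ := by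
      have := norm_add_le (W 0 0) (F g σ - W 0 0)
      rwa [add_sub_cancel] at this
    have h3 : max |σ - 0| ‖Real.exp (l * |σ|) • g σ - 0‖ ≤ |σ| + Real.exp (l * |σ|) * ‖g‖ := by
      refine max_le ?_ ?_
      · rw [sub_zero]; have := norm_nonneg g; have := Real.exp_pos (l * |σ|); nlinarith
      · rw [sub_zero, norm_smul, Real.norm_eq_abs, abs_of_pos (Real.exp_pos _)]
        have := mul_le_mul_of_nonneg_left (g.norm_coe_le_norm σ) (Real.exp_pos (l * |σ|)).le
        have := abs_nonneg σ
        linarith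
    have h4 := Real.add_one_le_exp (l * |σ|)
    have h5 : k * |σ| ≤ Real.exp (l * |σ|) := by
      have := abs_nonneg σ
      nlinarith
    have h6 : 1 ≤ Real.exp (l * |σ|) := Real.one_le_exp (by positivity)
    have h7 : c ≤ c * Real.exp (l * |σ|) := le_mul_of_one_le_right (norm_nonneg _) h6
    have h8 := mul_le_mul_of_nonneg_left h3 hk0.le
    change ‖F g σ - W 0 0‖ ≤ _ at h1
    nlinarith
  let G : BoundedContinuousFunction ℝ E → ℝ → E := fun g t => ∫ σ in (0 : ℝ)..t, F g σ
  have hGd : ∀ g t, HasDerivAt (G g) (F g t) t := fun g t =>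
    intervalIntegral.integral_hasDerivAt_right ((hFc g).intervalIntegrable _ _)
      ((hFc g).stronglyMeasurableAtFilter _ _) (hFc g).continuousAt
  have hGc : ∀ g, Continuous (G g) := fun g =>
    continuous_iff_continuousAt.2 fun t => (hGd g t).continuousAt
  have hexp : ∀ t : ℝ, Real.exp (-(l * |t|)) * Real.exp (l * |t|) = 1 := fun t => by
    rw [← Real.exp_add]; simp
  let T : BoundedContinuousFunction ℝ E → BoundedContinuousFunction ℝ E := fun g =>
    BoundedContinuousFunction.ofNormedAddCommGroup
      (fun t => Real.exp (-(l * |t|)) • G g t)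
      (Continuous.smul (by fun_prop) (hGc g)) ((c + 1 + k * ‖g‖) / l) (fun t => by
        rw [norm_smul, Real.norm_eq_abs, abs_of_pos (Real.exp_pos _)]
        have := norm_intervalIntegral_le_of_norm_le_exp hl0 (by positivity) (hFb g) t
        calc _ ≤ Real.exp (-(l * |t|)) * ((c + 1 + k * ‖g‖) / l * Real.exp (l * |t|)) := by
              gcongr
          _ = (c + 1 + k * ‖g‖) / l := by
              rw [mul_comm, mul_assoc, mul_comm (Real.exp _) (Real.exp _), hexp, mul_one])
  have hT : ContractingWith (1 / 2) T := by
    refine ⟨by rw [← NNReal.coe_lt_coe]; norm_num, LipschitzWith.of_dist_le_mul fun g₁ g₂ => ?_⟩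
    rw [BoundedContinuousFunction.dist_le (by positivity)]
    intro t
    change dist (Real.exp (-(l * |t|)) • G g₁ t) (Real.exp (-(l * |t|)) • G g₂ t) ≤ _
    rw [dist_eq_norm, ← smul_sub, norm_smul, Real.norm_eq_abs, abs_of_pos (Real.exp_pos _)]
    have h1 : G g₁ t - G g₂ t = ∫ σ in (0 : ℝ)..t, (F g₁ σ - F g₂ σ) := by
      rw [intervalIntegral.integral_sub ((hFc _).intervalIntegrable _ _)
        ((hFc _).intervalIntegrable _ _)]
    have h2 : ∀ σ, ‖F g₁ σ - F g₂ σ‖ ≤ (k * dist g₁ g₂) * Real.exp (l * |σ|) := by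
      intro σ
      refine (hWd _ _ _ _).trans ?_
      rw [sub_self, abs_zero, max_eq_right (norm_nonneg _), ← smul_sub, norm_smul,
        Real.norm_eq_abs, abs_of_pos (Real.exp_pos _), ← dist_eq_norm]
      have := mul_le_mul_of_nonneg_left (BoundedContinuousFunction.dist_coe_le_dist
        (f := g₁) (g := g₂) σ) (by positivity : 0 ≤ k * Real.exp (l * |σ|))
      linarith
    have h3 := norm_intervalIntegral_le_of_norm_le_exp hl0 (by positivity) h2 t
    rw [h1]
    calc _ ≤ Real.exp (-(l * |t|)) * (k * dist g₁ g₂ / l * Real.exp (l * |t|)) := by gcongr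
      _ = k * dist g₁ g₂ / l := by
          rw [mul_comm, mul_assoc, mul_comm (Real.exp _) (Real.exp _), hexp, mul_one]
      _ ≤ _ := by
          rw [hl, mul_comm (2 : ℝ), mul_div_mul_left _ _ hk0.ne']
          simp [div_eq_inv_mul]
  obtain ⟨g, hg⟩ : ∃ g, T g = g := ⟨_, hT.fixedPoint_isFixedPt⟩
  have hgG : ∀ t, Real.exp (l * |t|) • g t = G g t := by
    intro t
    have : g t = Real.exp (-(l * |t|)) • G g t := DFunLike.congr_fun hg.symm t
    rw [this, smul_smul, mul_comm, hexp, one_smul]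
  refine ⟨G g, by simp [G], fun t => ?_⟩
  have := hGd g t
  simpa only [F, hgG] using this


/-- `X` is the flow of `V`, defined for all times. -/
structure IsGlobalFlow (V : ℝ → E → E) (X : ℝ → ℝ → E → E) : Prop where
  init : ∀ s x, X s s x = x
  deriv : ∀ s x τ, HasDerivAt (fun σ => X σ s x) (V τ (X τ s x)) τ

lemma exists_isGlobalFlow {V : ℝ → E → E} {K : NNReal}
    (hV : LipschitzWith K (fun z : ℝ × E => V z.1 z.2)) : ∃ X, IsGlobalFlow V X := by
  have key : ∀ s x, ∃ β : ℝ → E, β s = x ∧ ∀ t, HasDerivAt β (V t (β t)) t := by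
    intro s x
    have hW : LipschitzWith K (fun z : ℝ × E => (fun t y => V (t + s) (y + x)) z.1 z.2) := by
      intro z z'
      refine (hV (z.1 + s, z.2 + x) (z'.1 + s, z'.2 + x)).trans ?_
      gcongr
      simp [Prod.edist_eq]
    obtain ⟨α, h0, hα⟩ := exists_global_integralCurve_zero (W := fun t y => V (t + s) (y + x)) hW
    refine ⟨fun t => α (t - s) + x, by simp [h0], fun t => ?_⟩
    have := (hα (t - s)).scomp t ((hasDerivAt_id t).sub_const s)
    simp only [sub_add_cancel, one_smul] at this
    exact this.add_const x
  choose β h0 hβ using key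
  exact ⟨fun τ s x => β s x τ, h0, hβ⟩

lemma lipschitzWith_slice {V : ℝ → E → E} {K : NNReal}
    (hV : LipschitzWith K (fun z : ℝ × E => V z.1 z.2)) (s : ℝ) : LipschitzWith K (V s) := by
  have := hV.comp (LipschitzWith.prodMk_left s)
  rwa [mul_one] at this

namespace IsGlobalFlow

variable {V : ℝ → E → E} {X : ℝ → ℝ → E → E} {K : NNReal}

lemma comp (hX : IsGlobalFlow V X) (hV : LipschitzWith K (fun z : ℝ × E => V z.1 z.2))
    (τ s u : ℝ) (x : E) : X τ s (X s u x) = X τ u x := by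
  have := ODE_solution_unique_univ (v := V) (s := fun _ => univ) (t₀ := s)
    (fun t => (lipschitzWith_slice hV t).lipschitzOnWith)
    (fun t => ⟨hX.deriv s (X s u x) t, mem_univ _⟩) (fun t => ⟨hX.deriv u x t, mem_univ _⟩)
    (hX.init s _)
  exact congrFun this τ

lemma continuous_time (hX : IsGlobalFlow V X) (s : ℝ) (x : E) : Continuous fun τ => X τ s x :=
  continuous_iff_continuousAt.2 fun t => (hX.deriv s x t).continuousAt

/-- The Grönwall estimates used below run forward in time; time reversal yields them for `τ < s`. -/
lemma reverse (hX : IsGlobalFlow V X) :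
    IsGlobalFlow (fun τ x => -V (-τ) x) (fun τ s x => X (-τ) (-s) x) where
  init s x := hX.init _ x
  deriv s x τ := by
    have := (hX.deriv (-s) x (-τ)).scomp τ (hasDerivAt_neg τ)
    rw [neg_one_smul] at this
    exact this

lemma lipschitzWith_reverse (hV : LipschitzWith K (fun z : ℝ × E => V z.1 z.2)) :
    LipschitzWith K (fun z : ℝ × E => (fun τ x => -V (-τ) x) z.1 z.2) := by
  intro z z'
  have := hV (-z.1, z.2) (-z'.1, z'.2)
  simpa [Prod.edist_eq, edist_neg_neg] using this

lemma dist_le (hX : IsGlobalFlow V X) (hV : LipschitzWith K (fun z : ℝ × E => V z.1 z.2))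
    (τ s : ℝ) (x y : E) : dist (X τ s x) (X τ s y) ≤ dist x y * Real.exp (K * |τ - s|) := by
  have key : ∀ {V : ℝ → E → E} {X : ℝ → ℝ → E → E}, IsGlobalFlow V X →
      LipschitzWith K (fun z : ℝ × E => V z.1 z.2) → ∀ τ s, s ≤ τ →
      dist (X τ s x) (X τ s y) ≤ dist x y * Real.exp (K * |τ - s|) := by
    intro V X hX hV τ s h
    have := dist_le_of_trajectories_ODE (fun t => lipschitzWith_slice hV t)
      (hX.continuous_time s x).continuousOn (fun t _ => (hX.deriv s x t).hasDerivWithinAt)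
      (hX.continuous_time s y).continuousOn (fun t _ => (hX.deriv s y t).hasDerivWithinAt)
      (by rw [hX.init, hX.init]) τ ⟨h, le_rfl⟩
    rwa [abs_of_nonneg (sub_nonneg.2 h)]
  rcases le_total s τ with h | h
  · exact key hX hV τ s h
  · have := key hX.reverse (lipschitzWith_reverse hV) (-τ) (-s) (by linarith)
    simpa [abs_sub_comm, neg_add_eq_sub] using this

/-- The constant curve `x` is an approximate trajectory with defect at most `M`. Grönwall's bound
`(M / K) (exp (K d) - 1)` is at most `M d exp (K d)`, which also makes sense for `K = 0`. -/
lemma dist_self_le (hX : IsGlobalFlow V X) (hV : LipschitzWith K (fun z : ℝ × E => V z.1 z.2))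
    (τ s : ℝ) (x : E) {M : ℝ} (hM : ∀ σ ∈ uIcc s τ, ‖V σ x‖ ≤ M) :
    dist (X τ s x) x ≤ M * |τ - s| * Real.exp (K * |τ - s|) := by
  have hM0 : 0 ≤ M := (norm_nonneg _).trans (hM s left_mem_uIcc)
  have key : ∀ {V : ℝ → E → E} {X : ℝ → ℝ → E → E}, IsGlobalFlow V X →
      LipschitzWith K (fun z : ℝ × E => V z.1 z.2) → ∀ τ s, s ≤ τ →
      (∀ σ ∈ uIcc s τ, ‖V σ x‖ ≤ M) →
      dist (X τ s x) x ≤ M * |τ - s| * Real.exp (K * |τ - s|) := by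
    intro V X hX hV τ s h hM
    have h1 := dist_le_of_approx_trajectories_ODE (v := V) (f' := fun t => V t (X t s x))
      (g := fun _ => x) (g' := fun _ => 0) (εf := 0) (εg := M) (δ := 0)
      (a := s) (b := τ) (fun t => lipschitzWith_slice hV t)
      (hX.continuous_time s x).continuousOn (fun t _ => (hX.deriv s x t).hasDerivWithinAt)
      (fun t _ => by simp) continuousOn_const (fun t _ => hasDerivWithinAt_const _ _ _)
      (fun t ht => by
        rw [dist_zero_left]
        exact hM t (by rw [uIcc_of_le h]; exact Ico_subset_Icc_self ht))
      (by rw [hX.init]; simp) τ ⟨h, le_rfl⟩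
    refine h1.trans ?_
    rw [abs_of_nonneg (sub_nonneg.2 h), zero_add]
    set d := τ - s
    have hd : 0 ≤ d := sub_nonneg.2 h
    by_cases hK : (K : ℝ) = 0
    · rw [hK, gronwallBound_K0]; simp
    · rw [gronwallBound_of_K_ne_0 hK]
      have hK0 : (0 : ℝ) < K := lt_of_le_of_ne K.2 (Ne.symm hK)
      have h2 := Real.add_one_le_exp (-(K * d))
      have h3 : Real.exp (-(K * d)) * Real.exp (K * d) = 1 := by rw [← Real.exp_add]; simp
      have h4 : Real.exp (K * d) - 1 ≤ K * d * Real.exp (K * d) := by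
        have := mul_le_mul_of_nonneg_right h2 (Real.exp_pos (K * d)).le
        nlinarith
      calc _ = M / K * (Real.exp (K * d) - 1) := by ring
        _ ≤ M / K * (K * d * Real.exp (K * d)) := by gcongr
        _ = _ := by field_simp
  rcases le_total s τ with h | h
  · exact key hX hV τ s h hM
  · have := key hX.reverse (lipschitzWith_reverse hV) (-τ) (-s) (by linarith) (fun σ hσ => by
      rw [norm_neg]
      refine hM _ ?_
      rw [uIcc_of_le (by linarith)] at hσ
      rw [uIcc_of_ge h]
      exact ⟨by linarith [hσ.2], by linarith [hσ.1]⟩)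
    simpa [abs_sub_comm, neg_add_eq_sub] using this

lemma lipschitzWith (hX : IsGlobalFlow V X) (hV : LipschitzWith K (fun z : ℝ × E => V z.1 z.2))
    (τ s : ℝ) : LipschitzWith (Real.exp (K * |τ - s|)).toNNReal (X τ s) :=
  LipschitzWith.of_dist_le_mul fun x y => by
    rw [Real.coe_toNNReal _ (Real.exp_pos _).le, mul_comm]
    exact hX.dist_le hV τ s x y

lemma continuous (hX : IsGlobalFlow V X) (hV : LipschitzWith K (fun z : ℝ × E => V z.1 z.2))
    (a : ℝ) : Continuous fun z : ℝ × E => X z.1 a z.2 := by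
  refine continuous_iff_continuousAt.2 fun z₀ => tendsto_iff_dist_tendsto_zero.2 ?_
  have h1 : Tendsto (fun z : ℝ × E => dist z.2 z₀.2 * Real.exp (K * |z.1 - a|) +
      dist (X z.1 a z₀.2) (X z₀.1 a z₀.2)) (𝓝 z₀) (𝓝 0) := by
    have hc := hX.continuous_time a z₀.2
    have : Continuous (fun z : ℝ × E => dist z.2 z₀.2 * Real.exp (K * |z.1 - a|) +
      dist (X z.1 a z₀.2) (X z₀.1 a z₀.2)) := by fun_prop
    simpa using this.tendsto z₀
  refine squeeze_zero (fun _ => dist_nonneg) (fun z => ?_) h1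
  exact (dist_triangle _ (X z.1 a z₀.2) _).trans (by gcongr; exact hX.dist_le hV _ _ _ _)

/-- A change of the initial time is traded for a displacement: by the group law the trajectory from
`z'` also starts at time `z.1`, from a point close to `z'.2` by `dist_self_le`. -/
lemma locallyLipschitz_inv (hX : IsGlobalFlow V X)
    (hV : LipschitzWith K (fun z : ℝ × E => V z.1 z.2)) (a : ℝ) :
    LocallyLipschitz fun z : ℝ × E => X a z.1 z.2 := by
  intro z₀
  set M : ℝ := ‖V z₀.1 z₀.2‖ + K with hM
  set L : ℝ := Real.exp (K * (|a - z₀.1| + 1)) * (1 + M * Real.exp (K * 2)) with hL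
  refine ⟨L.toNNReal, Metric.ball z₀ 1, Metric.ball_mem_nhds _ one_pos,
    LipschitzOnWith.of_dist_le_mul fun z hz z' hz' => ?_⟩
  rw [Real.coe_toNNReal _ (by positivity)]
  rw [Metric.mem_ball, Prod.dist_eq, max_lt_iff, Real.dist_eq] at hz hz'
  have hb : ∀ σ ∈ uIcc z'.1 z.1, ‖V σ z'.2‖ ≤ M := by
    intro σ hσ
    have h1 : |σ - z₀.1| ≤ 1 := by
      rcases abs_lt.1 hz.1 with ⟨h1, h2⟩
      rcases abs_lt.1 hz'.1 with ⟨h3, h4⟩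
      rcases mem_uIcc.1 hσ with h | h <;> exact abs_le.2 ⟨by linarith, by linarith⟩
    have h2 := hV.dist_le_mul (σ, z'.2) z₀
    rw [Prod.dist_eq, Real.dist_eq] at h2
    have h3 : ‖V σ z'.2‖ ≤ ‖V z₀.1 z₀.2‖ + dist (V σ z'.2) (V z₀.1 z₀.2) := by
      rw [dist_eq_norm]
      have := norm_add_le (V z₀.1 z₀.2) (V σ z'.2 - V z₀.1 z₀.2)
      rwa [add_sub_cancel] at this
    have h4 : (K : ℝ) * max |σ - z₀.1| (dist z'.2 z₀.2) ≤ K * 1 := by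
      gcongr; exact max_le h1 hz'.2.le
    linarith
  have hM0 : 0 ≤ M := by positivity
  have hzz : |z.1 - z'.1| ≤ dist z z' := by
    rw [Prod.dist_eq, Real.dist_eq]; exact le_max_left _ _
  have hzz2 : dist z.2 z'.2 ≤ dist z z' := by
    rw [Prod.dist_eq]; exact le_max_right _ _
  have e1 := hX.dist_self_le hV z.1 z'.1 z'.2 hb
  have e2 : |z.1 - z'.1| ≤ 2 := by
    rcases abs_lt.1 hz.1 with ⟨h1, h2⟩
    rcases abs_lt.1 hz'.1 with ⟨h3, h4⟩
    exact abs_le.2 ⟨by linarith, by linarith⟩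
  have e3 : dist (X z.1 z'.1 z'.2) z'.2 ≤ M * dist z z' * Real.exp (K * 2) :=
    e1.trans (by gcongr)
  have e4 : |a - z.1| ≤ |a - z₀.1| + 1 := by
    have := abs_sub_le a z₀.1 z.1
    rw [abs_sub_comm z₀.1] at this
    linarith [hz.1]
  rw [← hX.comp hV a z.1 z'.1 z'.2]
  calc _ ≤ dist z.2 (X z.1 z'.1 z'.2) * Real.exp (K * |a - z.1|) := hX.dist_le hV _ _ _ _
    _ ≤ (dist z z' + M * dist z z' * Real.exp (K * 2)) * Real.exp (K * (|a - z₀.1| + 1)) := by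
        gcongr
        exact (dist_triangle _ z'.2 _).trans (add_le_add hzz2 (by rwa [dist_comm]))
    _ = L * dist z z' := by rw [hL]; ring

end IsGlobalFlow

end GlobalFlow

/-! ### Liouville's formula for matrix equations. -/

section Determinant

variable {n : Type*} [Fintype n] [DecidableEq n]

/-- The determinant is multilinear in the rows, so its derivative varies one row at a time. -/
lemma hasFDerivAt_matrix_det (M : Matrix n n ℝ) :
    ∃ D : (n → n → ℝ) →L[ℝ] ℝ, HasFDerivAt (fun A : n → n → ℝ => Matrix.det (Matrix.of A)) D M ∧
      ∀ A, D A = ∑ i, (M.updateRow i (A i)).det := by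
  let f : ContinuousMultilinearMap ℝ (fun _ : n => n → ℝ) ℝ :=
    { toMultilinearMap := (Matrix.detRowAlternating (R := ℝ) (n := n)).toMultilinearMap
      cont := (continuous_id.matrix_det : Continuous fun A : Matrix n n ℝ => A.det) }
  exact ⟨f.linearDeriv M, f.hasFDerivAt M, fun A => f.linearDeriv_apply M A⟩

/-- **Liouville's formula** for a linear equation `M' = B M` that holds almost everywhere. -/
lemma det_eq_exp_integral_trace {a τ C : ℝ} {A B M : ℝ → Matrix n n ℝ}
    (hBm : ∀ i j, Measurable fun s => B s i j) (hBA : ∀ i j, Measurable fun s => (B s * A s) i j)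
    (hBb : ∀ s i j, |B s i j| ≤ C) (hBAb : ∀ s i j, |(B s * A s) i j| ≤ C)
    (hM : ∀ σ i j, M σ i j = (1 : Matrix n n ℝ) i j + ∫ s in a..σ, (B s * A s) i j)
    (hA : ∀ᵐ s, s ∈ uIcc a τ → A s = M s) :
    (M τ).det = Real.exp (∫ s in a..τ, (B s).trace) := by
  have hint : ∀ {f : ℝ → ℝ} {c : ℝ}, Measurable f → (∀ s, |f s| ≤ c) →
      LocallyIntegrable f volume ∧ (∀ x y, IntervalIntegrable f volume x y) ∧
      LipschitzWith c.toNNReal (fun σ => ∫ s in a..σ, f s) := by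
    intro f c hf hc
    have h1 : LocallyIntegrable f volume :=
      (locallyIntegrable_const c).mono hf.aestronglyMeasurable
        (Eventually.of_forall fun s => (hc s).trans (le_abs_self c))
    have h2 : ∀ x y, IntervalIntegrable f volume x y := fun x y =>
      intervalIntegrable_iff.2 ((h1.integrableOn_isCompact isCompact_uIcc).mono_set uIoc_subset_uIcc)
    refine ⟨h1, h2, LipschitzWith.of_dist_le_mul fun x y => ?_⟩
    rw [Real.dist_eq, intervalIntegral.integral_interval_sub_left (h2 _ _) (h2 _ _),
      Real.coe_toNNReal _ ((abs_nonneg _).trans (hc 0)), Real.dist_eq]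
    exact intervalIntegral.norm_integral_le_of_norm_le_const (f := f) fun s _ => hc s
  have htrm : Measurable fun s => (B s).trace :=
    Finset.measurable_sum _ fun i _ => hBm i i
  have htrb : ∀ s, |(B s).trace| ≤ ∑ _i : n, C := fun s =>
    (Finset.abs_sum_le_sum_abs _ _).trans (Finset.sum_le_sum fun i _ => hBb s i i)
  obtain ⟨htr1, htr2, htr3⟩ := hint htrm htrb
  have hML : LipschitzWith C.toNNReal (fun σ i j => M σ i j) := by
    refine LipschitzWith.of_dist_le_mul fun x y => ?_
    refine (dist_pi_le_iff (by positivity)).2 fun i => (dist_pi_le_iff (by positivity)).2 fun j => ?_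
    have := (hint (hBA i j) (fun s => hBAb s i j)).2.2.dist_le_mul x y
    simp only [hM, dist_add_left]
    exact this
  -- `det M · exp (-∫ tr B)` is Lipschitz on the interval and has zero derivative almost everywhere.
  -- Absolute continuity makes it constant, although the equation may fail on a null set of times.
  let G : (n → n → ℝ) × ℝ → ℝ := fun p => Matrix.det (Matrix.of p.1) * Real.exp (-p.2)
  have hG : ContDiff ℝ 1 G := by
    refine ContDiff.mul ?_ (by fun_prop)
    simp only [Matrix.det_apply]
    refine ContDiff.sum fun σ _ => ContDiff.const_smul _ (contDiff_prod fun i _ => ?_)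
    simp only [Matrix.of_apply]
    fun_prop
  let f : ℝ → ℝ := fun σ => G (fun i j => M σ i j, ∫ s in a..σ, (B s).trace)
  have hf : LocallyLipschitz f :=
    hG.locallyLipschitz.comp (hML.locallyLipschitz.prodMk htr3.locallyLipschitz)
  obtain ⟨K, hK⟩ := (hf.locallyLipschitzOn (s := uIcc a τ)).exists_lipschitzOnWith_of_compact
    isCompact_uIcc
  have hd1 : ∀ᵐ σ, ∀ i j, HasDerivAt (fun s => M s i j) ((B σ * A σ) i j) σ := by
    refine ae_all_iff.2 fun i => ae_all_iff.2 fun j => ?_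
    filter_upwards [LocallyIntegrable.ae_hasDerivAt_integral
      (hint (hBA i j) (fun s => hBAb s i j)).1] with σ hσ
    simp only [hM]
    exact (hσ a).const_add _
  obtain ⟨c, hc⟩ := hK.absolutelyContinuousOnInterval.const_of_ae_hasDerivAt_zero (by
    filter_upwards [hd1, LocallyIntegrable.ae_hasDerivAt_integral htr1, hA] with σ h1 h2 h3 hσ
    have h1' : HasDerivAt (fun s i j => M s i j) (fun i j => (B σ * M σ) i j) σ := by
      rw [← h3 hσ]
      exact hasDerivAt_pi.2 fun i => hasDerivAt_pi.2 fun j => h1 i j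
    obtain ⟨D, hD, hDa⟩ := hasFDerivAt_matrix_det (M σ)
    have h4 : HasDerivAt (fun s => (M s).det) ((B σ).trace * (M σ).det) σ := by
      have h5 := hD.comp_hasDerivAt σ h1'
      have h6 : D (fun i j => (B σ * M σ) i j) = (B σ).trace * (M σ).det := by
        rw [hDa, Matrix.trace, Finset.sum_mul]
        refine Finset.sum_congr rfl fun i _ => ?_
        -- Row `i` of `B M` is a combination of the rows of `M`; since the determinant is
        -- alternating, only the multiple `B i i` of row `i` itself contributes.
        have := Matrix.det_updateRow_sum (M σ) i (B σ i)
        rw [smul_eq_mul] at this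
        rw [Matrix.diag_apply, ← this]
        congr 2
        ext j
        simp [Matrix.mul_apply]
      rw [h6] at h5
      exact h5
    have h7 := h4.mul ((h2 a).neg.exp)
    refine h7.congr_deriv ?_
    ring)
  have e1 := hc a left_mem_uIcc
  have e2 := hc τ right_mem_uIcc
  have h0 : M a = 1 := by ext i j; rw [hM]; simp
  have e3 : f a = 1 := by
    have : (Matrix.of fun i j => M a i j).det = 1 := by rw [h0]; exact Matrix.det_one
    simp [f, G, this]
  have e4 : (M τ).det * Real.exp (-∫ s in a..τ, (B s).trace) = 1 := by
    rw [← e3, e1, ← e2]; rfl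
  rw [Real.exp_neg] at e4
  field_simp at e4
  exact e4

end Determinant

/-! ### Jacobian of the flow and change of variables. -/

section Measure

variable {N : ℕ}

/-- Lebesgue measure is a multiple of the `N`-dimensional Hausdorff measure, which a `K`-Lipschitz
map increases at most by the factor `K ^ N`. -/
lemma measure_image_eq_zero_of_lipschitzWith {f : Space N → Space N} {K : NNReal}
    (hf : LipschitzWith K f) {A : Set (Space N)} (hA : volume A = 0) : volume (f '' A) = 0 := by
  have h1 := Measure.isAddLeftInvariant_eq_smul (volume : Measure (Space N)) (Measure.hausdorffMeasure (N : ℝ))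
  have h2 := Measure.isAddLeftInvariant_eq_smul (Measure.hausdorffMeasure (N : ℝ)) (volume : Measure (Space N))
  have h3 : Measure.hausdorffMeasure (N : ℝ) A = 0 := by rw [h2]; simp [hA]
  have h4 := hf.hausdorffMeasure_image_le (Nat.cast_nonneg N) A
  rw [h3, mul_zero, nonpos_iff_eq_zero] at h4
  rw [h1]; simp [h4]

lemma abs_divergence_le {f : Space N → Space N} {K : NNReal} (hf : LipschitzWith K f)
    (x : Space N) : |divergence f x| ≤ N * K := by
  unfold divergence
  refine (Finset.abs_sum_le_sum_abs _ _).trans ?_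
  have : ∀ i ∈ (Finset.univ : Finset (Fin N)),
      |fderiv ℝ f x (EuclideanSpace.single i 1) i| ≤ (K : ℝ) := by
    intro i _
    rw [← Real.norm_eq_abs]
    refine (PiLp.norm_apply_le _ i).trans ((ContinuousLinearMap.le_opNorm _ _).trans ?_)
    rw [PiLp.norm_single, norm_one, mul_one]
    exact norm_fderiv_le_of_lipschitz ℝ hf
  simpa using Finset.sum_le_sum this

variable {V : ℝ → Space N → Space N} {X : ℝ → ℝ → Space N → Space N} {K : NNReal}

lemma measurable_divergence {α : Type*} [TopologicalSpace α] [MeasurableSpace α]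
    [OpensMeasurableSpace α] {W : α → Space N → Space N}
    (hW : Continuous fun z : α × Space N => W z.1 z.2) :
    Measurable fun z : α × Space N => divergence (W z.1) z.2 := by
  unfold divergence
  refine Finset.measurable_sum _ fun i _ => ?_
  exact (EuclideanSpace.proj (𝕜 := ℝ) i).continuous.measurable.comp
    (measurable_fderiv_apply_const_with_param ℝ hW (EuclideanSpace.single i 1))

/-- The Jacobian determinant of the flow from time `a` to time `τ`. -/
def flowJac (V : ℝ → Space N → Space N) (X : ℝ → ℝ → Space N → Space N) (a τ : ℝ)
    (y : Space N) : ℝ :=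
  Real.exp (∫ s in a..τ, divergence (V s) (X s a y))

lemma flowJac_pos (V : ℝ → Space N → Space N) (X : ℝ → ℝ → Space N → Space N) (a τ : ℝ)
    (y : Space N) : 0 < flowJac V X a τ y := Real.exp_pos _

namespace IsGlobalFlow

/-- The inverse `X s τ` is Lipschitz, so preimages of null sets are null. This is what allows almost
everywhere properties of `V s`, such as the value of its divergence, to be used along the flow. -/
lemma quasiMeasurePreserving (hX : IsGlobalFlow V X)
    (hV : LipschitzWith K (fun z : ℝ × Space N => V z.1 z.2)) (τ s : ℝ) :
    Measure.QuasiMeasurePreserving (X τ s) := by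
  refine ⟨(hX.lipschitzWith hV τ s).continuous.measurable,
    Measure.AbsolutelyContinuous.mk fun A hA h0 => ?_⟩
  rw [Measure.map_apply (hX.lipschitzWith hV τ s).continuous.measurable hA,
    ← Set.image_eq_preimage_of_inverse (f := X s τ) (g := X τ s)]
  · exact measure_image_eq_zero_of_lipschitzWith (hX.lipschitzWith hV s τ) h0
  · exact fun x => by rw [hX.comp hV, hX.init]
  · exact fun x => by rw [hX.comp hV, hX.init]

/-- At each fixed time the exceptional `y` form a null set. Exchanging the quantifiers by Fubini's
theorem gives, for almost every `y`, the chain rule at almost every time of its trajectory. -/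
lemma ae_differentiableAt (hX : IsGlobalFlow V X)
    (hV : LipschitzWith K (fun z : ℝ × Space N => V z.1 z.2)) (a : ℝ) :
    ∀ᵐ y, ∀ᵐ s, DifferentiableAt ℝ (V s) (X s a y) ∧ DifferentiableAt ℝ (X s a) y := by
  have hm1 : MeasurableSet {z : ℝ × Space N | DifferentiableAt ℝ (V z.1) z.2} :=
    measurableSet_of_differentiableAt_with_param ℝ (f := V) hV.continuous
  have hm2 : MeasurableSet {z : ℝ × Space N | DifferentiableAt ℝ (X z.1 a) z.2} :=
    measurableSet_of_differentiableAt_with_param ℝ (f := fun s y => X s a y) (hX.continuous hV a)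
  have hΦ : Measurable fun z : ℝ × Space N => (z.1, X z.1 a z.2) :=
    measurable_fst.prodMk (hX.continuous hV a).measurable
  have hm : MeasurableSet {z : ℝ × Space N |
      DifferentiableAt ℝ (V z.1) (X z.1 a z.2) ∧ DifferentiableAt ℝ (X z.1 a) z.2} :=
    (hΦ hm1).inter hm2
  refine (Measure.ae_ae_comm hm).1 (Eventually.of_forall fun s => ?_)
  filter_upwards [(hX.quasiMeasurePreserving hV s a).ae
    (lipschitzWith_slice hV s).ae_differentiableAt,
    (hX.lipschitzWith hV s a).ae_differentiableAt] with y h1 h2 using ⟨h1, h2⟩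

lemma integral_eq (hX : IsGlobalFlow V X)
    (hV : LipschitzWith K (fun z : ℝ × Space N => V z.1 z.2)) (a σ : ℝ) (z : Space N) :
    X σ a z = z + ∫ s in a..σ, V s (X s a z) := by
  have hc : Continuous fun s => V s (X s a z) :=
    hV.continuous.comp (continuous_id.prodMk (hX.continuous_time a z))
  rw [intervalIntegral.integral_eq_sub_of_hasDerivAt (fun s _ => hX.deriv a z s)
    (hc.intervalIntegrable _ _), hX.init]
  abel

lemma measurable_fderiv_field (hX : IsGlobalFlow V X)
    (hV : LipschitzWith K (fun z : ℝ × Space N => V z.1 z.2)) (a : ℝ) (y : Space N) :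
    Measurable fun s => fderiv ℝ (V s) (X s a y) :=
  (measurable_fderiv_with_param ℝ (f := V) hV.continuous).comp
    (measurable_id.prodMk (hX.continuous_time a y).measurable)

lemma measurable_fderiv_comp (hX : IsGlobalFlow V X)
    (hV : LipschitzWith K (fun z : ℝ × Space N => V z.1 z.2)) (a : ℝ) (y e : Space N) :
    Measurable fun s => fderiv ℝ (V s) (X s a y) (fderiv ℝ (X s a) y e) := by
  have hXm : Measurable fun s => fderiv ℝ (X s a) y e :=
    (measurable_fderiv_apply_const_with_param ℝ (f := fun s y => X s a y) (hX.continuous hV a)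
      e).comp (measurable_id.prodMk measurable_const)
  exact (isBoundedBilinearMap_apply (𝕜 := ℝ) (E := Space N) (F := Space N)).continuous.measurable.comp
    ((hX.measurable_fderiv_field hV a y).prodMk hXm)

lemma norm_fderiv_comp_le (hX : IsGlobalFlow V X)
    (hV : LipschitzWith K (fun z : ℝ × Space N => V z.1 z.2)) (a s : ℝ) (y e : Space N) :
    ‖fderiv ℝ (V s) (X s a y) (fderiv ℝ (X s a) y e)‖ ≤ K * (Real.exp (K * |s - a|) * ‖e‖) := by
  refine (ContinuousLinearMap.le_opNorm _ _).trans ?_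
  gcongr
  · exact norm_fderiv_le_of_lipschitz ℝ (lipschitzWith_slice hV s)
  · refine (ContinuousLinearMap.le_opNorm _ _).trans ?_
    gcongr
    refine (norm_fderiv_le_of_lipschitz ℝ (hX.lipschitzWith hV s a)).trans ?_
    rw [Real.coe_toNNReal _ (Real.exp_pos _).le]

/-- This is the linearized equation in integral form: `integral_eq` is differentiated in the
direction `e` under the integral sign, where Lipschitz bounds dominate and differentiability is
needed for almost every `s` only. -/
lemma fderiv_apply_eq (hX : IsGlobalFlow V X)
    (hV : LipschitzWith K (fun z : ℝ × Space N => V z.1 z.2)) {a σ : ℝ} {y : Space N}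
    (hy : ∀ᵐ s, DifferentiableAt ℝ (V s) (X s a y) ∧ DifferentiableAt ℝ (X s a) y)
    (hσ : DifferentiableAt ℝ (X σ a) y) (e : Space N) :
    fderiv ℝ (X σ a) y e =
      e + ∫ s in a..σ, fderiv ℝ (V s) (X s a y) (fderiv ℝ (X s a) y e) := by
  have hc : ∀ z, Continuous fun s => V s (X s a z) := fun z =>
    hV.continuous.comp (continuous_id.prodMk (hX.continuous_time a z))
  have hline : HasDerivAt (fun h : ℝ => y + h • e) e 0 := by
    simpa using ((hasDerivAt_id (0 : ℝ)).smul_const e).const_add y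
  have h1 := (intervalIntegral.hasDerivAt_integral_of_dominated_loc_of_lip (μ := volume)
    (F := fun (h : ℝ) s => V s (X s a (y + h • e))) (a := a) (b := σ)
    (F' := fun s => fderiv ℝ (V s) (X s a y) (fderiv ℝ (X s a) y e))
    (bound := fun s => K * Real.exp (K * |s - a|) * ‖e‖) (x₀ := 0) (s := univ) univ_mem
    (Eventually.of_forall fun h => (hc _).aestronglyMeasurable)
    ((hc _).intervalIntegrable _ _)
    (hX.measurable_fderiv_comp hV a y e).aestronglyMeasurable
    (Eventually.of_forall fun s _ => by
      refine LipschitzOnWith.of_dist_le_mul fun h _ h' _ => ?_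
      rw [Real.coe_nnabs, abs_of_nonneg (by positivity)]
      refine ((lipschitzWith_slice hV s).dist_le_mul _ _).trans ?_
      rw [mul_assoc (K : ℝ), mul_assoc (K : ℝ)]
      gcongr
      refine (hX.dist_le hV _ _ _ _).trans ?_
      rw [dist_add_left, dist_eq_norm, ← sub_smul, norm_smul, ← dist_eq_norm]
      apply le_of_eq
      ring)
    (by
      apply Continuous.intervalIntegrable
      fun_prop)
    (by
      filter_upwards [hy] with s hs _
      have h2 : HasFDerivAt (fun z => V s (X s a z))
          ((fderiv ℝ (V s) (X s a y)).comp (fderiv ℝ (X s a) y)) (y + (0 : ℝ) • e) := by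
        rw [zero_smul, add_zero]
        exact hs.1.hasFDerivAt.comp y hs.2.hasFDerivAt
      have h3 := h2.comp_hasDerivAt (0 : ℝ) hline
      exact h3)).2
  have h2 : HasDerivAt (fun h : ℝ => X σ a (y + h • e)) (fderiv ℝ (X σ a) y e) 0 := by
    have : HasFDerivAt (X σ a) (fderiv ℝ (X σ a) y) (y + (0 : ℝ) • e) := by
      rw [zero_smul, add_zero]
      exact hσ.hasFDerivAt
    exact this.comp_hasDerivAt (0 : ℝ) hline
  have h3 := hline.add h1
  refine h2.unique (h3.congr_of_eventuallyEq (Eventually.of_forall fun h => ?_))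
  exact hX.integral_eq hV a σ _

/-- **Liouville's formula** for the flow of a Lipschitz vector field. -/
lemma ae_det_fderiv_eq (hX : IsGlobalFlow V X)
    (hV : LipschitzWith K (fun z : ℝ × Space N => V z.1 z.2)) (a τ : ℝ) :
    ∀ᵐ y, DifferentiableAt ℝ (X τ a) y ∧ (fderiv ℝ (X τ a) y).det = flowJac V X a τ y := by
  filter_upwards [hX.ae_differentiableAt hV a, (hX.lipschitzWith hV τ a).ae_differentiableAt]
    with y hy hτ
  refine ⟨hτ, ?_⟩
  let b := (EuclideanSpace.basisFun (Fin N) ℝ).toBasis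
  -- The cutoff outside the interval makes the entries of `B A` bounded for all times.
  let A : ℝ → Matrix (Fin N) (Fin N) ℝ := fun s =>
    (uIcc a τ).indicator (fun s => LinearMap.toMatrix b b (fderiv ℝ (X s a) y).toLinearMap) s
  let B : ℝ → Matrix (Fin N) (Fin N) ℝ := fun s =>
    LinearMap.toMatrix b b (fderiv ℝ (V s) (X s a y)).toLinearMap
  have hmat : ∀ (L : Space N →L[ℝ] Space N) i j,
      LinearMap.toMatrix b b L.toLinearMap i j = L (EuclideanSpace.single j 1) i := by
    intro L i j
    simp [LinearMap.toMatrix_apply, b]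
  have hcoord : ∀ i, Measurable fun z : Space N => z i := fun i =>
    (EuclideanSpace.proj (𝕜 := ℝ) i).continuous.measurable
  have hBA : ∀ s i j, (B s * A s) i j = (uIcc a τ).indicator (fun s =>
      fderiv ℝ (V s) (X s a y) (fderiv ℝ (X s a) y (EuclideanSpace.single j 1)) i) s := by
    intro s i j
    by_cases hs : s ∈ uIcc a τ
    · simp only [A, B, indicator_of_mem hs]
      rw [← LinearMap.toMatrix_comp]
      exact hmat ((fderiv ℝ (V s) (X s a y)).comp (fderiv ℝ (X s a) y)) i j
    · simp [A, indicator_of_notMem hs]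
  -- The integral is defined and Lipschitz in `σ` at all times, also where `X σ a` is not
  -- differentiable at `y`; elsewhere on the interval it is the Jacobian matrix.
  let M : ℝ → Matrix (Fin N) (Fin N) ℝ := fun σ => Matrix.of fun i j =>
    (1 : Matrix (Fin N) (Fin N) ℝ) i j + ∫ s in a..σ, (B s * A s) i j
  have hMX : ∀ σ ∈ uIcc a τ, DifferentiableAt ℝ (X σ a) y →
      M σ = LinearMap.toMatrix b b (fderiv ℝ (X σ a) y).toLinearMap := by
    intro σ hσ hd
    ext i j
    rw [hmat, hX.fderiv_apply_eq hV hy hd]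
    simp only [M, Matrix.of_apply, PiLp.add_apply]
    congr 1
    · simp [Matrix.one_apply]
    · have hi : IntervalIntegrable (fun s => fderiv ℝ (V s) (X s a y)
          (fderiv ℝ (X s a) y (EuclideanSpace.single j 1))) volume a σ := by
        refine IntervalIntegrable.mono_fun' (g := fun s => K * (Real.exp (K * |s - a|) *
          ‖(EuclideanSpace.single j 1 : Space N)‖))
          (Continuous.intervalIntegrable (by fun_prop) _ _)
          (hX.measurable_fderiv_comp hV a y _).aestronglyMeasurable
          (Eventually.of_forall fun s => hX.norm_fderiv_comp_le hV a s y _)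
      have h1 := (EuclideanSpace.proj (𝕜 := ℝ) i).intervalIntegral_comp_comm hi
      refine Eq.trans ?_ h1
      refine intervalIntegral.integral_congr fun s hs => ?_
      refine (hBA s i j).trans (indicator_of_mem ?_ _)
      exact uIcc_subset_uIcc left_mem_uIcc hσ hs
  have hdet : ∀ L : Space N →L[ℝ] Space N,
      (LinearMap.toMatrix b b L.toLinearMap).det = L.det := fun L => LinearMap.det_toMatrix _ _
  have htr : ∀ s, (B s).trace = divergence (V s) (X s a y) := by
    intro s
    simp only [Matrix.trace, Matrix.diag_apply, divergence, B, hmat]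
  have hnorm1 : ∀ j : Fin N, ‖(EuclideanSpace.single j 1 : Space N)‖ = 1 := fun j => by
    rw [PiLp.norm_single, norm_one]
  have key := det_eq_exp_integral_trace (a := a) (τ := τ) (A := A) (B := B) (M := M)
    (C := K * (Real.exp (K * |τ - a|)))
    (fun i j => by
      simp only [B, hmat]
      exact (hcoord i).comp ((hX.measurable_fderiv_field hV a y).apply_continuousLinearMap _))
    (fun i j => by
      simp only [hBA]
      exact ((hcoord i).comp (hX.measurable_fderiv_comp hV a y _)).indicator measurableSet_uIcc)
    (fun s i j => by
      simp only [B, hmat]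
      rw [← Real.norm_eq_abs]
      refine (PiLp.norm_apply_le _ i).trans ((ContinuousLinearMap.le_opNorm _ _).trans ?_)
      rw [hnorm1, mul_one]
      exact (norm_fderiv_le_of_lipschitz ℝ (lipschitzWith_slice hV s)).trans
        (le_mul_of_one_le_right K.2 (Real.one_le_exp (by positivity))))
    (fun s i j => by
      rw [hBA]
      by_cases hs : s ∈ uIcc a τ
      · rw [indicator_of_mem hs, ← Real.norm_eq_abs]
        refine (PiLp.norm_apply_le _ i).trans ((hX.norm_fderiv_comp_le hV a s y _).trans ?_)
        rw [hnorm1, mul_one]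
        exact mul_le_mul_of_nonneg_left (Real.exp_le_exp.2
          (mul_le_mul_of_nonneg_left (abs_sub_left_of_mem_uIcc hs) K.2)) K.2
      · rw [indicator_of_notMem hs, abs_zero]
        positivity)
    (fun σ i j => rfl)
    (by
      filter_upwards [hy] with s hs hsu
      rw [hMX s hsu hs.2]
      simp only [A, indicator_of_mem hsu])
  rw [hMX τ right_mem_uIcc hτ, hdet] at key
  rw [key, flowJac]
  simp only [htr]

/-- Change of variables along the flow. -/
lemma lintegral_eq (hX : IsGlobalFlow V X)
    (hV : LipschitzWith K (fun z : ℝ × Space N => V z.1 z.2)) (a τ : ℝ)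
    (h : Space N → ENNReal) :
    ∫⁻ x, h x = ∫⁻ y, ENNReal.ofReal (flowJac V X a τ y) * h (X τ a y) := by
  have hL := hX.lipschitzWith hV τ a
  set S : Set (Space N) := {y | DifferentiableAt ℝ (X τ a) y} with hS
  have hSm : MeasurableSet S := measurableSet_of_differentiableAt ℝ (X τ a)
  have hSn : volume Sᶜ = 0 := hL.ae_differentiableAt
  have hinj : Function.Injective (X τ a) := fun x y hxy => by
    have := congrArg (X a τ) hxy
    rwa [hX.comp hV, hX.comp hV, hX.init, hX.init] at this
  have hsurj : Function.Surjective (X τ a) := fun x =>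
    ⟨X a τ x, by rw [hX.comp hV, hX.init]⟩
  -- The area formula applies on the set of differentiability; the complement of that set and its
  -- image are both null.
  have h1 := lintegral_image_eq_lintegral_abs_det_fderiv_mul volume hSm
    (f' := fun y => fderiv ℝ (X τ a) y)
    (fun y hy => (DifferentiableAt.hasFDerivAt hy).hasFDerivWithinAt) hinj.injOn h
  have h2 : volume (X τ a '' S)ᶜ = 0 := by
    rw [← image_compl_eq ⟨hinj, hsurj⟩]
    exact measure_image_eq_zero_of_lipschitzWith hL hSn
  rw [Measure.restrict_eq_self_of_ae_mem (compl_mem_ae_iff.1 (by rwa [compl_compl]) : _),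
    Measure.restrict_eq_self_of_ae_mem (show ∀ᵐ y, y ∈ S from hL.ae_differentiableAt)] at h1
  rw [h1]
  refine lintegral_congr_ae ?_
  filter_upwards [hX.ae_det_fderiv_eq hV a τ] with y hy
  rw [hy.2, abs_of_pos (flowJac_pos V X a τ y)]

end IsGlobalFlow

end Measure

/-! ### Entropy balance on a single characteristic. -/

section Line

lemma lipschitzWith_integral_of_bounded {g : ℝ → ℝ} {C : ℝ} (hg : Measurable g)
    (hgb : ∀ s, |g s| ≤ C) (a : ℝ) :
    LocallyIntegrable g volume ∧ (∀ x y, IntervalIntegrable g volume x y) ∧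
      LipschitzWith C.toNNReal (fun σ => ∫ s in a..σ, g s) := by
  have h1 : LocallyIntegrable g volume :=
    (locallyIntegrable_const C).mono hg.aestronglyMeasurable
      (Eventually.of_forall fun s => (hgb s).trans (le_abs_self C))
  have h2 : ∀ x y, IntervalIntegrable g volume x y := fun x y =>
    intervalIntegrable_iff.2 ((h1.integrableOn_isCompact isCompact_uIcc).mono_set uIoc_subset_uIcc)
  refine ⟨h1, h2, LipschitzWith.of_dist_le_mul fun x y => ?_⟩
  rw [Real.dist_eq, intervalIntegral.integral_interval_sub_left (h2 _ _) (h2 _ _),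
    Real.coe_toNNReal _ ((abs_nonneg _).trans (hgb 0)), Real.dist_eq]
  exact intervalIntegral.norm_integral_le_of_norm_le_const (f := g) fun s _ => hgb s

lemma LocallyLipschitz.real_mul {α : Type*} [PseudoEMetricSpace α] {f g : α → ℝ}
    (hf : LocallyLipschitz f) (hg : LocallyLipschitz g) : LocallyLipschitz fun x => f x * g x := by
  have h : ContDiff ℝ 1 fun p : ℝ × ℝ => p.1 * p.2 := contDiff_fst.mul contDiff_snd
  exact h.locallyLipschitz.comp (hf.prodMk hg)

lemma LocallyLipschitz.absolutelyContinuousOnInterval {f : ℝ → ℝ} (hf : LocallyLipschitz f)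
    (a b : ℝ) : AbsolutelyContinuousOnInterval f a b := by
  obtain ⟨K, hK⟩ := (hf.locallyLipschitzOn (s := uIcc a b)).exists_lipschitzOnWith_of_compact
    isCompact_uIcc
  exact hK.absolutelyContinuousOnInterval

/-- The entropy balance along one characteristic. -/
lemma integral_entropy_along_line {a b r k C : ℝ} {g ψ ψ' : ℝ → ℝ} (hab : a ≤ b)
    (hg : Measurable g) (hgb : ∀ s, |g s| ≤ C) (hψ : ∀ s, HasDerivAt ψ (ψ' s) s)
    (hψ' : Continuous ψ') (ha : ψ a = 0) (hb : ψ b = 0) :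
    ∫ s in Icc a b, Real.exp (∫ u in a..s, g u) *
      (|r * Real.exp (-∫ u in a..s, g u) - k| * ψ' s -
        Real.sign (r * Real.exp (-∫ u in a..s, g u) - k) * (k * g s) * ψ s) = 0 := by
  obtain ⟨h1, -, h3⟩ := lipschitzWith_integral_of_bounded hg hgb a
  set J : ℝ → ℝ := fun s => Real.exp (∫ u in a..s, g u) with hJ
  have hJpos : ∀ s, 0 < J s := fun s => Real.exp_pos _
  -- Multiplication by `J` turns `|r / J - k|` into `|q|`, and `q' = -k J g`. The integrand is
  -- therefore the derivative of `|q| ψ`, which vanishes at both ends.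
  set q : ℝ → ℝ := fun s => r - k * J s with hq
  have hJL : LocallyLipschitz J :=
    (Real.contDiff_exp.locallyLipschitz (𝕂 := ℝ)).comp h3.locallyLipschitz
  have hqL : LocallyLipschitz q := by
    have : ContDiff ℝ 1 fun x : ℝ => r - k * x := by fun_prop
    exact this.locallyLipschitz.comp hJL
  have hqaL : LocallyLipschitz fun s => |q s| :=
    (LipschitzWith.of_dist_le_mul (K := 1) (fun x y => by
      simpa [Real.dist_eq] using abs_abs_sub_abs_le_abs_sub x y)
      : LipschitzWith 1 fun x : ℝ => |x|).locallyLipschitz.comp hqL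
  have hψc : ContDiff ℝ 1 ψ := by
    rw [contDiff_one_iff_deriv]
    refine ⟨fun s => (hψ s).differentiableAt, ?_⟩
    rw [show deriv ψ = ψ' from funext fun s => (hψ s).deriv]
    exact hψ'
  have hf := (hqaL.real_mul hψc.locallyLipschitz).absolutelyContinuousOnInterval a b
  have hFTC := hf.integral_deriv_eq_sub
  rw [ha, hb, mul_zero, mul_zero, sub_zero, intervalIntegral.integral_of_le hab,
    ← integral_Icc_eq_integral_Ioc] at hFTC
  rw [← hFTC]
  refine setIntegral_congr_ae measurableSet_Icc ?_
  filter_upwards [LocallyIntegrable.ae_hasDerivAt_integral h1,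
    (hqaL.absolutelyContinuousOnInterval a b).ae_differentiableAt] with s hs1 hs2 hs
  have hJd : HasDerivAt J (J s * g s) s := (hs1 a).exp
  have hqd : HasDerivAt q (-(k * (J s * g s))) s := (hJd.const_mul k).const_sub r
  have hqad : HasDerivAt (fun s => |q s|) (Real.sign (q s) * -(k * (J s * g s))) s := by
    rcases lt_trichotomy (q s) 0 with h | h | h
    · rw [Real.sign_of_neg h]
      have : (fun s => |q s|) =ᶠ[𝓝 s] fun s => - q s := by
        filter_upwards [hqL.continuous.continuousAt.eventually_lt continuousAt_const h] with u hu
        exact abs_of_neg hu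
      rw [neg_one_mul]
      exact hqd.neg.congr_of_eventuallyEq this
    · rw [h, Real.sign_zero, zero_mul]
      have hd := (hs2 (by rwa [uIcc_of_le hab])).hasDerivAt
      -- A zero of `q` is a minimum of `|q|`, so the derivative there, when it exists, is 0. This
      -- agrees with the convention `sign 0 = 0`.
      have : IsLocalMin (fun s => |q s|) s :=
        Eventually.of_forall fun u => by simp only [h, abs_zero]; exact abs_nonneg _
      rwa [this.hasDerivAt_eq_zero hd] at hd
    · rw [Real.sign_of_pos h, one_mul]
      have : (fun s => |q s|) =ᶠ[𝓝 s] q := by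
        filter_upwards [continuousAt_const.eventually_lt hqL.continuous.continuousAt h] with u hu
        exact abs_of_pos hu
      exact hqd.congr_of_eventuallyEq this
  have hfin := (hqad.mul (hψ s)).deriv
  have e1 : r * Real.exp (-∫ u in a..s, g u) - k = q s / J s := by
    rw [Real.exp_neg]
    change r * (J s)⁻¹ - k = (r - k * J s) / J s
    have := (hJpos s).ne'
    field_simp
  have e2 : Real.sign (q s / J s) = Real.sign (q s) := by
    rcases lt_trichotomy (q s) 0 with h | h | h
    · rw [Real.sign_of_neg h, Real.sign_of_neg (div_neg_of_neg_of_pos h (hJpos s))]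
    · rw [h, zero_div]
    · rw [Real.sign_of_pos h, Real.sign_of_pos (div_pos h (hJpos s))]
  rw [e1, e2, abs_div, abs_of_pos (hJpos s)]
  refine Eq.trans ?_ hfin.symm
  have := (hJpos s).ne'
  field_simp
  ring

end Line

/-! ### The transported density: mass and entropy. -/

section Density

variable {N : ℕ} {V : ℝ → Space N → Space N} {X : ℝ → ℝ → Space N → Space N} {K : NNReal}

namespace IsGlobalFlow

lemma measurable_divergence_comp (hX : IsGlobalFlow V X)
    (hV : LipschitzWith K (fun z : ℝ × Space N => V z.1 z.2)) (a : ℝ) :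
    Measurable fun z : ℝ × Space N => divergence (V z.1) (X z.1 a z.2) :=
  (measurable_divergence hV.continuous).comp
    (measurable_fst.prodMk (hX.continuous hV a).measurable)

lemma continuous_flowJac_time (hX : IsGlobalFlow V X)
    (hV : LipschitzWith K (fun z : ℝ × Space N => V z.1 z.2)) (a : ℝ) (y : Space N) :
    Continuous fun τ => flowJac V X a τ y :=
  Real.continuous_exp.comp (lipschitzWith_integral_of_bounded
    ((hX.measurable_divergence_comp hV a).comp (measurable_id.prodMk measurable_const))
    (fun s => abs_divergence_le (lipschitzWith_slice hV s) _) a).2.2.continuous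

lemma measurable_flowJac (hX : IsGlobalFlow V X)
    (hV : LipschitzWith K (fun z : ℝ × Space N => V z.1 z.2)) (a : ℝ) :
    Measurable fun z : ℝ × Space N => flowJac V X a z.1 z.2 := by
  refine measurable_uncurry_of_continuous_of_measurable (u := fun τ y => flowJac V X a τ y)
    (hX.continuous_flowJac_time hV a) fun τ => ?_
  refine Real.measurable_exp.comp ?_
  have h : StronglyMeasurable (Function.uncurry fun (y : Space N) (s : ℝ) =>
      divergence (V s) (X s a y)) :=
    ((hX.measurable_divergence_comp hV a).comp measurable_swap).stronglyMeasurable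
  simp only [intervalIntegral]
  exact (h.integral_prod_right.sub h.integral_prod_right).measurable

lemma abs_log_flowJac_sub_le (hX : IsGlobalFlow V X)
    (hV : LipschitzWith K (fun z : ℝ × Space N => V z.1 z.2)) (a τ s : ℝ) (y : Space N) :
    |(∫ u in a..τ, divergence (V u) (X u a y)) - ∫ u in a..s, divergence (V u) (X u a y)| ≤
      N * K * |τ - s| := by
  have := (lipschitzWith_integral_of_bounded
    ((hX.measurable_divergence_comp hV a).comp (measurable_id.prodMk measurable_const))
    (fun s => abs_divergence_le (lipschitzWith_slice hV s) (X s a y)) a).2.2.dist_le_mul τ s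
  rwa [Real.coe_toNNReal _ (by positivity)] at this

lemma flowJac_le (hX : IsGlobalFlow V X)
    (hV : LipschitzWith K (fun z : ℝ × Space N => V z.1 z.2)) (a τ : ℝ) (y : Space N) :
    flowJac V X a τ y ≤ Real.exp (N * K * |τ - a|) := by
  have := hX.abs_log_flowJac_sub_le hV a τ a y
  rw [intervalIntegral.integral_same, sub_zero] at this
  exact Real.exp_le_exp.2 ((le_abs_self _).trans this)

lemma charDensity_eq (hX : IsGlobalFlow V X)
    (hV : LipschitzWith K (fun z : ℝ × Space N => V z.1 z.2)) (a : ℝ) (r : Space N → ℝ) (τ : ℝ)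
    (x : Space N) :
    charDensity V X a r τ x = r (X a τ x) * (flowJac V X a τ (X a τ x))⁻¹ := by
  simp only [charDensity, flowJac, ← Real.exp_neg, hX.comp hV]

lemma charDensity_flow (hX : IsGlobalFlow V X)
    (hV : LipschitzWith K (fun z : ℝ × Space N => V z.1 z.2)) (a : ℝ) (r : Space N → ℝ) (τ : ℝ)
    (y : Space N) :
    charDensity V X a r τ (X τ a y) = r y * (flowJac V X a τ y)⁻¹ := by
  rw [hX.charDensity_eq hV, hX.comp hV, hX.init]

lemma ofReal_mul_enorm_div (J c : ℝ) (hJ : 0 < J) :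
    ENNReal.ofReal J * ‖c * J⁻¹‖ₑ = ‖c‖ₑ := by
  rw [enorm_mul, mul_left_comm, ← Real.enorm_of_nonneg hJ.le, ← enorm_mul,
    mul_inv_cancel₀ hJ.ne']
  simp

/-- Conservation of mass: the Jacobian of the change of variables cancels the factor `1 / J` of the
density. -/
lemma lintegral_enorm_charDensity (hX : IsGlobalFlow V X)
    (hV : LipschitzWith K (fun z : ℝ × Space N => V z.1 z.2)) (a : ℝ) (r : Space N → ℝ) (τ : ℝ) :
    ∫⁻ x, ‖charDensity V X a r τ x‖ₑ = ∫⁻ y, ‖r y‖ₑ := by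
  rw [hX.lintegral_eq hV a τ]
  refine lintegral_congr fun y => ?_
  rw [hX.charDensity_flow hV, ofReal_mul_enorm_div _ _ (flowJac_pos V X a τ y)]

lemma quasiMeasurePreserving_inv (hX : IsGlobalFlow V X)
    (hV : LipschitzWith K (fun z : ℝ × Space N => V z.1 z.2)) (a : ℝ) :
    Measure.QuasiMeasurePreserving (fun z : ℝ × Space N => X a z.1 z.2) :=
  QuasiMeasurePreserving.prod_of_right
    (hX.locallyLipschitz_inv hV a).continuous.measurable
    (Eventually.of_forall fun τ => hX.quasiMeasurePreserving hV a τ)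

lemma measurable_flowJac_inv (hX : IsGlobalFlow V X)
    (hV : LipschitzWith K (fun z : ℝ × Space N => V z.1 z.2)) (a : ℝ) :
    Measurable fun z : ℝ × Space N => flowJac V X a z.1 (X a z.1 z.2) :=
  (hX.measurable_flowJac hV a).comp
    (measurable_fst.prodMk (hX.locallyLipschitz_inv hV a).continuous.measurable)

lemma aestronglyMeasurable_charDensity (hX : IsGlobalFlow V X)
    (hV : LipschitzWith K (fun z : ℝ × Space N => V z.1 z.2)) (a : ℝ) {r : Space N → ℝ}
    (hr : AEStronglyMeasurable r) :
    AEStronglyMeasurable (fun z : ℝ × Space N => charDensity V X a r z.1 z.2) := by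
  simp only [hX.charDensity_eq hV]
  exact (hr.comp_quasiMeasurePreserving (hX.quasiMeasurePreserving_inv hV a)).mul
    (hX.measurable_flowJac_inv hV a).inv.aestronglyMeasurable

lemma integrable_charDensity (hX : IsGlobalFlow V X)
    (hV : LipschitzWith K (fun z : ℝ × Space N => V z.1 z.2)) (a : ℝ) {r : Space N → ℝ}
    (hr : Integrable r) (τ : ℝ) : Integrable (charDensity V X a r τ) := by
  refine ⟨?_, ?_⟩
  · have h1 : charDensity V X a r τ = fun x => r (X a τ x) * (flowJac V X a τ (X a τ x))⁻¹ :=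
      funext fun x => hX.charDensity_eq hV a r τ x
    rw [h1]
    exact (hr.1.comp_quasiMeasurePreserving (hX.quasiMeasurePreserving hV a τ)).mul
      ((hX.measurable_flowJac_inv hV a).comp
        (measurable_const.prodMk measurable_id)).inv.aestronglyMeasurable
  · rw [HasFiniteIntegral, hX.lintegral_enorm_charDensity hV]
    exact hr.2

lemma integrableOn_charDensity (hX : IsGlobalFlow V X)
    (hV : LipschitzWith K (fun z : ℝ × Space N => V z.1 z.2)) (a b c : ℝ) {r : Space N → ℝ}
    (hr : Integrable r) :
    IntegrableOn (fun z : ℝ × Space N => charDensity V X a r z.1 z.2) (Icc b c ×ˢ univ) := by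
  have hm := hX.aestronglyMeasurable_charDensity hV a hr.1
  refine ⟨hm.restrict, ?_⟩
  rw [HasFiniteIntegral, Measure.volume_eq_prod, ← Measure.prod_restrict, Measure.restrict_univ,
    lintegral_prod]
  · simp only [hX.lintegral_enorm_charDensity hV, lintegral_const]
    exact ENNReal.mul_lt_top hr.2 (by simp)
  · have := hm.enorm.restrict (s := Icc b c ×ˢ (univ : Set (Space N)))
    rwa [Measure.volume_eq_prod, ← Measure.prod_restrict, Measure.restrict_univ] at this

/-- The map `(s, y) ↦ (s, X s a y)` as a homeomorphism of space-time. -/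
def spaceTimeHomeomorph (hX : IsGlobalFlow V X)
    (hV : LipschitzWith K (fun z : ℝ × Space N => V z.1 z.2)) (a : ℝ) :
    ℝ × Space N ≃ₜ ℝ × Space N where
  toFun z := (z.1, X z.1 a z.2)
  invFun z := (z.1, X a z.1 z.2)
  left_inv z := by simp only [hX.comp hV, hX.init]
  right_inv z := by simp only [hX.comp hV, hX.init]
  continuous_toFun := continuous_fst.prodMk (hX.continuous hV a)
  continuous_invFun := continuous_fst.prodMk (hX.locallyLipschitz_inv hV a).continuous

/-- Space-time integrals pass to Lagrangian coordinates at the price of the density `flowJac`; on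
each time slice this is `lintegral_eq`. -/
lemma measurePreserving_spaceTime (hX : IsGlobalFlow V X)
    (hV : LipschitzWith K (fun z : ℝ × Space N => V z.1 z.2)) (a : ℝ) :
    MeasurePreserving (hX.spaceTimeHomeomorph hV a)
      (volume.withDensity fun z => ENNReal.ofReal (flowJac V X a z.1 z.2)) volume := by
  have hm := (hX.spaceTimeHomeomorph hV a).continuous.measurable
  have hJ := (hX.measurable_flowJac hV a).ennreal_ofReal
  refine ⟨hm, Measure.ext fun s hs => ?_⟩
  rw [Measure.map_apply hm hs, withDensity_apply _ (hm hs), ← lintegral_indicator (hm hs),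
    ← lintegral_indicator_one hs, Measure.volume_eq_prod,
    lintegral_prod _ (hJ.indicator (hm hs)).aemeasurable,
    lintegral_prod _ (measurable_one.indicator hs).aemeasurable]
  refine lintegral_congr fun τ => ?_
  rw [hX.lintegral_eq hV a τ (fun y => s.indicator 1 (τ, y))]
  refine lintegral_congr fun y => ?_
  by_cases h : (τ, X τ a y) ∈ s
  · rw [indicator_of_mem h, indicator_of_mem (show (τ, y) ∈ (hX.spaceTimeHomeomorph hV a) ⁻¹' s from h)]
    simp
  · rw [indicator_of_notMem h, indicator_of_notMem (show (τ, y) ∉ (hX.spaceTimeHomeomorph hV a) ⁻¹' s from h)]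
    simp

/-- The entropy balance of the density transported along the characteristics. -/
lemma integral_entropy_charDensity (hX : IsGlobalFlow V X)
    (hV : LipschitzWith K (fun z : ℝ × Space N => V z.1 z.2)) {a b : ℝ} (hab : a ≤ b)
    (r : Space N → ℝ) (k : ℝ) {φ : ℝ × Space N → ℝ} (hφ : ContDiff ℝ (⊤ : ℕ∞) φ)
    (hφs : tsupport φ ⊆ Ioo a b ×ˢ univ) :
    ∫ z in Icc a b ×ˢ (univ : Set (Space N)),
      (|charDensity V X a r z.1 z.2 - k| * fderiv ℝ φ z (1, V z.1 z.2)
        - Real.sign (charDensity V X a r z.1 z.2 - k) * (k * divergence (V z.1) z.2) * φ z) = 0 := by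
  -- The integral of a non-integrable function is 0 by convention, so Fubini's theorem is needed in
  -- the integrable case only.
  by_cases hI : IntegrableOn (fun z : ℝ × Space N =>
    (|charDensity V X a r z.1 z.2 - k| * fderiv ℝ φ z (1, V z.1 z.2)
      - Real.sign (charDensity V X a r z.1 z.2 - k) * (k * divergence (V z.1) z.2) * φ z))
    (Icc a b ×ˢ univ)
  swap
  · exact integral_undef hI
  have mp := hX.measurePreserving_spaceTime hV a
  have hme := (hX.spaceTimeHomeomorph hV a).measurableEmbedding
  have hpre : (hX.spaceTimeHomeomorph hV a) ⁻¹' (Icc a b ×ˢ univ) = Icc a b ×ˢ univ := by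
    ext z; simp [spaceTimeHomeomorph]
  have hms : MeasurableSet (Icc a b ×ˢ (univ : Set (Space N))) :=
    measurableSet_Icc.prod MeasurableSet.univ
  have hJ := (hX.measurable_flowJac hV a).ennreal_ofReal
  have hJfin : ∀ᵐ z ∂(volume.restrict (Icc a b ×ˢ (univ : Set (Space N)))),
      ENNReal.ofReal (flowJac V X a z.1 z.2) < ⊤ := Eventually.of_forall fun z => ENNReal.ofReal_lt_top
  have hI2 := (mp.integrableOn_comp_preimage hme).2 hI
  rw [hpre, IntegrableOn, restrict_withDensity hms,
    integrable_withDensity_iff_integrable_smul' hJ hJfin] at hI2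
  rw [← mp.setIntegral_preimage_emb hme, hpre, restrict_withDensity hms,
    integral_withDensity_eq_integral_toReal_smul hJ hJfin]
  rw [Measure.volume_eq_prod, ← Measure.prod_restrict, Measure.restrict_univ] at hI2 ⊢
  -- Integrating in time first isolates one characteristic for each `y`, and each contributes zero
  -- on its own.
  refine (integral_prod_symm _ hI2).trans ?_
  refine integral_eq_zero_of_ae (Eventually.of_forall fun y => ?_)
  have hend : ∀ s, s ∉ Ioo a b → ∀ x, φ (s, x) = 0 := fun s hs x => by
    by_contra h
    exact hs (hφs (subset_tsupport _ h)).1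
  have hφd : Differentiable ℝ φ := hφ.differentiable (by simp)
  have hcurve : ∀ s, HasDerivAt (fun s => (s, X s a y)) ((1 : ℝ), V s (X s a y)) s := fun s =>
    (hasDerivAt_id s).prodMk (hX.deriv a y s)
  have := integral_entropy_along_line (a := a) (b := b) (r := r y) (k := k)
    (g := fun s => divergence (V s) (X s a y)) (ψ := fun s => φ (s, X s a y))
    (ψ' := fun s => fderiv ℝ φ (s, X s a y) (1, V s (X s a y))) hab
    ((hX.measurable_divergence_comp hV a).comp (measurable_id.prodMk measurable_const))
    (fun s => abs_divergence_le (lipschitzWith_slice hV s) _)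
    (fun s => (hφd _).hasFDerivAt.comp_hasDerivAt s (hcurve s))
    (by
      have h1 := hX.continuous_time a y
      have h2 : Continuous fun s => V s (X s a y) := hV.continuous.comp (continuous_id.prodMk h1)
      exact ((hφ.continuous_fderiv (by simp)).comp (continuous_id.prodMk h1)).clm_apply
        (continuous_const.prodMk h2))
    (hend a (by simp) _) (hend b (by simp) _)
  refine Eq.trans (integral_congr_ae (Eventually.of_forall fun s => ?_)) this
  simp only [spaceTimeHomeomorph, Homeomorph.homeomorph_mk_coe, Equiv.coe_fn_mk, smul_eq_mul,
    Function.comp_apply]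
  rw [hX.charDensity_flow hV, ENNReal.toReal_ofReal (flowJac_pos V X a s y).le, flowJac,
    ← Real.exp_neg]

end IsGlobalFlow

end Density

/-! ### Continuity in time with values in `L^1`. -/

section ContinuityL1

variable {N : ℕ} {V : ℝ → Space N → Space N} {X : ℝ → ℝ → Space N → Space N} {K : NNReal}

lemma abs_exp_sub_one_le_exp_abs_sub_one (u : ℝ) : |Real.exp u - 1| ≤ Real.exp |u| - 1 := by
  rcases le_total 0 u with h | h
  · rw [abs_of_nonneg h, abs_of_nonneg (by linarith [Real.one_le_exp h])]
  · rw [abs_of_nonpos h, abs_of_nonpos (by linarith [Real.exp_le_one_iff.2 h])]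
    linarith [Real.add_one_le_exp u, Real.add_one_le_exp (-u)]

namespace IsGlobalFlow

lemma lintegral_comp_inv (hX : IsGlobalFlow V X)
    (hV : LipschitzWith K (fun z : ℝ × Space N => V z.1 z.2)) (a τ : ℝ) (h : Space N → ENNReal) :
    ∫⁻ x, h (X a τ x) = ∫⁻ y, ENNReal.ofReal (flowJac V X a τ y) * h y := by
  rw [hX.lintegral_eq hV a τ]
  simp only [hX.comp hV, hX.init]

lemma lintegral_comp_inv_le (hX : IsGlobalFlow V X)
    (hV : LipschitzWith K (fun z : ℝ × Space N => V z.1 z.2)) (a τ : ℝ) (h : Space N → ENNReal) :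
    ∫⁻ x, h (X a τ x) ≤ ENNReal.ofReal (Real.exp (N * K * |τ - a|)) * ∫⁻ y, h y := by
  rw [hX.lintegral_comp_inv hV, ← lintegral_const_mul' _ _ ENNReal.ofReal_ne_top]
  refine lintegral_mono fun y => ?_
  gcongr
  exact hX.flowJac_le hV a τ y

/-- Composition with the flow is continuous in `L^1`. -/
lemma tendsto_lintegral_comp_inv_sub (hX : IsGlobalFlow V X)
    (hV : LipschitzWith K (fun z : ℝ × Space N => V z.1 z.2)) (a s : ℝ) {g : Space N → ℝ}
    (hg : Integrable g) :
    Tendsto (fun τ => ∫⁻ x, ‖g (X a τ x) - g (X a s x)‖ₑ) (𝓝 s) (𝓝 0) := by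
  have hcts : ∀ g₀ : Space N → ℝ, Continuous g₀ → HasCompactSupport g₀ →
      Tendsto (fun τ => ∫⁻ x, ‖g₀ (X a τ x) - g₀ (X a s x)‖ₑ) (𝓝 s) (𝓝 0) := by
    intro g₀ hc hs
    have hinv := (hX.locallyLipschitz_inv hV a).continuous
    obtain ⟨M, hM⟩ := hs.exists_bound_of_continuous hc
    -- The flow carries the support into one compact set during the whole time window, which gives
    -- an integrable dominating function.
    set S : Set (Space N) := (fun z : ℝ × Space N => X z.1 a z.2) ''
      (Icc (s - 1) (s + 1) ×ˢ tsupport g₀) with hS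
    have hSc : IsCompact S := (isCompact_Icc.prod hs).image (hX.continuous hV a)
    have hz : ∀ τ ∈ Icc (s - 1) (s + 1), ∀ x ∉ S, g₀ (X a τ x) = 0 := by
      intro τ hτ x hx
      by_contra h
      exact hx ⟨(τ, X a τ x), ⟨hτ, subset_tsupport _ h⟩, by simp only [hX.comp hV, hX.init]⟩
    have hlim := tendsto_lintegral_filter_of_dominated_convergence (μ := volume) (l := 𝓝 s)
      (F := fun τ x => ‖g₀ (X a τ x) - g₀ (X a s x)‖ₑ) (f := fun _ => 0)
      (S.indicator fun _ => ENNReal.ofReal (2 * M))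
      (Eventually.of_forall fun τ => by
        have h1 : Continuous fun x => X a τ x := hinv.comp (continuous_const.prodMk continuous_id)
        have h2 : Continuous fun x => X a s x := hinv.comp (continuous_const.prodMk continuous_id)
        exact ((hc.comp h1).sub (hc.comp h2)).enorm.measurable)
      (by
        filter_upwards [Icc_mem_nhds (by linarith : s - 1 < s) (by linarith : s < s + 1)] with τ hτ
        refine Eventually.of_forall fun x => ?_
        by_cases hx : x ∈ S
        · rw [indicator_of_mem hx, ← ofReal_norm]
          refine ENNReal.ofReal_le_ofReal ((norm_sub_le _ _).trans ?_)
          linarith [hM (X a τ x), hM (X a s x)]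
        · rw [hz τ hτ x hx, hz s ⟨by linarith, by linarith⟩ x hx]
          simp)
      (by
        rw [lintegral_indicator hSc.measurableSet, setLIntegral_const]
        exact ENNReal.mul_ne_top ENNReal.ofReal_ne_top hSc.measure_lt_top.ne)
      (Eventually.of_forall fun x => by
        have h1 : Continuous fun τ => ‖g₀ (X a τ x) - g₀ (X a s x)‖ₑ :=
          ((hc.comp (hinv.comp (continuous_id.prodMk continuous_const))).sub
            continuous_const).enorm
        simpa using h1.tendsto s)
    simpa using hlim
  rw [ENNReal.tendsto_nhds_zero]
  intro ε hε
  -- This bounds the Jacobian for all `|τ - s| < 1`; composing with the flow thus enlarges the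
  -- approximation error of `g₀` by at most the factor `c`.
  set c : ENNReal := ENNReal.ofReal (Real.exp (N * K * (|s - a| + 1))) with hc
  have hc0 : c ≠ 0 := (ENNReal.ofReal_pos.2 (Real.exp_pos _)).ne'
  have hε3 : ε / 3 ≠ 0 := (ENNReal.div_pos hε.ne' (by simp)).ne'
  obtain ⟨g₀, hs, hle, hcont, -⟩ := hg.exists_hasCompactSupport_lintegral_sub_le
    (ε := ε / 3 / c) (ENNReal.div_pos hε3 ENNReal.ofReal_ne_top).ne'
  have hg₀m : AEStronglyMeasurable (g - g₀) := hg.1.sub hcont.aestronglyMeasurable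
  have hb : ∀ τ, |τ - s| < 1 → ∫⁻ x, ‖g (X a τ x) - g₀ (X a τ x)‖ₑ ≤ ε / 3 := by
    intro τ hτ
    refine (hX.lintegral_comp_inv_le hV a τ (fun y => ‖g y - g₀ y‖ₑ)).trans ?_
    calc _ ≤ c * (ε / 3 / c) := by
          gcongr
          rw [hc]
          gcongr
          linarith [abs_sub_le τ s a]
      _ = ε / 3 := ENNReal.mul_div_cancel hc0 ENNReal.ofReal_ne_top
  filter_upwards [ENNReal.tendsto_nhds_zero.1 (hcts g₀ hcont hs) (ε / 3) (pos_iff_ne_zero.2 hε3),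
    Metric.ball_mem_nhds s one_pos] with τ h1 h2
  rw [Metric.mem_ball, Real.dist_eq] at h2
  have hm : ∀ τ, AEMeasurable fun x => ‖g (X a τ x) - g₀ (X a τ x)‖ₑ := fun τ =>
    (hg₀m.comp_quasiMeasurePreserving (hX.quasiMeasurePreserving hV a τ)).enorm
  have hm2 : AEMeasurable fun x => ‖g₀ (X a τ x) - g₀ (X a s x)‖ₑ :=
    ((hcont.comp (hX.lipschitzWith hV a τ).continuous).sub
      (hcont.comp (hX.lipschitzWith hV a s).continuous)).enorm.measurable.aemeasurable
  calc ∫⁻ x, ‖g (X a τ x) - g (X a s x)‖ₑ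
      ≤ ∫⁻ x, (‖g (X a τ x) - g₀ (X a τ x)‖ₑ + ‖g₀ (X a τ x) - g₀ (X a s x)‖ₑ +
          ‖g (X a s x) - g₀ (X a s x)‖ₑ) := by
        refine lintegral_mono fun x => ?_
        have : g (X a τ x) - g (X a s x) = (g (X a τ x) - g₀ (X a τ x)) +
          (g₀ (X a τ x) - g₀ (X a s x)) - (g (X a s x) - g₀ (X a s x)) := by ring
        rw [this]
        exact enorm_sub_le.trans (add_le_add_left (enorm_add_le _ _) _)
    _ = (∫⁻ x, ‖g (X a τ x) - g₀ (X a τ x)‖ₑ) + (∫⁻ x, ‖g₀ (X a τ x) - g₀ (X a s x)‖ₑ) +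
          ∫⁻ x, ‖g (X a s x) - g₀ (X a s x)‖ₑ := by
        rw [lintegral_add_right' _ (hm s), lintegral_add_left' (hm τ)]
    _ ≤ ε / 3 + ε / 3 + ε / 3 := by
        gcongr
        · exact hb τ h2
        · exact hb s (by simp)
    _ = ε := ENNReal.add_thirds ε

/-- Between `(r / J_τ) ∘ X a τ` and `(r / J_s) ∘ X a s` the function `(r / J_s) ∘ X a τ` is
inserted. In Lagrangian coordinates the first difference costs `|1 - J_τ / J_s| ≤ exp (N K |τ - s|)
- 1`; the second tends to zero by continuity of composition with the flow. -/
lemma tendsto_lintegral_charDensity_sub (hX : IsGlobalFlow V X)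
    (hV : LipschitzWith K (fun z : ℝ × Space N => V z.1 z.2)) (a s : ℝ) {r : Space N → ℝ}
    (hr : Integrable r) :
    Tendsto (fun τ => ∫⁻ x, ‖charDensity V X a r τ x - charDensity V X a r s x‖ₑ) (𝓝 s) (𝓝 0) := by
  set f : Space N → ℝ := fun y => r y * (flowJac V X a s y)⁻¹ with hf
  have hJm : ∀ τ, Measurable fun y => flowJac V X a τ y := fun τ =>
    (hX.measurable_flowJac hV a).comp (measurable_const.prodMk measurable_id)
  have hfi : Integrable f := by
    refine hr.mul_bdd (c := Real.exp (N * K * |s - a|)) (hJm s).inv.aestronglyMeasurable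
      (Eventually.of_forall fun y => ?_)
    rw [Real.norm_of_nonneg (inv_nonneg.2 (flowJac_pos V X a s y).le), flowJac, ← Real.exp_neg]
    have := hX.abs_log_flowJac_sub_le hV a s a y
    rw [intervalIntegral.integral_same, sub_zero] at this
    exact Real.exp_le_exp.2 ((neg_le_abs _).trans this)
  have h1 : Tendsto (fun τ => ENNReal.ofReal (Real.exp (N * K * |τ - s|) - 1) * ∫⁻ y, ‖r y‖ₑ)
      (𝓝 s) (𝓝 0) := by
    have hc : Continuous fun τ => ENNReal.ofReal (Real.exp (N * K * |τ - s|) - 1) :=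
      ENNReal.continuous_ofReal.comp (by fun_prop)
    have := ENNReal.Tendsto.mul_const (b := ∫⁻ y, ‖r y‖ₑ) (hc.tendsto s) (Or.inr hr.2.ne)
    simpa using this
  have h2 := h1.add (hX.tendsto_lintegral_comp_inv_sub hV a s hfi)
  rw [add_zero] at h2
  refine tendsto_of_tendsto_of_tendsto_of_le_of_le tendsto_const_nhds h2 (fun _ => zero_le)
    fun τ => ?_
  simp only
  calc ∫⁻ x, ‖charDensity V X a r τ x - charDensity V X a r s x‖ₑ
      ≤ ∫⁻ x, (‖r (X a τ x) * ((flowJac V X a τ (X a τ x))⁻¹ -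
          (flowJac V X a s (X a τ x))⁻¹)‖ₑ + ‖f (X a τ x) - f (X a s x)‖ₑ) := by
        refine lintegral_mono fun x => ?_
        refine le_trans (le_of_eq ?_) (enorm_add_le _ _)
        rw [hX.charDensity_eq hV, hX.charDensity_eq hV]
        simp only [hf]
        ring_nf
    _ = (∫⁻ x, ‖r (X a τ x) * ((flowJac V X a τ (X a τ x))⁻¹ -
          (flowJac V X a s (X a τ x))⁻¹)‖ₑ) + ∫⁻ x, ‖f (X a τ x) - f (X a s x)‖ₑ := by
        refine lintegral_add_left' ?_ _
        exact ((hr.1.mul ((hJm τ).inv.sub (hJm s).inv).aestronglyMeasurable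
          ).comp_quasiMeasurePreserving (hX.quasiMeasurePreserving hV a τ)).enorm
    _ ≤ _ := by
        gcongr
        rw [hX.lintegral_comp_inv hV a τ (fun y => ‖r y * ((flowJac V X a τ y)⁻¹ -
          (flowJac V X a s y)⁻¹)‖ₑ), ← lintegral_const_mul' _ _ ENNReal.ofReal_ne_top]
        refine lintegral_mono fun y => ?_
        rw [enorm_mul, mul_left_comm, mul_comm (ENNReal.ofReal (_ - 1))]
        gcongr
        rw [← Real.enorm_of_nonneg (flowJac_pos V X a τ y).le, ← enorm_mul, ← ofReal_norm]
        refine ENNReal.ofReal_le_ofReal ?_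
        have e1 : flowJac V X a τ y * ((flowJac V X a τ y)⁻¹ - (flowJac V X a s y)⁻¹) =
            -(Real.exp ((∫ u in a..τ, divergence (V u) (X u a y)) -
              ∫ u in a..s, divergence (V u) (X u a y)) - 1) := by
          rw [mul_sub, mul_inv_cancel₀ (flowJac_pos V X a τ y).ne', Real.exp_sub]
          simp only [flowJac, div_eq_mul_inv]
          ring
        rw [e1, norm_neg, Real.norm_eq_abs]
        refine (abs_exp_sub_one_le_exp_abs_sub_one _).trans ?_
        gcongr
        exact hX.abs_log_flowJac_sub_le hV a τ s y

lemma isContinuousL1_charDensity (hX : IsGlobalFlow V X)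
    (hV : LipschitzWith K (fun z : ℝ × Space N => V z.1 z.2)) (a b : ℝ) {r : Space N → ℝ}
    (hr : Integrable r) : IsContinuousL1 a b (charDensity V X a r) := by
  refine ⟨fun τ _ => hX.integrable_charDensity hV a hr τ, fun s _ => ?_⟩
  simp only [eLpNorm_one_eq_lintegral_enorm]
  exact (hX.tendsto_lintegral_charDensity_sub hV a s hr).mono_left nhdsWithin_le_nhds

lemma charDensity_self (hX : IsGlobalFlow V X) (a : ℝ) (r : Space N → ℝ) :
    charDensity V X a r a = r := by
  funext x
  simp [charDensity, hX.init]

/-- The density transported along the characteristics is a Kružkov solution. -/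
lemma isKruzkovSolution_charDensity (hX : IsGlobalFlow V X)
    (hV : LipschitzWith K (fun z : ℝ × Space N => V z.1 z.2)) {a b : ℝ} (hab : a ≤ b)
    {r : Space N → ℝ} (hr : Integrable r) :
    IsKruzkovSolution V a b r (charDensity V X a r) where
  locallyIntegrable := (hX.integrableOn_charDensity hV a a b hr).locallyIntegrableOn
  entropy k φ hφ _ hφs _ := (hX.integral_entropy_charDensity hV hab r k hφ hφs).ge
  initial R := by
    have h := hX.tendsto_lintegral_charDensity_sub hV a a hr
    rw [hX.charDensity_self] at h
    refine tendsto_of_tendsto_of_tendsto_of_le_of_le tendsto_const_nhds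
      (h.mono_left (inf_le_left.trans nhdsWithin_le_nhds)) (fun _ => zero_le) fun τ => ?_
    exact setLIntegral_le_lintegral _ _

end IsGlobalFlow

end ContinuityL1

/-! ### Mollification and bounds from weak derivatives. -/

section Mollification

open scoped Convolution
open ContinuousLinearMap

variable {F : Type*} [NormedAddCommGroup F] [NormedSpace ℝ F] [FiniteDimensional ℝ F]
  [MeasurableSpace F] [BorelSpace F]

/-- Bump functions that shrink to the origin. -/
def shrinkingBump (F : Type*) [NormedAddCommGroup F] [NormedSpace ℝ F] (n : ℕ) :
    ContDiffBump (0 : F) :=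
  ⟨1 / (n + 1), 2 / (n + 1), by positivity, by gcongr; norm_num⟩

/-- The mollification of `g` at the scale of the `n`-th bump function. -/
def mollify {G : Type*} [NormedAddCommGroup G] [NormedSpace ℝ G] (μ : Measure F) (n : ℕ)
    (g : F → G) : F → G :=
  (shrinkingBump F n).normed μ ⋆[lsmul ℝ ℝ, μ] g

variable {μ : Measure F} [μ.IsAddHaarMeasure]
variable {G : Type*} [NormedAddCommGroup G] [NormedSpace ℝ G] [CompleteSpace G]

lemma tendsto_shrinkingBump_rOut :
    Tendsto (fun n => (shrinkingBump F n).rOut) atTop (𝓝 0) :=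
  tendsto_const_div_atTop_nhds_zero_nat 2 |>.comp (tendsto_add_atTop_nat 1) |>.congr fun n => by
    simp [shrinkingBump]

lemma mollify_apply (n : ℕ) (g : F → G) (x : F) :
    mollify μ n g x = ∫ u, (shrinkingBump F n).normed μ u • g (x - u) ∂μ := rfl

lemma ae_tendsto_mollify {g : F → G} (hg : LocallyIntegrable g μ) :
    ∀ᵐ x ∂μ, Tendsto (fun n => mollify μ n g x) atTop (𝓝 (g x)) := by
  -- The bounded ratio 2 of the outer to the inner radius is what lets the Lebesgue differentiation
  -- theorem give almost everywhere convergence.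
  refine ContDiffBump.ae_convolution_tendsto_right_of_locallyIntegrable (K := 2)
    tendsto_shrinkingBump_rOut (Eventually.of_forall fun n => ?_) hg
  simp only [shrinkingBump]
  apply le_of_eq
  ring

lemma contDiff_mollify (n : ℕ) {g : F → G} (hg : LocallyIntegrable g μ) :
    ContDiff ℝ (⊤ : ℕ∞) (mollify μ n g) :=
  (shrinkingBump F n).hasCompactSupport_normed.contDiff_convolution_left _
    (shrinkingBump F n).contDiff_normed hg

lemma norm_mollify_le (n : ℕ) {g : F → G} {C : ℝ} (hC : ∀ᵐ x ∂μ, ‖g x‖ ≤ C) (x : F) :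
    ‖mollify μ n g x‖ ≤ C := by
  have hi : Integrable ((shrinkingBump F n).normed μ) μ :=
    (shrinkingBump F n).integrable_normed
  calc ‖mollify μ n g x‖ ≤ ∫ u, C * (shrinkingBump F n).normed μ u ∂μ := by
        refine norm_integral_le_of_norm_le (hi.const_mul C) ?_
        filter_upwards [(quasiMeasurePreserving_sub_left μ x).ae hC] with u hu
        change ‖(shrinkingBump F n).normed μ u • g (x - u)‖ ≤ _
        rw [norm_smul, Real.norm_of_nonneg ((shrinkingBump F n).nonneg_normed u), mul_comm]
        exact mul_le_mul_of_nonneg_right hu ((shrinkingBump F n).nonneg_normed u)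
    _ = C := by rw [integral_const_mul, ContDiffBump.integral_normed, mul_one]

/-- Here the derivative falls on `φ`, so almost everywhere bounds for `fderiv ℝ φ` become bounds at
every point for the mollified function. -/
lemma hasFDerivAt_mollify (n : ℕ) {φ : F → ℝ} {C : NNReal} (hφ : LipschitzWith C φ) (x : F) :
    HasFDerivAt (mollify μ n φ) (mollify μ n (fderiv ℝ φ) x) x := by
  have hη : Continuous ((shrinkingBump F n).normed μ) := (shrinkingBump F n).continuous_normed
  have hi : Integrable ((shrinkingBump F n).normed μ) μ :=
    (shrinkingBump F n).integrable_normed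
  have hc : ∀ y, Continuous fun u => (shrinkingBump F n).normed μ u • φ (y - u) := fun y =>
    hη.smul (hφ.continuous.comp (by fun_prop))
  have hae : ∀ᵐ u ∂μ, DifferentiableAt ℝ φ (x - u) :=
    (quasiMeasurePreserving_sub_left μ x).ae hφ.ae_differentiableAt
  refine (hasFDerivAt_integral_of_dominated_loc_of_lip (s := univ)
    (bound := fun u => (shrinkingBump F n).normed μ u * C)
    (F := fun y u => (shrinkingBump F n).normed μ u • φ (y - u)) univ_mem
    (Eventually.of_forall fun y => (hc y).aestronglyMeasurable)
    ?_ ?_ (Eventually.of_forall fun u => ?_) (hi.mul_const _) ?_).2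
  · exact (hc x).integrable_of_hasCompactSupport
      ((shrinkingBump F n).hasCompactSupport_normed.smul_right)
  · exact (hη.measurable.smul ((measurable_fderiv ℝ φ).comp (measurable_const.sub measurable_id))
      ).aestronglyMeasurable
  · refine LipschitzOnWith.of_dist_le_mul fun y _ z _ => ?_
    have h0 : 0 ≤ (shrinkingBump F n).normed μ u * (C : ℝ) :=
      mul_nonneg ((shrinkingBump F n).nonneg_normed u) C.2
    rw [dist_smul₀, Real.norm_of_nonneg ((shrinkingBump F n).nonneg_normed u), Real.coe_nnabs,
      abs_of_nonneg h0, mul_assoc]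
    refine mul_le_mul_of_nonneg_left ?_ ((shrinkingBump F n).nonneg_normed u)
    simpa using hφ.dist_le_mul (y - u) (z - u)
  · filter_upwards [hae] with u hu
    have h1 : HasFDerivAt (fun y : F => y - u) (ContinuousLinearMap.id ℝ F) x :=
      (hasFDerivAt_id x).sub_const u
    exact (hu.hasFDerivAt.comp x h1).const_smul ((shrinkingBump F n).normed μ u)

lemma mollify_eq_zero_of_notMem_cthickening (n : ℕ) {g : F → G} {x : F}
    (hx : x ∉ Metric.cthickening (shrinkingBump F n).rOut (tsupport g)) : mollify μ n g x = 0 := by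
  rw [mollify_apply]
  refine integral_eq_zero_of_ae (Eventually.of_forall fun u => ?_)
  by_cases hu : u ∈ Function.support ((shrinkingBump F n).normed μ)
  · rw [ContDiffBump.support_normed_eq, mem_ball_zero_iff] at hu
    have : g (x - u) = 0 := by
      by_contra h
      refine hx (Metric.mem_cthickening_of_dist_le x (x - u) _ _ (subset_tsupport _ h) ?_)
      rw [dist_eq_norm, sub_sub_cancel]
      exact hu.le
    change (shrinkingBump F n).normed μ u • g (x - u) = 0
    rw [this, smul_zero]
  · change (shrinkingBump F n).normed μ u • g (x - u) = 0
    rw [Function.notMem_support.1 hu, zero_smul]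

/-- Here the derivative falls on the kernel, so information on `f` in the sense of distributions
suffices. -/
lemma fderiv_mollify_apply (n : ℕ) {f : F → ℝ} (hf : LocallyIntegrable f μ) (x e : F) :
    fderiv ℝ (mollify μ n f) x e =
      -∫ y, f y * fderiv ℝ (fun y => (shrinkingBump F n).normed μ (x - y)) y e ∂μ := by
  set η := (shrinkingBump F n).normed μ with hη
  have hηs : ContDiff ℝ (⊤ : ℕ∞) η := (shrinkingBump F n).contDiff_normed
  have hηc : HasCompactSupport η := (shrinkingBump F n).hasCompactSupport_normed
  have hd : HasFDerivAt (mollify μ n f) ((fderiv ℝ η ⋆[(lsmul ℝ ℝ).precompL F, μ] f) x) x :=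
    hηc.hasFDerivAt_convolution_left (lsmul ℝ ℝ) (hηs.of_le (by simp)) hf x
  have hi : Integrable (fun y => (lsmul ℝ ℝ).precompL F (fderiv ℝ η (x - y)) (f y)) μ :=
    ((hηc.fderiv ℝ).convolutionExists_left _ (hηs.continuous_fderiv (by simp)) hf x).integrable_swap
  rw [hd.fderiv, convolution_eq_swap, ContinuousLinearMap.integral_apply hi, ← integral_neg]
  refine integral_congr_ae (Eventually.of_forall fun y => ?_)
  have h2 : HasFDerivAt (fun y : F => x - y) (-ContinuousLinearMap.id ℝ F) y :=
    (hasFDerivAt_id y).const_sub x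
  have h3 := ((hηs.differentiable (by simp)) (x - y)).hasFDerivAt.comp y h2
  have h4 : fderiv ℝ (fun y => η (x - y)) y = _ := h3.fderiv
  simp [h4, mul_comm]

lemma integral_abs_shrinkingBump_sub (n : ℕ) (x : F) :
    ∫ y, |(shrinkingBump F n).normed μ (x - y)| ∂μ = 1 := by
  rw [integral_sub_left_eq_self (fun y => |(shrinkingBump F n).normed μ y|) μ x,
    ← (shrinkingBump F n).integral_normed (μ := μ)]
  exact integral_congr_ae (Eventually.of_forall fun y =>
    abs_of_nonneg ((shrinkingBump F n).nonneg_normed y))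

/-- The increment along `v` of a function with a bounded distributional derivative along `v`. -/
lemma ae_abs_sub_le_of_weak_le {f : F → ℝ} (hf : LocallyIntegrable f μ) {Ω : Set F}
    (hΩ : IsOpen Ω) (hΩc : Convex ℝ Ω) {C : ℝ} {v : F}
    (h : ∀ φ : F → ℝ, ContDiff ℝ (⊤ : ℕ∞) φ → HasCompactSupport φ → tsupport φ ⊆ Ω →
      |∫ y, f y * fderiv ℝ φ y v ∂μ| ≤ C * ∫ y, |φ y| ∂μ) :
    ∀ᵐ z ∂μ, z ∈ Ω → z + v ∈ Ω → |f (z + v) - f z| ≤ C := by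
  have ht := ae_tendsto_mollify (μ := μ) hf
  filter_upwards [ht, (quasiMeasurePreserving_add_right μ v).ae ht] with z hz hzv hzΩ hzvΩ
  have hseg : IsCompact (segment ℝ z (z + v)) := by
    rw [segment_eq_image_lineMap]
    exact isCompact_Icc.image AffineMap.lineMap_continuous
  obtain ⟨δ, hδ, hδΩ⟩ := hseg.exists_cthickening_subset_open hΩ (hΩc.segment_subset hzΩ hzvΩ)
  refine le_of_tendsto (hzv.sub hz).abs ?_
  filter_upwards [(tendsto_shrinkingBump_rOut (F := F)).eventually_lt_const hδ] with n hn
  have hd : Differentiable ℝ (mollify μ n f) := (contDiff_mollify n hf).differentiable (by simp)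
  have h1 : ∀ s ∈ Icc (0 : ℝ) 1, HasDerivWithinAt (fun s : ℝ => mollify μ n f (z + s • v))
      (fderiv ℝ (mollify μ n f) (z + s • v) v) (Icc 0 1) s := fun s _ => by
    have h2 : HasDerivAt (fun s : ℝ => z + s • v) v s := by
      simpa using ((hasDerivAt_id s).smul_const v).const_add z
    exact ((hd (z + s • v)).hasFDerivAt.comp_hasDerivAt s h2).hasDerivWithinAt
  have h3 := norm_image_sub_le_of_norm_deriv_le_segment_01' h1 (C := C) fun s hs => by
    rw [fderiv_mollify_apply n hf, norm_neg]
    have hw : z + s • v ∈ segment ℝ z (z + v) := by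
      rw [segment_eq_image']
      exact ⟨s, ⟨hs.1, hs.2.le⟩, by simp⟩
    set w := z + s • v
    have hsupp : tsupport (fun y => (shrinkingBump F n).normed μ (w - y)) ⊆ Ω := by
      refine Subset.trans (closure_minimal ?_ Metric.isClosed_closedBall)
        ((Metric.closedBall_subset_cthickening hw (shrinkingBump F n).rOut).trans
          ((Metric.cthickening_mono hn.le _).trans hδΩ))
      intro y hy
      have hy' : w - y ∈ Function.support ((shrinkingBump F n).normed μ) := hy
      rw [ContDiffBump.support_normed_eq, mem_ball_zero_iff] at hy'
      rw [mem_closedBall_iff_norm']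
      exact hy'.le
    -- The translated kernel is the test function. Its `L^1` norm is 1, so the weak bound becomes a
    -- pointwise bound by `C` along the segment, which stays in `Ω` by convexity.
    have h5 := h (fun y => (shrinkingBump F n).normed μ (w - y))
      ((shrinkingBump F n).contDiff_normed.comp (by fun_prop))
      ((shrinkingBump F n).hasCompactSupport_normed.comp_homeomorph (Homeomorph.subLeft w)) hsupp
    rwa [integral_abs_shrinkingBump_sub, mul_one] at h5
  simpa using h3

/-- Duality of `L^1` and `L^∞`: shrinking kernels of unit mass are the test functions. -/
lemma ae_abs_le_of_weak_le {f : F → ℝ} (hf : LocallyIntegrable f μ) {C : ℝ}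
    (h : ∀ φ : F → ℝ, ContDiff ℝ (⊤ : ℕ∞) φ → HasCompactSupport φ →
      |∫ y, f y * φ y ∂μ| ≤ C * ∫ y, |φ y| ∂μ) : ∀ᵐ x ∂μ, |f x| ≤ C := by
  filter_upwards [ae_tendsto_mollify hf] with x hx
  refine le_of_tendsto hx.abs (Eventually.of_forall fun n => ?_)
  set η := (shrinkingBump F n).normed μ with hη
  have h1 : mollify μ n f x = ∫ y, f y * η (x - y) ∂μ := by
    rw [mollify, convolution_eq_swap]
    simp [mul_comm, hη]
  have h5 := h (fun y => η (x - y)) ((shrinkingBump F n).contDiff_normed.comp (by fun_prop))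
    ((shrinkingBump F n).hasCompactSupport_normed.comp_homeomorph (Homeomorph.subLeft x))
  rwa [integral_abs_shrinkingBump_sub, mul_one, ← h1] at h5

/-- A Lipschitz function whose derivative is almost everywhere bounded by `C` is `C`-Lipschitz. -/
lemma LipschitzWith.of_ae_norm_fderiv_le {E : Type*} [NormedAddCommGroup E]
    [InnerProductSpace ℝ E] [FiniteDimensional ℝ E] {f : F → E} {K C : NNReal}
    (hf : LipschitzWith K f) (h : ∀ᵐ x ∂μ, ‖fderiv ℝ f x‖ ≤ C) : LipschitzWith C f := by
  have key : ∀ e : E, ∀ x y, |inner ℝ e (f x) - inner ℝ e (f y)| ≤ ‖e‖ * C * dist x y := by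
    intro e x y
    set φ : F → ℝ := fun x => innerSL ℝ e (f x) with hφ
    have hφL : LipschitzWith (‖innerSL ℝ e‖₊ * K) φ := (innerSL ℝ e).lipschitz.comp hf
    have hφd : ∀ᵐ x ∂μ, ‖fderiv ℝ φ x‖ ≤ ‖e‖ * C := by
      filter_upwards [h, hf.ae_differentiableAt (μ := μ)] with x hx hxd
      have : fderiv ℝ φ x = (innerSL ℝ e).comp (fderiv ℝ f x) :=
        ((innerSL ℝ e).hasFDerivAt.comp x hxd.hasFDerivAt).fderiv
      rw [this]
      refine (ContinuousLinearMap.opNorm_comp_le _ _).trans ?_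
      rw [innerSL_apply_norm]
      gcongr
    have hm : ∀ n, LipschitzWith (‖e‖₊ * C) (mollify μ n φ) := fun n =>
      lipschitzWith_of_nnnorm_fderiv_le (𝕜 := ℝ)
        (fun x => (hasFDerivAt_mollify n hφL x).differentiableAt) fun x => by
          rw [(hasFDerivAt_mollify n hφL x).fderiv, ← NNReal.coe_le_coe]
          exact norm_mollify_le n hφd x
    have ht : ∀ x, Tendsto (fun n => mollify μ n φ x) atTop (𝓝 (φ x)) := fun x =>
      ContDiffBump.convolution_tendsto_right_of_continuous tendsto_shrinkingBump_rOut
        hφL.continuous x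
    exact le_of_tendsto ((ht x).dist (ht y)) (Eventually.of_forall fun n => (hm n).dist_le_mul x y)
  refine LipschitzWith.of_dist_le_mul fun x y => ?_
  -- Taking the component in the direction of the increment itself recovers the norm without a
  -- factor depending on the dimension.
  have h1 := key (f x - f y) x y
  rw [← inner_sub_right, real_inner_self_eq_norm_sq, abs_of_nonneg (sq_nonneg _), sq, mul_assoc] at h1
  rw [dist_eq_norm (f x)]
  by_cases h0 : ‖f x - f y‖ = 0
  · rw [h0]; positivity
  · exact le_of_mul_le_mul_left h1 (lt_of_le_of_ne (norm_nonneg _) (Ne.symm h0))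

end Mollification

/-- Mollification is formulated for additive Haar measures and is applied to space-time and to the
space of all `(t, x, P)`. -/
instance isAddHaarMeasure_volume_prod {E F : Type*} [NormedAddCommGroup E] [NormedAddCommGroup F]
    [MeasureSpace E] [MeasureSpace F] [BorelSpace E] [BorelSpace F] [SecondCountableTopology E]
    [SecondCountableTopology F] [(volume : Measure E).IsAddHaarMeasure]
    [(volume : Measure F).IsAddHaarMeasure] [SFinite (volume : Measure E)]
    [SFinite (volume : Measure F)] : (volume : Measure (E × F)).IsAddHaarMeasure := by
  rw [Measure.volume_eq_prod]
  infer_instance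

/-! ### Integration by parts for Lipschitz fields. -/

section Divergence

variable {F : Type*} [NormedAddCommGroup F] [NormedSpace ℝ F] [FiniteDimensional ℝ F]
  [MeasurableSpace F] [BorelSpace F] {μ : Measure F} [μ.IsAddHaarMeasure] {N : ℕ}

/-- Integration by parts for the divergence of a Lipschitz vector field in the directions of a
subspace. -/
lemma integral_sum_fderiv_mul {ι : Space N →L[ℝ] F} {f : F → Space N} {K : NNReal}
    (hf : LipschitzWith K f) {φ : F → ℝ} (hφ : ContDiff ℝ 1 φ) (hφc : HasCompactSupport φ) :
    ∫ z, (∑ i, fderiv ℝ f z (ι (EuclideanSpace.single i 1)) i) * φ z ∂μ =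
      -∫ z, fderiv ℝ φ z (ι (f z)) ∂μ := by
  obtain ⟨D, hD⟩ := hφ.lipschitzWith_of_hasCompactSupport hφc (by simp)
  have hfi : ∀ i, LipschitzWith K fun z => f z i := fun i => by
    refine LipschitzWith.of_dist_le_mul fun x y => le_trans ?_ (hf.dist_le_mul x y)
    rw [dist_eq_norm, dist_eq_norm]
    exact PiLp.norm_apply_le (f x - f y) i
  have hd := hf.ae_differentiableAt (μ := μ)
  have hφd : ∀ z, DifferentiableAt ℝ φ z := hφ.differentiable (by simp)
  have h1 : ∀ i, ∫ z, fderiv ℝ f z (ι (EuclideanSpace.single i 1)) i * φ z ∂μ =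
      -∫ z, fderiv ℝ φ z (ι (EuclideanSpace.single i 1)) * f z i ∂μ := by
    intro i
    rw [← integral_neg]
    refine Eq.trans (integral_congr_ae ?_) (((hfi i).integral_lineDeriv_mul_eq (μ := μ) hD hφc
      (ι (EuclideanSpace.single i 1))).trans (integral_congr_ae (Eventually.of_forall fun z => ?_)))
    · filter_upwards [hd] with z hz
      have : HasFDerivAt (fun z => f z i)
          ((EuclideanSpace.proj i : Space N →L[ℝ] ℝ).comp (fderiv ℝ f z)) z :=
        (EuclideanSpace.proj i : Space N →L[ℝ] ℝ).hasFDerivAt.comp z hz.hasFDerivAt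
      simp only [this.differentiableAt.lineDeriv_eq_fderiv, this.fderiv]
      rfl
    · simp [(hφd z).lineDeriv_eq_fderiv]
  have hint1 : ∀ i, Integrable (fun z => fderiv ℝ f z (ι (EuclideanSpace.single i 1)) i * φ z) μ := by
    intro i
    refine (hφ.continuous.integrable_of_hasCompactSupport hφc).bdd_mul
      (c := K * ‖ι (EuclideanSpace.single i 1)‖) ?_ (Eventually.of_forall fun z => ?_)
    · exact (((EuclideanSpace.proj i : Space N →L[ℝ] ℝ).continuous.measurable).comp
        (measurable_fderiv_apply_const ℝ f _)).aestronglyMeasurable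
    · exact (PiLp.norm_apply_le (fderiv ℝ f z (ι (EuclideanSpace.single i 1))) i).trans
        ((fderiv ℝ f z).le_of_opNorm_le (norm_fderiv_le_of_lipschitz ℝ hf) _)
  have hint2 : ∀ i, Integrable (fun z => fderiv ℝ φ z (ι (EuclideanSpace.single i 1)) * f z i) μ := by
    intro i
    refine Continuous.integrable_of_hasCompactSupport ?_ ?_
    · exact ((hφ.continuous_fderiv (by simp)).clm_apply continuous_const).mul (hfi i).continuous
    · exact (hφc.fderiv_apply ℝ _).mul_right
  simp only [Finset.sum_mul]
  rw [integral_finsetSum _ fun i _ => hint1 i]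
  simp only [h1]
  rw [Finset.sum_neg_distrib, ← integral_finsetSum _ fun i _ => hint2 i]
  congr 1
  refine integral_congr_ae (Eventually.of_forall fun z => ?_)
  have h2 : f z = ∑ i, f z i • EuclideanSpace.single i (1 : ℝ) := by
    ext j
    simp [Finset.sum_apply, Pi.single_apply]
  change _ = fderiv ℝ φ z (ι (f z))
  conv_rhs => rw [h2]
  simp [map_sum, mul_comm]

lemma integral_divergence_mul {f : Space N → Space N} {K : NNReal}
    (hf : LipschitzWith K f) {φ : Space N → ℝ} (hφ : ContDiff ℝ 1 φ) (hφc : HasCompactSupport φ) :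
    ∫ x, divergence f x * φ x = -∫ x, fderiv ℝ φ x (f x) :=
  integral_sum_fderiv_mul (ι := ContinuousLinearMap.id ℝ _) hf hφ hφc

/-- This is the weak equation for the constant density 1 with its source `div V`. It permits the
subtraction of `|k|` times the same identity from the entropy inequality. -/
lemma integral_transport_add_divergence {V : ℝ → Space N → Space N} {K : NNReal}
    (hV : LipschitzWith K (fun z : ℝ × Space N => V z.1 z.2)) {φ : ℝ × Space N → ℝ}
    (hφ : ContDiff ℝ 1 φ) (hφc : HasCompactSupport φ) :
    ∫ z : ℝ × Space N, (fderiv ℝ φ z (1, V z.1 z.2) + divergence (V z.1) z.2 * φ z) = 0 := by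
  obtain ⟨D, hD⟩ := hφ.lipschitzWith_of_hasCompactSupport hφc (by simp)
  have hφd : ∀ z, DifferentiableAt ℝ φ z := hφ.differentiable (by simp)
  have hc := hφ.continuous_fderiv (by simp)
  have h1 := integral_sum_fderiv_mul (μ := (volume : Measure (ℝ × Space N)))
    (ι := ContinuousLinearMap.inr ℝ ℝ (Space N)) hV hφ hφc
  have h2 : ∫ z : ℝ × Space N, divergence (V z.1) z.2 * φ z =
      -∫ z : ℝ × Space N, fderiv ℝ φ z (0, V z.1 z.2) := by
    refine Eq.trans (integral_congr_ae ?_) h1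
    filter_upwards [hV.ae_differentiableAt (μ := (volume : Measure (ℝ × Space N)))] with z hz
    have h3 : HasFDerivAt (V z.1)
        ((fderiv ℝ (fun z : ℝ × Space N => V z.1 z.2) z).comp
          (ContinuousLinearMap.inr ℝ ℝ (Space N))) z.2 :=
      HasFDerivAt.comp (g := fun z : ℝ × Space N => V z.1 z.2) (f := fun x => (z.1, x)) z.2
        hz.hasFDerivAt (hasFDerivAt_prodMk_right z.1 z.2)
    simp only [divergence, h3.fderiv]
    rfl
  have h4 : ∫ z : ℝ × Space N, fderiv ℝ φ z (1, 0) = 0 := by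
    have := (LipschitzWith.const (1 : ℝ)).integral_lineDeriv_mul_eq
      (μ := (volume : Measure (ℝ × Space N))) hD hφc (-(1, 0))
    simp only [neg_neg, mul_one, (hφd _).lineDeriv_eq_fderiv] at this
    rw [← this]
    simp [lineDeriv]
  have i1 : Integrable fun z : ℝ × Space N => fderiv ℝ φ z (1, 0) :=
    (hc.clm_apply continuous_const).integrable_of_hasCompactSupport (hφc.fderiv_apply ℝ _)
  have i2 : Integrable fun z : ℝ × Space N => fderiv ℝ φ z (0, V z.1 z.2) := by
    refine (hc.clm_apply (continuous_const.prodMk hV.continuous)).integrable_of_hasCompactSupport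
      ((hφc.fderiv ℝ).mono ?_)
    intro z hz h
    exact hz (by simp [h])
  have i3 : Integrable fun z : ℝ × Space N => divergence (V z.1) z.2 * φ z :=
    (hφ.continuous.integrable_of_hasCompactSupport hφc).bdd_mul (c := N * K)
      (measurable_divergence hV.continuous).aestronglyMeasurable
      (Eventually.of_forall fun z => abs_divergence_le (lipschitzWith_slice hV z.1) z.2)
  have h5 : ∀ z : ℝ × Space N, fderiv ℝ φ z (1, V z.1 z.2) =
      fderiv ℝ φ z (1, 0) + fderiv ℝ φ z (0, V z.1 z.2) := fun z => by
    rw [← map_add]; simp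
  simp only [h5]
  rw [integral_add (f := fun z : ℝ × Space N => fderiv ℝ φ z (1, 0) + fderiv ℝ φ z (0, V z.1 z.2))
    (i1.add i2) i3, integral_add i1 i2, h4, h2]
  ring

end Divergence

/-! ### From the entropy inequality to the weak equation. -/

section Weak

variable {N : ℕ} {V : ℝ → Space N → Space N} {K : NNReal} {a b : ℝ} {r : Space N → ℝ}
  {ρ : ℝ → Space N → ℝ}

/-- The bound does not depend on `k`, so it provides the domination when `k` tends to `±∞`. -/
lemma abs_sign_mul_add_abs_le (x k : ℝ) : |Real.sign (x - k) * k + abs k| ≤ 2 * |x| := by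
  rcases lt_trichotomy (x - k) 0 with h | h | h
  · rw [Real.sign_of_neg h]
    rcases abs_cases k with ⟨h1, h2⟩ | ⟨h1, h2⟩ <;> rcases abs_cases x with ⟨h3, h4⟩ | ⟨h3, h4⟩ <;>
      rw [h1, h3, abs_le] <;> constructor <;> linarith
  · rw [h, Real.sign_zero, sub_eq_zero.1 h, zero_mul, zero_add, abs_abs]
    linarith [abs_nonneg k]
  · rw [Real.sign_of_pos h]
    rcases abs_cases k with ⟨h1, h2⟩ | ⟨h1, h2⟩ <;> rcases abs_cases x with ⟨h3, h4⟩ | ⟨h3, h4⟩ <;>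
      rw [h1, h3, abs_le] <;> constructor <;> linarith

/-- Once `|k|` exceeds `|x|` the sign of `x - k` is fixed: the entropy normalized by `|k|` is linear
in `x`, and the normalized divergence coefficient vanishes. -/
lemma eventually_abs_sub_sub_abs_eq (x ε : ℝ) (hε : ε = 1 ∨ ε = -1) : ∀ᶠ n : ℕ in atTop,
    |x - ε * n| - |ε * n| = -(ε * x) ∧ Real.sign (x - ε * n) * (ε * n) + |ε * n| = 0 := by
  filter_upwards [eventually_gt_atTop ⌈|x|⌉₊] with n hn
  have h : |x| < n := Nat.lt_of_ceil_lt hn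
  have h0 : (0 : ℝ) ≤ n := n.cast_nonneg
  obtain ⟨h1, h2⟩ := abs_lt.1 h
  rcases hε with rfl | rfl
  · rw [one_mul, abs_of_nonneg h0, abs_of_neg (by linarith), Real.sign_of_neg (by linarith)]
    constructor <;> ring
  · rw [neg_one_mul, abs_neg, abs_of_nonneg h0, abs_of_pos (by linarith),
      Real.sign_of_pos (by linarith)]
    constructor <;> ring

lemma Real.measurable_sign : Measurable Real.sign := by
  unfold Real.sign
  exact Measurable.ite measurableSet_Iio measurable_const
    (Measurable.ite measurableSet_Ioi measurable_const measurable_const)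

namespace IsKruzkovSolution

/-- The inequality with `k = ε n`, less `|k|` times the identity for constants, has an integrand
dominated by a multiple of `|ρ|`; as `n → ∞` only `-ε ρ` times the transport derivative remains. The
two signs of `ε` together give an equality. -/
lemma integral_transport_nonneg (hρ : IsKruzkovSolution V a b r ρ)
    (hV : LipschitzWith K (fun z : ℝ × Space N => V z.1 z.2)) {φ : ℝ × Space N → ℝ}
    (hφ : ContDiff ℝ (⊤ : ℕ∞) φ) (hφc : HasCompactSupport φ) (hφs : tsupport φ ⊆ Ioo a b ×ˢ univ)
    (hφ0 : ∀ z, 0 ≤ φ z) {ε : ℝ} (hε : ε = 1 ∨ ε = -1) :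
    0 ≤ ∫ z in tsupport φ, -(ε * ρ z.1 z.2) * fderiv ℝ φ z (1, V z.1 z.2) := by
  have hφ1 : ContDiff ℝ 1 φ := hφ.of_le (by simp)
  set S := tsupport φ with hS
  have hSm : MeasurableSet S := (isClosed_tsupport φ).measurableSet
  have hρi : IntegrableOn (fun z : ℝ × Space N => ρ z.1 z.2) S :=
    hρ.locallyIntegrable.integrableOn_compact_subset
      (hφs.trans (prod_mono Ioo_subset_Icc_self Subset.rfl)) hφc
  set L : ℝ × Space N → ℝ := fun z => fderiv ℝ φ z (1, V z.1 z.2) with hL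
  set D : ℝ × Space N → ℝ := fun z => divergence (V z.1) z.2 * φ z with hD
  have hLc : Continuous L := (hφ.continuous_fderiv (by simp)).clm_apply
    (continuous_const.prodMk hV.continuous)
  have hDm : Measurable D := (measurable_divergence hV.continuous).mul hφ.continuous.measurable
  have hL0 : ∀ z ∉ S, L z = 0 := fun z hz => by
    have : fderiv ℝ φ z = 0 := by
      by_contra h
      exact hz (support_fderiv_subset ℝ h)
    simp [hL, this]
  have hφz : ∀ z ∉ S, φ z = 0 := fun z hz => image_eq_zero_of_notMem_tsupport hz
  obtain ⟨CL, hCL⟩ := hφc.isCompact.exists_bound_of_continuousOn (f := L) hLc.continuousOn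
  obtain ⟨Cφ, hCφ⟩ := hφc.isCompact.exists_bound_of_continuousOn (f := φ) hφ.continuous.continuousOn
  have hDb : ∀ z ∈ S, |D z| ≤ N * K * Cφ := fun z hz => by
    rw [hD, abs_mul]
    exact mul_le_mul (abs_divergence_le (lipschitzWith_slice hV z.1) z.2) (hCφ z hz)
      (abs_nonneg _) (by positivity)
  have hZ : ∫ z in S, (L z + D z) = 0 := by
    rw [setIntegral_eq_integral_of_forall_compl_eq_zero fun z hz => by
      simp [hL0 z hz, hD, hφz z hz]]
    exact integral_transport_add_divergence hV hφ1 hφc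
  have hZi : IntegrableOn (fun z => L z + D z) S := by
    refine Measure.integrableOn_of_bounded (M := CL + N * K * Cφ) hφc.isCompact.measure_lt_top.ne
      (hLc.measurable.add hDm).aestronglyMeasurable
      ((ae_restrict_iff' hSm).2 (Eventually.of_forall fun z hz => ?_))
    exact (norm_add_le _ _).trans (add_le_add (hCL z hz) (hDb z hz))
  set g : ℕ → ℝ × Space N → ℝ := fun n z =>
    (|ρ z.1 z.2 - ε * n| - |ε * n|) * L z -
      (Real.sign (ρ z.1 z.2 - ε * n) * (ε * n) + |ε * n|) * D z with hg
  have hgm : ∀ n, AEStronglyMeasurable (g n) (volume.restrict S) := by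
    intro n
    have h1 := hρi.aemeasurable
    have h2 : AEMeasurable (fun z : ℝ × Space N => ρ z.1 z.2 - ε * n) (volume.restrict S) :=
      h1.sub_const _
    refine AEMeasurable.aestronglyMeasurable ?_
    refine ((h2.norm.sub_const _).mul hLc.measurable.aemeasurable).sub
      ((((Real.measurable_sign.comp_aemeasurable h2).mul_const _).add_const _).mul hDm.aemeasurable)
  have hgb : ∀ n, ∀ᵐ z ∂(volume.restrict S), ‖g n z‖ ≤ |ρ z.1 z.2| * (CL + 2 * (N * K * Cφ)) := by
    intro n
    refine (ae_restrict_iff' hSm).2 (Eventually.of_forall fun z hz => ?_)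
    refine (norm_sub_le _ _).trans ?_
    have h1 : |(|ρ z.1 z.2 - ε * n| - |ε * n|)| ≤ |ρ z.1 z.2| := by
      have := abs_abs_sub_abs_le_abs_sub (ρ z.1 z.2 - ε * n) (-(ε * n))
      simpa using this
    have h2 := abs_sign_mul_add_abs_le (ρ z.1 z.2) (ε * n)
    have h3 := mul_le_mul h1 (hCL z hz) (norm_nonneg _) (abs_nonneg _)
    have h4 := mul_le_mul h2 (hDb z hz) (abs_nonneg _) (by positivity)
    rw [norm_mul, norm_mul, Real.norm_eq_abs, Real.norm_eq_abs (_ + _), Real.norm_eq_abs (D z)]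
    linarith
  have hbi : IntegrableOn (fun z : ℝ × Space N => |ρ z.1 z.2| * (CL + 2 * (N * K * Cφ))) S :=
    hρi.norm.mul_const _
  have hgi : ∀ n, IntegrableOn (g n) S := fun n => hbi.mono' (hgm n) (hgb n)
  have hI : ∀ n, 0 ≤ ∫ z in S, g n z := by
    intro n
    have h1 := hρ.entropy (ε * n) φ hφ hφc hφs hφ0
    rw [setIntegral_eq_of_subset_of_forall_sdiff_eq_zero (s := S)
      (measurableSet_Icc.prod MeasurableSet.univ)
      (hφs.trans (prod_mono Ioo_subset_Icc_self Subset.rfl)) fun z hz => by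
        have := hL0 z hz.2
        simp only [hL] at this
        simp [this, hφz z hz.2]] at h1
    have h2 : ∫ z in S, (g n z + |ε * n| * (L z + D z)) = ∫ z in S, g n z := by
      rw [integral_add (hgi n) (hZi.const_mul _), integral_const_mul, hZ, mul_zero, add_zero]
    rw [← h2]
    refine h1.trans_eq (integral_congr_ae (Eventually.of_forall fun z => ?_))
    simp only [hg, hL, hD]
    ring
  refine ge_of_tendsto (tendsto_integral_of_dominated_convergence _ hgm hbi hgb
    (Eventually.of_forall fun z => ?_)) (Eventually.of_forall hI)
  refine tendsto_const_nhds.congr' ?_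
  filter_upwards [eventually_abs_sub_sub_abs_eq (ρ z.1 z.2) ε hε] with n hn
  simp only [hg, hn.1, hn.2, zero_mul, sub_zero]
  rfl

/-- Kružkov solutions are weak solutions. -/
lemma integral_transport_eq_zero_of_contDiff (hρ : IsKruzkovSolution V a b r ρ)
    (hV : LipschitzWith K (fun z : ℝ × Space N => V z.1 z.2)) {φ : ℝ × Space N → ℝ}
    (hφ : ContDiff ℝ (⊤ : ℕ∞) φ) (hφc : HasCompactSupport φ) (hφs : tsupport φ ⊆ Ioo a b ×ˢ univ)
    (hφ0 : ∀ z, 0 ≤ φ z) :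
    ∫ z in Icc a b ×ˢ univ, ρ z.1 z.2 * fderiv ℝ φ z (1, V z.1 z.2) = 0 := by
  have h1 := hρ.integral_transport_nonneg hV hφ hφc hφs hφ0 (Or.inl rfl)
  have h2 := hρ.integral_transport_nonneg hV hφ hφc hφs hφ0 (Or.inr rfl)
  simp only [one_mul, neg_mul, neg_neg, integral_neg] at h1 h2
  rw [setIntegral_eq_of_subset_of_forall_sdiff_eq_zero (s := tsupport φ)
      (measurableSet_Icc.prod MeasurableSet.univ)
      (hφs.trans (prod_mono Ioo_subset_Icc_self Subset.rfl))]
  · linarith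
  · intro z hz
    have : fderiv ℝ φ z = 0 := by
      by_contra h
      exact hz.2 (support_fderiv_subset ℝ h)
    simp [this]

/-- Dual solutions are only Lipschitz. Mollification keeps the sign and the support inside the open
strip, and its derivatives converge almost everywhere under a uniform bound. -/
lemma integral_transport_eq_zero_of_nonneg (hρ : IsKruzkovSolution V a b r ρ)
    (hV : LipschitzWith K (fun z : ℝ × Space N => V z.1 z.2)) {φ : ℝ × Space N → ℝ} {C : NNReal}
    (hφ : LipschitzWith C φ) (hφc : HasCompactSupport φ) (hφs : tsupport φ ⊆ Ioo a b ×ˢ univ)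
    (hφ0 : ∀ z, 0 ≤ φ z) :
    ∫ z in Icc a b ×ˢ univ, ρ z.1 z.2 * fderiv ℝ φ z (1, V z.1 z.2) = 0 := by
  have hO : IsOpen (Ioo a b ×ˢ (univ : Set (Space N))) := isOpen_Ioo.prod isOpen_univ
  obtain ⟨ε, hε, hεO⟩ := hφc.isCompact.exists_cthickening_subset_open hO hφs
  set S := Metric.cthickening ε (tsupport φ) with hS
  have hSc : IsCompact S := hφc.isCompact.cthickening
  have hSm : MeasurableSet S := hSc.measurableSet
  have hSI : S ⊆ Icc a b ×ˢ univ := hεO.trans (prod_mono Ioo_subset_Icc_self Subset.rfl)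
  have hρi : IntegrableOn (fun z : ℝ × Space N => ρ z.1 z.2) S :=
    hρ.locallyIntegrable.integrableOn_compact_subset hSI hSc
  set ψ : ℕ → ℝ × Space N → ℝ := fun n => mollify volume n φ with hψ
  have hev : ∀ᶠ n in atTop, (shrinkingBump (ℝ × Space N) n).rOut < ε :=
    tendsto_shrinkingBump_rOut.eventually_lt_const hε
  have hsupp : ∀ᶠ n in atTop, tsupport (ψ n) ⊆ S := by
    filter_upwards [hev] with n hn
    refine closure_minimal (fun z hz => ?_) Metric.isClosed_cthickening
    by_contra h
    exact hz (mollify_eq_zero_of_notMem_cthickening n fun h' =>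
      h (Metric.cthickening_mono hn.le _ h'))
  have hloc : LocallyIntegrable φ := hφ.continuous.locallyIntegrable
  have hfd : ∀ n z, fderiv ℝ (ψ n) z = mollify volume n (fderiv ℝ φ) z := fun n z =>
    (hasFDerivAt_mollify n hφ z).fderiv
  have hC : ∀ z, ‖fderiv ℝ φ z‖ ≤ C := fun z => norm_fderiv_le_of_lipschitz ℝ hφ
  have hlocd : LocallyIntegrable (fderiv ℝ φ) :=
    (locallyIntegrable_const (C : ℝ)).mono (measurable_fderiv ℝ φ).aestronglyMeasurable
      (Eventually.of_forall fun z => (hC z).trans (le_abs_self _))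
  have hVc : Continuous fun z : ℝ × Space N => ((1 : ℝ), V z.1 z.2) :=
    continuous_const.prodMk hV.continuous
  obtain ⟨B, hB⟩ := hSc.exists_bound_of_continuousOn hVc.continuousOn
  have hset : ∀ {χ : ℝ × Space N → ℝ}, tsupport χ ⊆ S →
      ∫ z in Icc a b ×ˢ univ, ρ z.1 z.2 * fderiv ℝ χ z (1, V z.1 z.2) =
        ∫ z in S, ρ z.1 z.2 * fderiv ℝ χ z (1, V z.1 z.2) := by
    intro χ hχ
    refine setIntegral_eq_of_subset_of_forall_sdiff_eq_zero
      (measurableSet_Icc.prod MeasurableSet.univ) hSI fun z hz => ?_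
    have : fderiv ℝ χ z = 0 := by
      by_contra h
      exact hz.2 (hχ (support_fderiv_subset ℝ h))
    simp [this]
  have hzero : ∀ᶠ n in atTop, ∫ z in S, ρ z.1 z.2 * fderiv ℝ (ψ n) z (1, V z.1 z.2) = 0 := by
    filter_upwards [hsupp] with n hn
    rw [← hset hn]
    refine hρ.integral_transport_eq_zero_of_contDiff hV (contDiff_mollify n hloc)
      (hSc.of_isClosed_subset (isClosed_tsupport _) hn) (hn.trans hεO) fun z => ?_
    exact integral_nonneg fun u => mul_nonneg ((shrinkingBump _ n).nonneg_normed u) (hφ0 _)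
  rw [hset (Metric.self_subset_cthickening _)]
  refine tendsto_nhds_unique (tendsto_integral_of_dominated_convergence
    (fun z : ℝ × Space N => ‖ρ z.1 z.2‖ * (C * B)) (fun n => ?_) (hρi.norm.mul_const _)
    (fun n => ?_) ?_) (tendsto_const_nhds.congr' (hzero.mono fun n hn => hn.symm))
  · exact hρi.1.mul (((contDiff_mollify n hloc).continuous_fderiv (by simp)).clm_apply
      hVc).aestronglyMeasurable
  · refine (ae_restrict_iff' hSm).2 (Eventually.of_forall fun z hz => ?_)
    rw [norm_mul]
    refine mul_le_mul_of_nonneg_left ?_ (norm_nonneg _)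
    rw [hfd]
    exact (ContinuousLinearMap.le_opNorm _ _).trans (mul_le_mul (norm_mollify_le n (Eventually.of_forall hC) z) (hB z hz)
      (norm_nonneg _) C.2)
  · filter_upwards [ae_restrict_of_ae (ae_tendsto_mollify hlocd)] with z hz
    simp only [hfd]
    exact ((((ContinuousLinearMap.apply ℝ ℝ ((1 : ℝ), V z.1 z.2)).continuous.tendsto _).comp
      hz).const_mul _)

/-- The sign condition is removed by splitting into positive and negative parts, which are again
Lipschitz but in general not smooth; hence this step comes after the extension to Lipschitz
functions. -/
lemma integral_transport_eq_zero (hρ : IsKruzkovSolution V a b r ρ)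
    (hV : LipschitzWith K (fun z : ℝ × Space N => V z.1 z.2)) {φ : ℝ × Space N → ℝ} {C : NNReal}
    (hφ : LipschitzWith C φ) (hφc : HasCompactSupport φ) (hφs : tsupport φ ⊆ Ioo a b ×ˢ univ) :
    ∫ z in Icc a b ×ˢ univ, ρ z.1 z.2 * fderiv ℝ φ z (1, V z.1 z.2) = 0 := by
  have key : ∀ {χ : ℝ × Space N → ℝ}, LipschitzWith C χ → HasCompactSupport χ →
      tsupport χ ⊆ Ioo a b ×ˢ univ → IntegrableOn (fun z : ℝ × Space N =>
        ρ z.1 z.2 * fderiv ℝ χ z (1, V z.1 z.2)) (Icc a b ×ˢ univ) := by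
    intro χ hχ hχc hχs
    have hSI : tsupport χ ⊆ Icc a b ×ˢ univ := hχs.trans (prod_mono Ioo_subset_Icc_self Subset.rfl)
    have hρi := hρ.locallyIntegrable.integrableOn_compact_subset hSI hχc
    have hVc : Continuous fun z : ℝ × Space N => ((1 : ℝ), V z.1 z.2) :=
      continuous_const.prodMk hV.continuous
    obtain ⟨B, hB⟩ := hχc.isCompact.exists_bound_of_continuousOn hVc.continuousOn
    refine IntegrableOn.of_forall_sdiff_eq_zero (s := tsupport χ) ?_
      (measurableSet_Icc.prod MeasurableSet.univ) ?_
    · refine Integrable.mul_bdd (c := C * B) hρi ?_ ?_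
      · exact (isBoundedBilinearMap_apply.continuous.measurable.comp
          ((measurable_fderiv ℝ χ).prodMk hVc.measurable)).aestronglyMeasurable
      · refine (ae_restrict_iff' hχc.isCompact.measurableSet).2 (Eventually.of_forall fun z hz => ?_)
        exact (ContinuousLinearMap.le_opNorm _ _).trans (mul_le_mul
          (norm_fderiv_le_of_lipschitz ℝ hχ) (hB z hz) (norm_nonneg _) C.2)
    · intro z hz
      have : fderiv ℝ χ z = 0 := by
        by_contra h
        exact hz.2 (support_fderiv_subset ℝ h)
      simp [this]
  set p : ℝ × Space N → ℝ := fun z => max (φ z) 0 with hp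
  set q : ℝ × Space N → ℝ := fun z => max (-φ z) 0 with hq
  have hpL : LipschitzWith C p := hφ.max_const 0
  have hqL : LipschitzWith C q := (hφ.neg).max_const 0
  have hps : tsupport p ⊆ tsupport φ := closure_mono fun z hz h => hz (by simp [hp, h])
  have hqs : tsupport q ⊆ tsupport φ := closure_mono fun z hz h => hz (by simp [hq, h])
  have hpc : HasCompactSupport p := hφc.isCompact.of_isClosed_subset (isClosed_tsupport _) hps
  have hqc : HasCompactSupport q := hφc.isCompact.of_isClosed_subset (isClosed_tsupport _) hqs
  have h1 := hρ.integral_transport_eq_zero_of_nonneg hV hpL hpc (hps.trans hφs)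
    fun z => le_max_right _ _
  have h2 := hρ.integral_transport_eq_zero_of_nonneg hV hqL hqc (hqs.trans hφs)
    fun z => le_max_right _ _
  have h3 : ∫ z in Icc a b ×ˢ univ, ρ z.1 z.2 * fderiv ℝ φ z (1, V z.1 z.2) =
      ∫ z in Icc a b ×ˢ univ, (ρ z.1 z.2 * fderiv ℝ p z (1, V z.1 z.2) -
        ρ z.1 z.2 * fderiv ℝ q z (1, V z.1 z.2)) := by
    refine integral_congr_ae (ae_restrict_of_ae ?_)
    filter_upwards [hpL.ae_differentiableAt (μ := (volume : Measure (ℝ × Space N))),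
      hqL.ae_differentiableAt (μ := (volume : Measure (ℝ × Space N)))] with z hz1 hz2
    have h4 : φ = p - q := by
      ext z
      simp only [hp, hq, Pi.sub_apply]
      rcases le_total (φ z) 0 with h | h
      · rw [max_eq_right h, max_eq_left (by linarith)]; ring
      · rw [max_eq_left h, max_eq_right (by linarith)]; ring
    rw [h4, fderiv_sub hz1 hz2]
    simp [mul_sub]
  rw [h3, integral_sub (key hpL hpc (hps.trans hφs)) (key hqL hqc (hqs.trans hφs)), h1, h2, sub_zero]

end IsKruzkovSolution

end Weak

/-! ### Uniqueness by duality. -/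

lemma LocallyLipschitz.exists_lipschitzWith_of_hasCompactSupport {F : Type*}
    [NormedAddCommGroup F] [ProperSpace F] {f : F → ℝ}
    (hf : LocallyLipschitz f) (hc : HasCompactSupport f) : ∃ C, LipschitzWith C f := by
  obtain ⟨L, hL⟩ := (hf.locallyLipschitzOn (s := Metric.cthickening 1 (tsupport f))
    ).exists_lipschitzOnWith_of_compact hc.isCompact.cthickening
  obtain ⟨M, hM⟩ := hc.isCompact.exists_bound_of_continuousOn hf.continuous.continuousOn
  have key : ∀ x ∈ tsupport f, ∀ y, dist (f x) (f y) ≤ max L M.toNNReal * dist x y := by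
    intro x hx y
    by_cases hy : y ∈ Metric.cthickening 1 (tsupport f)
    · exact (hL.dist_le_mul x (Metric.self_subset_cthickening _ hx) y hy).trans
        (mul_le_mul_of_nonneg_right (le_max_left _ _) dist_nonneg)
    · have h1 : 1 ≤ dist x y := by
        by_contra h
        exact hy (Metric.mem_cthickening_of_dist_le y x _ _ hx (by rw [dist_comm]; linarith))
      have h2 : f y = 0 := image_eq_zero_of_notMem_tsupport fun h =>
        hy (Metric.self_subset_cthickening _ h)
      rw [h2, dist_zero_right]
      calc ‖f x‖ ≤ M.toNNReal * 1 := by rw [mul_one]; exact (hM x hx).trans (Real.le_coe_toNNReal M)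
        _ ≤ max L M.toNNReal * dist x y := by gcongr; exact le_max_right _ _
  refine ⟨max L M.toNNReal, LipschitzWith.of_dist_le_mul fun x y => ?_⟩
  rw [NNReal.coe_max]
  by_cases hx : x ∈ tsupport f
  · exact key x hx y
  · by_cases hy : y ∈ tsupport f
    · rw [dist_comm, dist_comm x]
      exact key y hy x
    · rw [image_eq_zero_of_notMem_tsupport hx, image_eq_zero_of_notMem_tsupport hy, dist_self]
      positivity

lemma exists_deriv_smoothTransition_le : ∃ C, 0 ≤ C ∧ (∀ x, |deriv Real.smoothTransition x| ≤ C) ∧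
    ∀ x, x ∉ Icc (0 : ℝ) 1 → deriv Real.smoothTransition x = 0 := by
  have h0 : ∀ x, x ∉ Icc (0 : ℝ) 1 → deriv Real.smoothTransition x = 0 := by
    intro x hx
    rcases lt_or_ge x 0 with h | h
    · have : Real.smoothTransition =ᶠ[𝓝 x] fun _ => 0 := by
        filter_upwards [Iio_mem_nhds h] with y hy
        exact Real.smoothTransition.zero_of_nonpos (le_of_lt hy)
      rw [this.deriv_eq, deriv_const]
    · have h1 : 1 < x := by
        by_contra h'
        exact hx ⟨h, not_lt.1 h'⟩
      have : Real.smoothTransition =ᶠ[𝓝 x] fun _ => 1 := by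
        filter_upwards [Ioi_mem_nhds h1] with y hy
        exact Real.smoothTransition.one_of_one_le (le_of_lt hy)
      rw [this.deriv_eq, deriv_const]
  have hc : Continuous (deriv Real.smoothTransition) :=
    (Real.smoothTransition.contDiff (n := 1)).continuous_deriv le_rfl
  obtain ⟨C, hC⟩ := (isCompact_Icc (a := (0 : ℝ)) (b := 1)).exists_bound_of_continuousOn
    hc.continuousOn
  refine ⟨max C 0, le_max_right _ _, fun x => ?_, h0⟩
  by_cases hx : x ∈ Icc (0 : ℝ) 1
  · exact (hC x hx).trans (le_max_left _ _)
  · rw [h0 x hx, abs_zero]; exact le_max_right _ _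

section Uniqueness

variable {N : ℕ} {V : ℝ → Space N → Space N} {X : ℝ → ℝ → Space N → Space N} {K : NNReal}
  {a b : ℝ} {r : Space N → ℝ} {ρ ρ' : ℝ → Space N → ℝ}

namespace IsGlobalFlow

/-- The solution of the dual problem with right hand side `h`. -/
lemma exists_dual (hX : IsGlobalFlow V X) (hV : LipschitzWith K (fun z : ℝ × Space N => V z.1 z.2))
    (hab : a < b) {h : ℝ × Space N → ℝ} (hh : ContDiff ℝ 1 h) (hhc : HasCompactSupport h)
    (hhs : tsupport h ⊆ Ioo a b ×ˢ univ) :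
    ∃ φ : ℝ × Space N → ℝ, LocallyLipschitz φ ∧
      (∀ z, HasDerivAt (fun σ => φ (σ, X σ z.1 z.2)) (-h z) z.1) ∧
      ∃ Y : Set (Space N), IsCompact Y ∧ ∃ a' b' : ℝ, a < a' ∧ b' < b ∧ (∀ z, h z ≠ 0 → a' ≤ z.1) ∧
        ∀ z, a ≤ z.1 → φ z ≠ 0 → z.1 ≤ b' ∧ X a z.1 z.2 ∈ Y := by
  set Φ := hX.spaceTimeHomeomorph hV a with hΦ
  obtain ⟨Lh, hLh⟩ := hh.lipschitzWith_of_hasCompactSupport hhc (by simp)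
  obtain ⟨M, hM⟩ := hhc.exists_bound_of_continuous hh.continuous
  set H : ℝ → Space N → ℝ := fun s y => h (s, X s a y) with hH
  have hHc : Continuous fun z : ℝ × Space N => H z.1 z.2 :=
    hh.continuous.comp Φ.continuous
  have hHs : ∀ s, s ∉ Ioo a b → ∀ x, h (s, x) = 0 := fun s hs x => by
    by_contra h'
    exact hs (hhs (subset_tsupport _ h')).1
  have hHy : ∀ y, Continuous fun s => H s y := fun y =>
    hHc.comp (continuous_id.prodMk continuous_const)
  have hHL : ∀ s y y', |H s y - H s y'| ≤ Lh * Real.exp (K * (b - a)) * dist y y' := by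
    intro s y y'
    by_cases hs : s ∈ Ioo a b
    · have h1 := hLh.dist_le_mul (s, X s a y) (s, X s a y')
      rw [Prod.dist_eq, dist_self, max_eq_right dist_nonneg] at h1
      refine h1.trans ?_
      rw [mul_assoc, mul_comm (Real.exp _)]
      refine mul_le_mul_of_nonneg_left ((hX.dist_le hV s a y y').trans ?_) Lh.2
      gcongr
      rw [abs_of_pos (by linarith [hs.1])]
      linarith [hs.2]
    · simp only [hH, hHs s hs, sub_zero, abs_zero]
      positivity
  -- The source is integrated along characteristics backwards from time `b`. `Ψ` is the dual
  -- solution in Lagrangian coordinates, where `X a` turns a point into its label.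
  set Ψ : ℝ × Space N → ℝ := fun z => ∫ s in z.1..b, H s z.2 with hΨ
  have hΨL : LocallyLipschitz Ψ := by
    intro z₀
    set L : ℝ := Lh * Real.exp (K * (b - a)) * (|b - z₀.1| + 1) + |M| with hL
    refine ⟨L.toNNReal, Metric.ball z₀ 1, Metric.ball_mem_nhds _ one_pos,
      LipschitzOnWith.of_dist_le_mul fun z hz z' hz' => ?_⟩
    rw [Real.coe_toNNReal _ (by positivity)]
    rw [Metric.mem_ball, Prod.dist_eq, max_lt_iff, Real.dist_eq] at hz hz'
    have hzz : |z.1 - z'.1| ≤ dist z z' := by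
      rw [Prod.dist_eq, Real.dist_eq]; exact le_max_left _ _
    have hzz2 : dist z.2 z'.2 ≤ dist z z' := by
      rw [Prod.dist_eq]; exact le_max_right _ _
    have e1 : |Ψ z - ∫ s in z.1..b, H s z'.2| ≤
        Lh * Real.exp (K * (b - a)) * dist z.2 z'.2 * |b - z.1| := by
      rw [hΨ, ← intervalIntegral.integral_sub ((hHy _).intervalIntegrable _ _)
        ((hHy _).intervalIntegrable _ _)]
      exact intervalIntegral.norm_integral_le_of_norm_le_const
        (f := fun s => H s z.2 - H s z'.2) fun s _ => hHL s _ _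
    have e2 : |(∫ s in z.1..b, H s z'.2) - Ψ z'| ≤ |M| * |z.1 - z'.1| := by
      rw [hΨ, intervalIntegral.integral_interval_sub_interval_comm ((hHy _).intervalIntegrable _ _)
        ((hHy _).intervalIntegrable _ _) ((hHy _).intervalIntegrable _ _),
        intervalIntegral.integral_same, sub_zero, abs_sub_comm z.1]
      exact intervalIntegral.norm_integral_le_of_norm_le_const fun s _ =>
        (hM _).trans (le_abs_self M)
    have e3 : |b - z.1| ≤ |b - z₀.1| + 1 := by
      have := abs_sub_le b z₀.1 z.1
      rw [abs_sub_comm z₀.1] at this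
      linarith [hz.1]
    rw [Real.dist_eq]
    calc |Ψ z - Ψ z'| ≤ _ + _ := abs_sub_le _ (∫ s in z.1..b, H s z'.2) _
      _ ≤ Lh * Real.exp (K * (b - a)) * dist z z' * (|b - z₀.1| + 1) + |M| * dist z z' := by
        refine add_le_add (e1.trans ?_) (e2.trans ?_) <;> gcongr
      _ = L * dist z z' := by rw [hL]; ring
  -- The extra point only makes the set nonempty, so that a first and a last time exist even when `h
  -- = 0`.
  set Z : Set (ℝ × Space N) := insert ((a + b) / 2, 0) (Φ ⁻¹' (tsupport h)) with hZ
  have hZc : IsCompact Z := ((Φ.isCompact_preimage).2 hhc).insert _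
  have hZt : ∀ z ∈ Z, z.1 ∈ Ioo a b := by
    rintro z (rfl | hz)
    · exact ⟨by simp only; linarith, by simp only; linarith⟩
    · exact (hhs hz).1
  have hZn : Z.Nonempty := ⟨_, mem_insert _ _⟩
  obtain ⟨p, hpZ, hp⟩ := hZc.exists_isMinOn hZn continuous_fst.continuousOn
  obtain ⟨q, hqZ, hq⟩ := hZc.exists_isMaxOn hZn continuous_fst.continuousOn
  have hHZ : ∀ s y, H s y ≠ 0 → (s, y) ∈ Z := fun s y hs =>
    Or.inr (subset_tsupport _ hs : Φ (s, y) ∈ tsupport h)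
  refine ⟨fun z => Ψ (z.1, X a z.1 z.2),
    hΨL.comp (LipschitzWith.prod_fst.locallyLipschitz.prodMk (hX.locallyLipschitz_inv hV a)),
    fun z => ?_, Prod.snd '' Z, hZc.image continuous_snd, p.1, q.1, (hZt p hpZ).1, (hZt q hqZ).2,
    fun z hz => ?_, fun z hza hz => ?_⟩
  · have e : ∀ σ, Ψ (σ, X a σ (X σ z.1 z.2)) = ∫ s in σ..b, h (s, X s z.1 z.2) := fun σ => by
      simp only [hΨ, hH, hX.comp hV]
    have hc : Continuous fun s => h (s, X s z.1 z.2) :=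
      hh.continuous.comp (continuous_id.prodMk (hX.continuous_time _ _))
    have := intervalIntegral.integral_hasDerivAt_left (hc.intervalIntegrable z.1 b)
      hc.stronglyMeasurable.stronglyMeasurableAtFilter hc.continuousAt
    rw [hX.init] at this
    simpa only [e] using this
  · refine isMinOn_iff.1 hp (z.1, X a z.1 z.2) (hHZ z.1 (X a z.1 z.2) ?_)
    simpa only [hH, hX.comp hV, hX.init] using hz
  · obtain ⟨s, hs, hs0⟩ : ∃ s ∈ uIoc z.1 b, H s (X a z.1 z.2) ≠ 0 := by
      by_contra! hcon
      exact hz (intervalIntegral.integral_zero_ae (Eventually.of_forall hcon))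
    have hsZ := hHZ _ _ hs0
    have hsb := hZt _ hsZ
    refine ⟨?_, (s, X a z.1 z.2), hsZ, rfl⟩
    refine le_trans ?_ (hq hsZ)
    rcases mem_uIoc.1 hs with h' | h'
    · exact h'.1.le
    · exact absurd hsb.2 (not_lt.2 h'.1.le)

end IsGlobalFlow

namespace IsKruzkovSolution

/-- The dual solution vanishes near `b` but need not vanish at `a`; the cutoff `θ` makes `θ φ` an
admissible test function. Its derivative along `(1, V)` is the derivative along the characteristic,
that is `θ' φ - θ h`. -/
lemma integral_mul_dual_eq_zero (hρ : IsKruzkovSolution V a b r ρ) (hX : IsGlobalFlow V X)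
    (hV : LipschitzWith K (fun z : ℝ × Space N => V z.1 z.2)) {h φ : ℝ × Space N → ℝ}
    (hφ : LocallyLipschitz φ)
    (hφd : ∀ z, HasDerivAt (fun σ => φ (σ, X σ z.1 z.2)) (-h z) z.1) {Y : Set (Space N)}
    (hY : IsCompact Y) {b' : ℝ} (hb' : b' < b)
    (hφY : ∀ z, a ≤ z.1 → φ z ≠ 0 → z.1 ≤ b' ∧ X a z.1 z.2 ∈ Y)
    {θ : ℝ → ℝ} (hθ : ContDiff ℝ 1 θ) {c : ℝ} (hc : a < c) (hθ0 : ∀ τ ≤ c, θ τ = 0) :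
    ∫ z in Icc a b ×ˢ univ, ρ z.1 z.2 * (deriv θ z.1 * φ z - θ z.1 * h z) = 0 := by
  set Φ := hX.spaceTimeHomeomorph hV a with hΦ
  set χ : ℝ × Space N → ℝ := fun z => θ z.1 * φ z with hχ
  have hχL : LocallyLipschitz χ :=
    (hθ.comp contDiff_fst).locallyLipschitz.real_mul hφ
  have hS : IsCompact (Φ '' (Icc c b' ×ˢ Y)) := (isCompact_Icc.prod hY).image Φ.continuous
  have hχs : tsupport χ ⊆ Φ '' (Icc c b' ×ˢ Y) := by
    refine closure_minimal (fun z hz => ?_) hS.isClosed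
    have hz1 : θ z.1 ≠ 0 := fun h' => hz (by simp [hχ, h'])
    have hz2 : φ z ≠ 0 := fun h' => hz (by simp [hχ, h'])
    have hcz : c ≤ z.1 := by
      by_contra h'
      exact hz1 (hθ0 _ (not_le.1 h').le)
    have := hφY z (by linarith) hz2
    exact ⟨(z.1, X a z.1 z.2), ⟨⟨hcz, this.1⟩, this.2⟩, (Φ.apply_symm_apply z)⟩
  have hχc : HasCompactSupport χ := hS.of_isClosed_subset (isClosed_tsupport _) hχs
  obtain ⟨C, hC⟩ := hχL.exists_lipschitzWith_of_hasCompactSupport hχc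
  have := hρ.integral_transport_eq_zero hV hC hχc (hχs.trans (by
    rintro _ ⟨z, hz, rfl⟩
    exact ⟨⟨hc.trans_le hz.1.1, hz.1.2.trans_lt hb'⟩, mem_univ _⟩))
  rw [← this]
  refine integral_congr_ae (ae_restrict_of_ae ?_)
  filter_upwards [hC.ae_differentiableAt (μ := (volume : Measure (ℝ × Space N)))] with z hz
  have hcurve : HasDerivAt (fun σ => (σ, X σ z.1 z.2)) ((1 : ℝ), V z.1 (X z.1 z.1 z.2)) z.1 :=
    (hasDerivAt_id z.1).prodMk (hX.deriv z.1 z.2 z.1)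
  rw [hX.init] at hcurve
  have hz' : HasFDerivAt χ (fderiv ℝ χ z) (z.1, X z.1 z.1 z.2) := by
    rw [hX.init]; exact hz.hasFDerivAt
  have h1 : HasDerivAt (fun σ => χ (σ, X σ z.1 z.2)) (fderiv ℝ χ z (1, V z.1 z.2)) z.1 :=
    HasFDerivAt.comp_hasDerivAt (f := fun σ => (σ, X σ z.1 z.2)) z.1 hz' hcurve
  have h2 : HasDerivAt (fun σ => χ (σ, X σ z.1 z.2))
      (deriv θ z.1 * φ (z.1, X z.1 z.1 z.2) + θ z.1 * -h z) z.1 :=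
    ((hθ.differentiable (by simp)) z.1).hasDerivAt.mul (hφd z)
  rw [hX.init] at h2
  rw [h1.unique h2]
  ring

lemma exists_lintegral_sub_le (hρ : IsKruzkovSolution V a b r ρ)
    (hρ' : IsKruzkovSolution V a b r ρ') (hab : a < b)
    (hr : AEStronglyMeasurable r) (R : ℝ) {η : ENNReal} (hη : 0 < η) :
    ∃ e > 0, ∀ᵐ τ : ℝ, τ ∈ Ioo a (a + e) →
      ∫⁻ x in Metric.ball 0 R, ‖ρ τ x - ρ' τ x‖ₑ ≤ η := by
  have hη2 : 0 < η / 2 := ENNReal.half_pos hη.ne'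
  have hm : ∀ {ρ : ℝ → Space N → ℝ}, IsKruzkovSolution V a b r ρ →
      ∀ᵐ τ : ℝ, τ ∈ Icc a b → AEStronglyMeasurable (ρ τ) := by
    intro ρ hρ
    have h1 := hρ.locallyIntegrable.aestronglyMeasurable
    rw [Measure.volume_eq_prod, ← Measure.prod_restrict, Measure.restrict_univ] at h1
    exact (ae_restrict_iff' measurableSet_Icc).1 h1.prodMk_left
  have h1 := (hρ.initial R).eventually (ge_mem_nhds hη2)
  have h2 := (hρ'.initial R).eventually (ge_mem_nhds hη2)
  obtain ⟨s, hs, t, ht, hst⟩ := mem_inf_iff_superset.1 (h1.and h2)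
  obtain ⟨c, hc, hcs⟩ := (mem_nhdsGT_iff_exists_Ioo_subset).1 hs
  refine ⟨min (c - a) (b - a), lt_min (sub_pos.2 hc) (sub_pos.2 hab), ?_⟩
  filter_upwards [ht, hm hρ, hm hρ'] with τ hτ hmτ hmτ' hτa
  have hτc : τ < c := by linarith [hτa.2, min_le_left (c - a) (b - a)]
  have hτb : τ < b := by linarith [hτa.2, min_le_right (c - a) (b - a)]
  obtain ⟨h3, h4⟩ := hst ⟨hcs ⟨hτa.1, hτc⟩, hτ⟩
  have hτI : τ ∈ Icc a b := ⟨hτa.1.le, hτb.le⟩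
  calc ∫⁻ x in Metric.ball 0 R, ‖ρ τ x - ρ' τ x‖ₑ
      ≤ ∫⁻ x in Metric.ball 0 R, (‖ρ τ x - r x‖ₑ + ‖ρ' τ x - r x‖ₑ) := by
        refine lintegral_mono fun x => ?_
        have : ρ τ x - ρ' τ x = (ρ τ x - r x) - (ρ' τ x - r x) := by ring
        rw [this]
        exact enorm_sub_le
    _ = (∫⁻ x in Metric.ball 0 R, ‖ρ τ x - r x‖ₑ) + ∫⁻ x in Metric.ball 0 R, ‖ρ' τ x - r x‖ₑ :=
        lintegral_add_left' ((hmτ hτI).sub hr).enorm.restrict _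
    _ ≤ η := (add_le_add h3 h4).trans_eq (ENNReal.add_halves η)

/-- Kružkov solutions with the same datum coincide. -/
theorem ae_eq (hρ : IsKruzkovSolution V a b r ρ) (hρ' : IsKruzkovSolution V a b r ρ')
    (hX : IsGlobalFlow V X) (hV : LipschitzWith K (fun z : ℝ × Space N => V z.1 z.2))
    (hab : a < b) (hr : AEStronglyMeasurable r) :
    ∀ᵐ z ∂((volume : Measure (ℝ × Space N)).restrict (Icc a b ×ˢ univ)),
      ρ z.1 z.2 = ρ' z.1 z.2 := by
  have hms : MeasurableSet (Icc a b ×ˢ (univ : Set (Space N))) :=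
    measurableSet_Icc.prod MeasurableSet.univ
  set d : ℝ × Space N → ℝ := fun z => ρ z.1 z.2 - ρ' z.1 z.2 with hd
  have hdl : LocallyIntegrableOn d (Icc a b ×ˢ univ) := hρ.locallyIntegrable.sub hρ'.locallyIntegrable
  have hO : IsOpen (Ioo a b ×ˢ (univ : Set (Space N))) := isOpen_Ioo.prod isOpen_univ
  suffices h : ∀ᵐ z : ℝ × Space N, z ∈ Ioo a b ×ˢ (univ : Set (Space N)) → d z = 0 by
    have h1 : (Ioo a b ×ˢ (univ : Set (Space N))) =ᵐ[volume] (Icc a b ×ˢ (univ : Set (Space N))) := by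
      rw [Measure.volume_eq_prod]
      exact Measure.set_prod_ae_eq Ioo_ae_eq_Icc (Filter.EventuallyEq.refl _ _)
    rw [← Measure.restrict_congr_set h1, ae_restrict_iff' hO.measurableSet]
    exact h.mono fun z hz hzm => sub_eq_zero.1 (hz hzm)
  refine hO.ae_eq_zero_of_integral_contDiff_smul_eq_zero
    (hdl.mono_set (prod_mono Ioo_subset_Icc_self Subset.rfl)) fun g hg hgc hgs => ?_
  obtain ⟨φ, hφ, hφd, Y, hY, a', b', ha', hb', hga, hφY⟩ :=
    hX.exists_dual hV hab (hg.of_le (by simp)) hgc hgs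
  set Φ := hX.spaceTimeHomeomorph hV a with hΦ
  set W := Φ '' (Icc a b ×ˢ Y) with hW
  have hWc : IsCompact W := (isCompact_Icc.prod hY).image Φ.continuous
  have hφW : ∀ z : ℝ × Space N, z.1 ∈ Icc a b → φ z ≠ 0 → z ∈ W := fun z hz hz0 =>
    ⟨(z.1, X a z.1 z.2), ⟨hz, (hφY z hz.1 hz0).2⟩, Φ.apply_symm_apply z⟩
  obtain ⟨M, hM⟩ := hWc.exists_bound_of_continuousOn hφ.continuous.continuousOn
  obtain ⟨R, hR⟩ := (hWc.image continuous_snd).isBounded.subset_ball 0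
  obtain ⟨C, hC0, hC, hCz⟩ := exists_deriv_smoothTransition_le
  have hφM : ∀ z : ℝ × Space N, z.1 ∈ Icc a b → |φ z| ≤ |M| := fun z hz => by
    by_cases h : φ z = 0
    · rw [h, abs_zero]; positivity
    · exact (hM z (hφW z hz h)).trans (le_abs_self M)
  have hWI : W ⊆ Icc a b ×ˢ univ := by
    rintro _ ⟨z, hz, rfl⟩
    exact ⟨hz.1, mem_univ _⟩
  have hgI : tsupport g ⊆ Icc a b ×ˢ univ := hgs.trans (prod_mono Ioo_subset_Icc_self Subset.rfl)
  have hSI : W ∪ tsupport g ⊆ Icc a b ×ˢ univ := union_subset hWI hgI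
  have hSc : IsCompact (W ∪ tsupport g) := hWc.union hgc
  have hint : ∀ {ρ : ℝ → Space N → ℝ}, IsKruzkovSolution V a b r ρ → ∀ {F : ℝ × Space N → ℝ},
      Continuous F → (∀ z : ℝ × Space N, z.1 ∈ Icc a b → z ∉ W ∪ tsupport g → F z = 0) →
      IntegrableOn (fun z : ℝ × Space N => ρ z.1 z.2 * F z) (Icc a b ×ˢ univ) := by
    intro ρ hρ F hF hF0
    refine IntegrableOn.of_forall_sdiff_eq_zero (s := W ∪ tsupport g) ?_ hms fun z hz => by
      rw [hF0 z hz.1.1 hz.2, mul_zero]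
    exact (hρ.locallyIntegrable.integrableOn_compact_subset hSI hSc).mul_continuousOn
      hF.continuousOn hSc
  have hg0 : ∀ z : ℝ × Space N, z.1 ∈ Icc a b → z ∉ W ∪ tsupport g → g z = 0 := fun z _ hz =>
    image_eq_zero_of_notMem_tsupport fun h => hz (Or.inr h)
  have e0 : ∫ z, g z • d z = ∫ z in Icc a b ×ˢ univ, d z * g z := by
    rw [setIntegral_eq_integral_of_forall_compl_eq_zero fun z hz => by
      rw [image_eq_zero_of_notMem_tsupport fun h => hz (hgI h), mul_zero]]
    simp only [smul_eq_mul, mul_comm]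
  rw [e0]
  -- The cutoff rises from 0 to 1 on `[a + ε, a + 2 ε]`, before the support of `g` begins. Hence `∫
  -- d g = ∫ d θ' φ`, and `|θ'| ≤ C / ε` on an interval of length `ε`: the bound is `C |M|` times
  -- the `L^1` distance of the solutions near time `a`.
  have key : ∀ η : ℝ, 0 < η → |∫ z in Icc a b ×ˢ univ, d z * g z| ≤ C * |M| * η := by
    intro η hη
    obtain ⟨e, he, hde⟩ := hρ.exists_lintegral_sub_le hρ' hab hr R (ENNReal.ofReal_pos.2 hη)
    obtain ⟨ε, hε, hεe, hεa, hεb⟩ : ∃ ε : ℝ, 0 < ε ∧ 2 * ε < e ∧ a + 2 * ε ≤ a' ∧ a + 2 * ε < b := by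
      refine ⟨min (e / 3) (min ((a' - a) / 3) ((b - a) / 3)), ?_, ?_, ?_, ?_⟩
      · refine lt_min ?_ (lt_min ?_ ?_) <;> linarith
      · linarith [min_le_left (e / 3) (min ((a' - a) / 3) ((b - a) / 3))]
      · have h1 := min_le_right (e / 3) (min ((a' - a) / 3) ((b - a) / 3))
        have h2 := min_le_left ((a' - a) / 3) ((b - a) / 3)
        linarith
      · have h1 := min_le_right (e / 3) (min ((a' - a) / 3) ((b - a) / 3))
        have h2 := min_le_right ((a' - a) / 3) ((b - a) / 3)
        linarith
    set θ : ℝ → ℝ := fun τ => Real.smoothTransition ((τ - a - ε) / ε) with hθ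
    have hθs : ContDiff ℝ 1 θ := (Real.smoothTransition.contDiff (n := 1)).comp
      (((contDiff_id.sub contDiff_const).sub contDiff_const).div_const _)
    have hθd : ∀ τ, deriv θ τ = deriv Real.smoothTransition ((τ - a - ε) / ε) * (1 / ε) := fun τ => by
      have h1 : HasDerivAt (fun τ : ℝ => (τ - a - ε) / ε) (1 / ε) τ :=
        (((hasDerivAt_id τ).sub_const a).sub_const ε).div_const ε
      exact (((Real.smoothTransition.contDiff (n := 1)).differentiable
        (by simp) _).hasDerivAt.comp τ h1).deriv
    have hθg : ∀ z, θ z.1 * g z = g z := fun z => by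
      by_cases h : g z = 0
      · rw [h, mul_zero]
      · have : 1 ≤ (z.1 - a - ε) / ε := by
          rw [le_div_iff₀ hε]
          linarith [hga z h]
        rw [hθ]
        simp only
        rw [Real.smoothTransition.one_of_one_le this, one_mul]
    set F : ℝ × Space N → ℝ := fun z => deriv θ z.1 * φ z with hF
    have hFc : Continuous F :=
      ((hθs.continuous_deriv le_rfl).comp continuous_fst).mul hφ.continuous
    have hF0 : ∀ z : ℝ × Space N, z.1 ∈ Icc a b → z ∉ W ∪ tsupport g → F z = 0 := fun z hz hzW => by
      have : φ z = 0 := by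
        by_contra h
        exact hzW (Or.inl (hφW z hz h))
      simp only [hF, this, mul_zero]
    have hbal : ∀ {ρ : ℝ → Space N → ℝ}, IsKruzkovSolution V a b r ρ →
        ∫ z in Icc a b ×ˢ univ, ρ z.1 z.2 * g z = ∫ z in Icc a b ×ˢ univ, ρ z.1 z.2 * F z := by
      intro ρ hρ
      have h1 := hρ.integral_mul_dual_eq_zero hX hV hφ hφd hY hb' hφY hθs (c := a + ε) (by linarith)
        fun τ hτ => Real.smoothTransition.zero_of_nonpos
          (div_nonpos_of_nonpos_of_nonneg (by linarith) hε.le)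
      simp only [hθg, mul_sub] at h1
      rw [integral_sub (hint hρ hFc hF0) (hint hρ hg.continuous hg0)] at h1
      linarith
    have e1 : ∫ z in Icc a b ×ˢ univ, d z * g z = ∫ z in Icc a b ×ˢ univ, d z * F z := by
      simp only [hd, sub_mul]
      rw [integral_sub (hint hρ hg.continuous hg0) (hint hρ' hg.continuous hg0),
        integral_sub (hint hρ hFc hF0) (hint hρ' hFc hF0), hbal hρ, hbal hρ']
    rw [e1, ← ENNReal.ofReal_le_ofReal_iff (by positivity), ← Real.enorm_eq_ofReal_abs]
    set J := Icc (a + ε) (a + 2 * ε) with hJ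
    have hJI : J ⊆ Icc a b := Icc_subset_Icc (by linarith) (by linarith)
    have hms' : MeasurableSet (J ×ˢ Metric.ball (0 : Space N) R) :=
      measurableSet_Icc.prod Metric.isOpen_ball.measurableSet
    have hdm : AEMeasurable (fun z => ‖d z‖ₑ)
        ((volume.restrict J).prod (volume.restrict (Metric.ball (0 : Space N) R))) := by
      rw [Measure.prod_restrict, ← Measure.volume_eq_prod]
      exact (hdl.aestronglyMeasurable.mono_set (prod_mono hJI (subset_univ _))).enorm
    calc ‖∫ z in Icc a b ×ˢ univ, d z * F z‖ₑ
        ≤ ∫⁻ z in Icc a b ×ˢ univ, ‖d z * F z‖ₑ := enorm_integral_le_lintegral_enorm _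
      _ ≤ ∫⁻ z in Icc a b ×ˢ univ, (J ×ˢ Metric.ball (0 : Space N) R).indicator
            (fun z => ENNReal.ofReal (C * (1 / ε) * |M|) * ‖d z‖ₑ) z := by
          refine setLIntegral_mono' hms fun z hz => ?_
          by_cases hzJ : z ∈ J ×ˢ Metric.ball (0 : Space N) R
          · rw [indicator_of_mem hzJ, enorm_mul, mul_comm]
            gcongr
            rw [Real.enorm_eq_ofReal_abs]
            refine ENNReal.ofReal_le_ofReal ?_
            rw [hF, abs_mul, hθd, abs_mul, abs_of_pos (one_div_pos.2 hε)]
            refine mul_le_mul ?_ (hφM z hz.1) (abs_nonneg _) (by positivity)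
            exact mul_le_mul_of_nonneg_right (hC _) (by positivity)
          · rw [indicator_of_notMem hzJ]
            have : F z = 0 := by
              by_contra h
              have h1 : deriv θ z.1 ≠ 0 := left_ne_zero_of_mul h
              have h2 : φ z ≠ 0 := right_ne_zero_of_mul h
              refine hzJ ⟨?_, hR ⟨z, hφW z hz.1 h2, rfl⟩⟩
              by_contra h3
              refine h1 ?_
              rw [hθd, hCz, zero_mul]
              intro h4
              refine h3 ⟨?_, ?_⟩
              · have := h4.1
                rw [le_div_iff₀ hε] at this
                linarith
              · have := h4.2
                rw [div_le_iff₀ hε] at this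
                linarith
            simp [this]
      _ ≤ ∫⁻ z in J ×ˢ Metric.ball (0 : Space N) R, ENNReal.ofReal (C * (1 / ε) * |M|) * ‖d z‖ₑ := by
          rw [← lintegral_indicator hms']
          exact setLIntegral_le_lintegral _ _
      _ = ENNReal.ofReal (C * (1 / ε) * |M|) * ∫⁻ τ in J, ∫⁻ x in Metric.ball (0 : Space N) R,
            ‖d (τ, x)‖ₑ := by
          rw [lintegral_const_mul' _ _ ENNReal.ofReal_ne_top, Measure.volume_eq_prod,
            ← Measure.prod_restrict, lintegral_prod _ hdm]
      _ ≤ ENNReal.ofReal (C * (1 / ε) * |M|) * ∫⁻ τ in J, ENNReal.ofReal η := by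
          refine mul_le_mul_right (setLIntegral_mono_ae' measurableSet_Icc ?_) _
          filter_upwards [hde] with τ hτ hτJ
          exact hτ ⟨by linarith [hτJ.1], by linarith [hτJ.2]⟩
      _ = ENNReal.ofReal (C * |M| * η) := by
          rw [lintegral_const, Measure.restrict_apply_univ, hJ, Real.volume_Icc,
            ← ENNReal.ofReal_mul hη.le, ← ENNReal.ofReal_mul (by positivity)]
          congr 1
          field_simp
          ring
  by_contra hne
  have hpos : 0 < |∫ z in Icc a b ×ˢ univ, d z * g z| := abs_pos.2 hne
  set I := |∫ z in Icc a b ×ˢ univ, d z * g z| with hI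
  have h1 := key (I / (2 * (C * |M| + 1))) (by positivity)
  have h2 : C * |M| * (I / (2 * (C * |M| + 1))) ≤ I / 2 := by
    rw [mul_div_assoc', div_le_div_iff₀ (by positivity) two_pos]
    nlinarith [hpos]
  linarith

end IsKruzkovSolution

end Uniqueness

/-! ### Use of weak gradients, and passage from almost everywhere to closures. -/

section WeakGradient

/-- The norm is an infimum over representatives, so a representative is taken for each `C' > C` and
then `C' → C`. The second function `g'` allows a field that agrees with the given one on `Ω` only.
-/
lemma abs_integral_le_of_weakPartialGradientNorm_le {N : ℕ} {F : Type*} [NormedAddCommGroup F]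
    [NormedSpace ℝ F] [MeasureSpace F] [BorelSpace F]
    [IsFiniteMeasureOnCompacts (volume : Measure F)]
    {ι : Space N →L[ℝ] F} {Ω : Set F} {g g' : F → ℝ}
    (hgg' : ∀ y ∈ Ω, g y = g' y) {C : ℝ} (hC : 0 ≤ C)
    (h : weakPartialGradientNorm ι Ω g ≤ ENNReal.ofReal C) {φ : F → ℝ}
    (hφ : ContDiff ℝ (⊤ : ℕ∞) φ) (hφc : HasCompactSupport φ) (hφΩ : tsupport φ ⊆ Ω) (e : Space N) :
    |∫ y, g' y * fderiv ℝ φ y (ι e)| ≤ C * ‖e‖ * ∫ y, |φ y| := by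
  have hφi : Integrable φ := hφ.continuous.integrable_of_hasCompactSupport hφc
  have key : ∀ C' : ℝ, C < C' →
      |∫ y, g' y * fderiv ℝ φ y (ι e)| ≤ C' * (‖e‖ * ∫ y, |φ y|) := by
    intro C' hC'
    have h1 : weakPartialGradientNorm ι Ω g < ENNReal.ofReal C' :=
      h.trans_lt ((ENNReal.ofReal_lt_ofReal_iff (hC.trans_lt hC')).2 hC')
    simp only [weakPartialGradientNorm, iInf_lt_iff] at h1
    obtain ⟨G, ⟨-, hGi, hG⟩, hGC⟩ := h1
    have h2 : ∀ᵐ y ∂(volume.restrict Ω), ‖G y‖ ≤ C' := by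
      filter_upwards [ae_le_eLpNormEssSup (f := G) (μ := volume.restrict Ω)] with y hy
      rw [← eLpNorm_exponent_top] at hy
      have := hy.trans hGC.le
      rwa [← ofReal_norm, ENNReal.ofReal_le_ofReal_iff (hC.trans hC'.le)] at this
    have e1 : ∫ y, g' y * fderiv ℝ φ y (ι e) = ∫ y, g y * fderiv ℝ φ y (ι e) := by
      refine integral_congr_ae (Eventually.of_forall fun y => ?_)
      by_cases hy : y ∈ Ω
      · simp only [hgg' y hy]
      · have : fderiv ℝ φ y = 0 := by
          by_contra h'
          exact hy (hφΩ (support_fderiv_subset ℝ h'))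
        simp [this]
    rw [e1, hG φ hφ hφc hφΩ e, abs_neg, ← integral_const_mul, ← integral_const_mul]
    have e2 : ∫ y, inner ℝ (G y) e * φ y = ∫ y in tsupport φ, inner ℝ (G y) e * φ y := by
      refine (setIntegral_eq_integral_of_forall_compl_eq_zero fun y hy => ?_).symm
      rw [image_eq_zero_of_notMem_tsupport hy, mul_zero]
    have e3 : ∫ y, C' * (‖e‖ * |φ y|) = ∫ y in tsupport φ, C' * (‖e‖ * |φ y|) := by
      refine (setIntegral_eq_integral_of_forall_compl_eq_zero fun y hy => ?_).symm
      rw [image_eq_zero_of_notMem_tsupport hy, abs_zero, mul_zero, mul_zero]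
    rw [e2, e3, ← Real.norm_eq_abs]
    refine norm_integral_le_of_norm_le ((hφi.abs.const_mul _).const_mul _).integrableOn ?_
    filter_upwards [ae_restrict_of_ae_restrict_of_subset hφΩ h2] with y hy
    rw [norm_mul, ← mul_assoc]
    refine mul_le_mul_of_nonneg_right ?_ (norm_nonneg _)
    exact (norm_inner_le_norm _ _).trans (mul_le_mul_of_nonneg_right hy (norm_nonneg _))
  rw [mul_assoc]
  have ht : Tendsto (fun C' => C' * (‖e‖ * ∫ y, |φ y|)) (𝓝[>] C) (𝓝 (C * (‖e‖ * ∫ y, |φ y|))) :=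
    ((continuous_id.mul continuous_const).tendsto C).mono_left nhdsWithin_le_nhds
  exact ge_of_tendsto ht (eventually_mem_nhdsWithin.mono key)

/-- This reaches the null slice at the initial time and the boundary of the ball of leader
positions, which almost everywhere bounds do not see. -/
lemma le_on_closure_of_ae {F : Type*} [TopologicalSpace F] [MeasurableSpace F]
    {μ : Measure F} [μ.IsOpenPosMeasure] {Ω : Set F} (hΩ : IsOpen Ω) {f g : F → ℝ}
    (hf : Continuous f) (hg : Continuous g) (h : ∀ᵐ q ∂μ, q ∈ Ω → f q ≤ g q) :
    ∀ q ∈ closure Ω, f q ≤ g q := by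
  refine fun q hq => closure_minimal (fun q' hq' => ?_) (isClosed_le hf hg) hq
  by_contra hn
  replace hn : g q' < f q' := lt_of_not_ge hn
  have hU : IsOpen (Ω ∩ {q | g q < f q}) := hΩ.inter (isOpen_lt hg hf)
  refine (hU.measure_pos μ ⟨q', hq', hn⟩).ne' (measure_mono_null ?_ h)
  intro y hy h'
  exact absurd (h' hy.1) (not_le.2 hy.2)

end WeakGradient

/-! ### Bounds at the frozen time. -/

section Bounds

instance isAddHaarMeasure_volume_prod_prod {N : ℕ} :
    (volume : Measure (ℝ × Space N × Space N)).IsAddHaarMeasure := isAddHaarMeasure_volume_prod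

variable {N : ℕ} {v : ℝ → Space N → Space N → Space N} {K : NNReal} {t δ : ℝ}

lemma ae_ae_ae_of_ae_prod {p : ℝ × Space N × Space N → Prop} (h : ∀ᵐ z, p z) :
    ∀ᵐ τ : ℝ, ∀ᵐ P : Space N, ∀ᵐ x : Space N, p (τ, x, P) := by
  rw [Measure.volume_eq_prod] at h
  filter_upwards [Measure.ae_ae_of_ae_prod h] with τ hτ
  have h1 : ∀ᵐ q : Space N × Space N ∂(volume.prod volume), p (τ, q.2, q.1) :=
    (Measure.measurePreserving_swap (μ := (volume : Measure (Space N)))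
      (ν := (volume : Measure (Space N)))).quasiMeasurePreserving.ae hτ
  exact Measure.ae_ae_of_ae_prod h1

lemma left_mem_closure_Ioo_add (hδ : 0 < δ) : t ∈ closure (Ioo t (t + δ)) := by
  rw [closure_Ioo (by linarith)]
  exact ⟨le_rfl, by linarith⟩

lemma lipschitzWith_slice_x (hv : LipschitzWith K fun z : ℝ × Space N × Space N => v z.1 z.2.1 z.2.2)
    (τ : ℝ) (P : Space N) : LipschitzWith K fun x => v τ x P := by
  have := hv.comp ((LipschitzWith.prodMk_left τ).comp (LipschitzWith.prodMk_right P))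
  rwa [mul_one, mul_one] at this

lemma lipschitzWith_slice_P (hv : LipschitzWith K fun z : ℝ × Space N × Space N => v z.1 z.2.1 z.2.2)
    (τ : ℝ) (x : Space N) : LipschitzWith K fun P => v τ x P := by
  have := hv.comp ((LipschitzWith.prodMk_left τ).comp (LipschitzWith.prodMk_left x))
  rwa [mul_one, mul_one] at this

/-- For almost every `(τ, P)` the derivative bound holds at almost every `x` and gives a Lipschitz
constant. The resulting inequality between two points is closed, so continuity of `v` extends it to
`τ = t` and to the closure of `B`. -/
lemma lipschitzWith_x_of_ae_le
    (hv : LipschitzWith K fun z : ℝ × Space N × Space N => v z.1 z.2.1 z.2.2) (hδ : 0 < δ)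
    {B : Set (Space N)} (hB : IsOpen B) {C : NNReal}
    (h : ∀ᵐ z : ℝ × Space N × Space N, z ∈ slab t δ B →
      ‖fderiv ℝ (fun x => v z.1 x z.2.2) z.2.1‖ ≤ C) {P : Space N} (hP : P ∈ closure B) :
    LipschitzWith C fun x => v t x P := by
  refine LipschitzWith.of_dist_le_mul fun x y => ?_
  have hc := hv.continuous
  refine le_on_closure_of_ae (μ := volume) isOpen_Ioo (f := fun τ => dist (v τ x P) (v τ y P))
    (g := fun _ => C * dist x y)
    ((hc.comp (by fun_prop : Continuous fun τ : ℝ => (τ, x, P))).dist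
      (hc.comp (by fun_prop : Continuous fun τ : ℝ => (τ, y, P))))
    continuous_const ?_ t (left_mem_closure_Ioo_add hδ)
  filter_upwards [ae_ae_ae_of_ae_prod h] with τ hτ hτI
  refine le_on_closure_of_ae (μ := volume) hB (f := fun P => dist (v τ x P) (v τ y P))
    (g := fun _ => C * dist x y)
    ((hc.comp (by fun_prop : Continuous fun P : Space N => (τ, x, P))).dist
      (hc.comp (by fun_prop : Continuous fun P : Space N => (τ, y, P))))
    continuous_const ?_ P hP
  filter_upwards [hτ] with P hP hPB
  refine (LipschitzWith.of_ae_norm_fderiv_le (μ := volume) (lipschitzWith_slice_x hv τ P)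
    ?_).dist_le_mul x y
  filter_upwards [hP] with x hx
  exact hx ⟨hτI, mem_univ _, hPB⟩

lemma lipschitzWith_P_of_ae_le
    (hv : LipschitzWith K fun z : ℝ × Space N × Space N => v z.1 z.2.1 z.2.2) (hδ : 0 < δ)
    {C : NNReal} (h : ∀ᵐ z : ℝ × Space N × Space N, z ∈ slab t δ univ →
      ‖fderiv ℝ (fun P => v z.1 z.2.1 P) z.2.2‖ ≤ C) (x : Space N) :
    LipschitzWith C fun P => v t x P := by
  refine LipschitzWith.of_dist_le_mul fun P Q => ?_
  have hc := hv.continuous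
  refine le_on_closure_of_ae (μ := volume) isOpen_Ioo (f := fun τ => dist (v τ x P) (v τ x Q))
    (g := fun _ => C * dist P Q)
    ((hc.comp (by fun_prop : Continuous fun τ : ℝ => (τ, x, P))).dist
      (hc.comp (by fun_prop : Continuous fun τ : ℝ => (τ, x, Q))))
    continuous_const ?_ t (left_mem_closure_Ioo_add hδ)
  rw [Measure.volume_eq_prod] at h
  filter_upwards [Measure.ae_ae_of_ae_prod h] with τ hτ hτI
  refine le_on_closure_of_ae (μ := volume) isOpen_univ (f := fun x => dist (v τ x P) (v τ x Q))
    (g := fun _ => C * dist P Q)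
    ((hc.comp (by fun_prop : Continuous fun x : Space N => (τ, x, P))).dist
      (hc.comp (by fun_prop : Continuous fun x : Space N => (τ, x, Q))))
    continuous_const ?_ x (subset_closure (mem_univ _))
  filter_upwards [Measure.ae_ae_of_ae_prod hτ] with x hx _
  refine (LipschitzWith.of_ae_norm_fderiv_le (μ := volume) (lipschitzWith_slice_P hv τ x)
    ?_).dist_le_mul P Q
  filter_upwards [hx] with P hP
  exact hP ⟨hτI, mem_univ _, mem_univ _⟩

lemma divergence_comp_add_right (f : Space N → Space N) (h x : Space N) :
    divergence (fun x => f (x + h)) x = divergence f (x + h) := by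
  simp only [divergence, fderiv_comp_add_right]

lemma divergence_sub {f g : Space N → Space N} {x : Space N} (hf : DifferentiableAt ℝ f x)
    (hg : DifferentiableAt ℝ g x) :
    divergence (fun x => f x - g x) x = divergence f x - divergence g x := by
  simp [divergence, fderiv_fun_sub hf hg]

lemma measurable_divergence_of_lipschitzWith {f : Space N → Space N} (hf : LipschitzWith K f) :
    Measurable (divergence f) :=
  (measurable_divergence (W := fun _ : Unit => f) (hf.continuous.comp continuous_snd)).comp
    (measurable_prodMk_left (x := ()))

lemma locallyIntegrable_of_abs_le {F : Type*} [NormedAddCommGroup F] [MeasurableSpace F]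
    {μ : Measure F} [IsLocallyFiniteMeasure μ] {f : F → ℝ} (hf : Measurable f) {C : ℝ}
    (hC : ∀ x, |f x| ≤ C) : LocallyIntegrable f μ :=
  (locallyIntegrable_const C).mono hf.aestronglyMeasurable
    (Eventually.of_forall fun s => (hC s).trans (le_abs_self C))

lemma locallyIntegrable_divX
    (hv : LipschitzWith K fun z : ℝ × Space N × Space N => v z.1 z.2.1 z.2.2) :
    LocallyIntegrable (divX v) := by
  refine locallyIntegrable_of_abs_le (C := N * K) ?_ fun z =>
    abs_divergence_le (lipschitzWith_slice_x hv z.1 z.2.2) _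
  have h1 : Continuous fun z : (ℝ × Space N) × Space N => v z.1.1 z.2 z.1.2 :=
    hv.continuous.comp (by fun_prop : Continuous fun z : (ℝ × Space N) × Space N =>
      (z.1.1, z.2, z.1.2))
  exact (measurable_divergence (W := fun (q : ℝ × Space N) x => v q.1 x q.2) h1).comp
    (by fun_prop : Measurable fun z : ℝ × Space N × Space N => ((z.1, z.2.2), z.2.1))

/-- Increments of `div_x v` that are bounded in a space-time slab are bounded at its initial
time. -/
lemma ae_abs_divergence_sub_le
    (hv : LipschitzWith K fun z : ℝ × Space N × Space N => v z.1 z.2.1 z.2.2) (hδ : 0 < δ)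
    {B : Set (Space N)} (hB : IsOpen B) {C : ℝ} {h e : Space N}
    (hyp : ∀ᵐ z : ℝ × Space N × Space N, z ∈ slab t δ B → z + (0, h, e) ∈ slab t δ B →
      |divX v (z + (0, h, e)) - divX v z| ≤ C) {P : Space N}
    (hP : P ∈ closure {P | P ∈ B ∧ P + e ∈ B}) :
    ∀ᵐ x, |divergence (fun x => v t x (P + e)) (x + h) - divergence (fun x => v t x P) x| ≤ C := by
  have hL := lipschitzWith_slice_x hv
  have hO : IsOpen {P | P ∈ B ∧ P + e ∈ B} :=
    hB.inter (hB.preimage (continuous_id.add continuous_const))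
  have hm : ∀ τ P, Measurable fun x =>
      divergence (fun x => v τ x (P + e)) (x + h) - divergence (fun x => v τ x P) x := fun τ P =>
    ((measurable_divergence_of_lipschitzWith (hL τ (P + e))).comp
      (measurable_id.add_const h)).sub (measurable_divergence_of_lipschitzWith (hL τ P))
  have hb : ∀ τ P x, |divergence (fun x => v τ x (P + e)) (x + h) -
      divergence (fun x => v τ x P) x| ≤ N * K + N * K := fun τ P x =>
    (abs_sub _ _).trans (add_le_add (abs_divergence_le (hL _ _) _) (abs_divergence_le (hL _ _) _))
  refine ae_abs_le_of_weak_le (locallyIntegrable_of_abs_le (hm t P) (hb t P)) fun ψ hψ hψc => ?_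
  have hψi : Integrable ψ := hψ.continuous.integrable_of_hasCompactSupport hψc
  -- The divergence has no pointwise continuity in `τ` and `P`. After integration by parts its
  -- pairing with `ψ` involves `v` only and is continuous, so the bound survives the passage to `τ =
  -- t` and to the closure.
  set G : ℝ × Space N → ℝ := fun q =>
    ∫ x in tsupport ψ, fderiv ℝ ψ x (v q.1 (x + h) (q.2 + e) - v q.1 x q.2) with hG
  have hGc : Continuous G := by
    refine continuous_parametric_integral_of_continuous (μ := volume)
      (f := fun (q : ℝ × Space N) x => fderiv ℝ ψ x (v q.1 (x + h) (q.2 + e) - v q.1 x q.2)) ?_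
      hψc.isCompact
    have h1 := hv.continuous.comp (by fun_prop : Continuous fun z : (ℝ × Space N) × Space N =>
      (z.1.1, z.2 + h, z.1.2 + e))
    have h2 := hv.continuous.comp (by fun_prop : Continuous fun z : (ℝ × Space N) × Space N =>
      (z.1.1, z.2, z.1.2))
    exact ((hψ.continuous_fderiv (by simp)).comp continuous_snd).clm_apply (h1.sub h2)
  have hGe : ∀ τ P, ∫ x, (divergence (fun x => v τ x (P + e)) (x + h) -
      divergence (fun x => v τ x P) x) * ψ x = -G (τ, P) := by
    intro τ P
    have h1 : LipschitzWith K fun x => v τ (x + h) (P + e) := by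
      have := (hL τ (P + e)).comp (LipschitzWith.id.add (LipschitzWith.const h))
      rwa [add_zero, mul_one] at this
    have h2 := h1.sub (hL τ P)
    have h3 : G (τ, P) = ∫ x, fderiv ℝ ψ x (v τ (x + h) (P + e) - v τ x P) := by
      refine setIntegral_eq_integral_of_forall_compl_eq_zero fun x hx => ?_
      have : fderiv ℝ ψ x = 0 := by
        by_contra h'
        exact hx (support_fderiv_subset ℝ h')
      simp [this]
    rw [h3, ← integral_divergence_mul h2 (hψ.of_le (by simp)) hψc]
    refine integral_congr_ae ?_
    filter_upwards [h1.ae_differentiableAt (μ := volume),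
      (hL τ P).ae_differentiableAt (μ := volume)] with x hx1 hx2
    rw [divergence_sub hx1 hx2, divergence_comp_add_right (fun x => v τ x (P + e))]
  rw [hGe, abs_neg]
  refine le_on_closure_of_ae (μ := volume) isOpen_Ioo (f := fun τ => |G (τ, P)|)
    (g := fun _ => C * ∫ x, |ψ x|)
    (hGc.comp (by fun_prop : Continuous fun τ : ℝ => (τ, P))).abs continuous_const ?_ t
    (left_mem_closure_Ioo_add hδ)
  filter_upwards [ae_ae_ae_of_ae_prod hyp] with τ hτ hτI
  refine le_on_closure_of_ae (μ := volume) hO (f := fun P => |G (τ, P)|)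
    (g := fun _ => C * ∫ x, |ψ x|)
    (hGc.comp (by fun_prop : Continuous fun P : Space N => (τ, P))).abs continuous_const ?_ P hP
  filter_upwards [hτ] with P hP hPO
  rw [← abs_neg, ← hGe, ← integral_const_mul, ← Real.norm_eq_abs]
  refine norm_integral_le_of_norm_le (hψi.abs.const_mul C) ?_
  filter_upwards [hP] with x hx
  rw [norm_mul]
  refine mul_le_mul_of_nonneg_right ?_ (norm_nonneg _)
  have := hx ⟨hτI, mem_univ _, hPO.1⟩ ⟨by simpa using hτI, mem_univ _, hPO.2⟩
  simpa [divX] using this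

/-- If all increments of a bounded function are almost everywhere bounded by `C` times the shift,
the function is `C`-Lipschitz on a set of full measure. -/
lemma exists_lipschitzOnWith_of_ae_abs_sub_le {f : Space N → ℝ} (hf : LocallyIntegrable f)
    {C : NNReal} (h : ∀ h : Space N, ∀ᵐ x, |f (x + h) - f x| ≤ C * ‖h‖) :
    ∃ S : Set (Space N), (∀ᵐ x, x ∈ S) ∧ LipschitzOnWith C f S := by
  -- The null set in the hypothesis depends on the shift. The points where the mollifications
  -- converge form one full set that serves all shifts.
  refine ⟨{x | Tendsto (fun n => mollify volume n f x) atTop (𝓝 (f x))}, ae_tendsto_mollify hf,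
    LipschitzOnWith.of_dist_le_mul fun x hx y hy => ?_⟩
  refine le_of_tendsto (Tendsto.dist hx hy) (Eventually.of_forall fun n => ?_)
  set η := (shrinkingBump (Space N) n).normed volume with hη
  have hi : ∀ x, Integrable fun u => η u * f (x - u) := fun x =>
    (shrinkingBump (Space N) n).hasCompactSupport_normed.convolutionExists_left
      (ContinuousLinearMap.lsmul ℝ ℝ) (shrinkingBump (Space N) n).continuous_normed hf x
  rw [Real.dist_eq, mollify_apply, mollify_apply]
  simp only [smul_eq_mul]
  rw [← integral_sub (hi x) (hi y)]
  calc |∫ u, (η u * f (x - u) - η u * f (y - u))|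
      ≤ ∫ u, C * ‖x - y‖ * η u := by
        rw [← Real.norm_eq_abs]
        refine norm_integral_le_of_norm_le
          ((shrinkingBump (Space N) n).integrable_normed.const_mul _) ?_
        filter_upwards [(quasiMeasurePreserving_sub_left volume y).ae (h (x - y))] with u hu
        rw [← mul_sub, norm_mul, Real.norm_of_nonneg ((shrinkingBump (Space N) n).nonneg_normed u),
          mul_comm]
        refine mul_le_mul_of_nonneg_right ?_ ((shrinkingBump (Space N) n).nonneg_normed u)
        rwa [show y - u + (x - y) = x - u by abel] at hu
    _ = C * dist x y := by
        rw [integral_const_mul, ContDiffBump.integral_normed, mul_one, dist_eq_norm]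

lemma isOpen_slab {B : Set (Space N)} (hB : IsOpen B) : IsOpen (slab t δ B) :=
  isOpen_Ioo.prod (isOpen_univ.prod hB)

lemma convex_slab {B : Set (Space N)} (hB : Convex ℝ B) : Convex ℝ (slab t δ B) :=
  (convex_Ioo _ _).prod (convex_univ.prod hB)

lemma exists_lipschitzOnWith_divergence
    (hv : LipschitzWith K fun z : ℝ × Space N × Space N => v z.1 z.2.1 z.2.2) (hδ : 0 < δ)
    {B : Set (Space N)} (hB : IsOpen B) (hBc : Convex ℝ B) {C : NNReal}
    {g : ℝ × Space N × Space N → ℝ} (hg : ∀ z ∈ slab t δ B, g z = divX v z)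
    (h : weakPartialGradientNorm (inclX N) (slab t δ B) g ≤ C) {P : Space N} (hP : P ∈ closure B) :
    ∃ S : Set (Space N), (∀ᵐ x, x ∈ S) ∧ LipschitzOnWith C (divergence fun x => v t x P) S := by
  refine exists_lipschitzOnWith_of_ae_abs_sub_le
    (locallyIntegrable_of_abs_le (measurable_divergence_of_lipschitzWith
      (lipschitzWith_slice_x hv t P)) (abs_divergence_le (lipschitzWith_slice_x hv t P))) fun e => ?_
  have := ae_abs_sub_le_of_weak_le (locallyIntegrable_divX hv) (isOpen_slab hB) (convex_slab hBc)
    (v := inclX N e) (C := C * ‖e‖) fun φ hφ hφc hφΩ =>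
      abs_integral_le_of_weakPartialGradientNorm_le hg C.coe_nonneg (by rwa [ENNReal.ofReal_coe_nnreal])
        hφ hφc hφΩ e
  have h2 := ae_abs_divergence_sub_le (e := 0) (h := e) (P := P) hv hδ hB this (by simpa using hP)
  simpa using h2

lemma ae_abs_divergence_sub_le_P
    (hv : LipschitzWith K fun z : ℝ × Space N × Space N => v z.1 z.2.1 z.2.2) (hδ : 0 < δ)
    {C : NNReal} {g : ℝ × Space N × Space N → ℝ} (hg : ∀ z ∈ slab t δ univ, g z = divX v z)
    (h : weakPartialGradientNorm (inclP N) (slab t δ univ) g ≤ C) (P Q : Space N) :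
    ∀ᵐ x, |divergence (fun x => v t x P) x - divergence (fun x => v t x Q) x| ≤ C * ‖P - Q‖ := by
  have := ae_abs_sub_le_of_weak_le (locallyIntegrable_divX hv) (isOpen_slab isOpen_univ)
    (convex_slab convex_univ) (v := inclP N (P - Q)) (C := C * ‖P - Q‖) fun φ hφ hφc hφΩ =>
      abs_integral_le_of_weakPartialGradientNorm_le hg C.coe_nonneg (by rwa [ENNReal.ofReal_coe_nnreal])
        hφ hφc hφΩ (P - Q)
  have h2 := ae_abs_divergence_sub_le (e := P - Q) (h := 0) (P := Q) hv hδ isOpen_univ this (by simp)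
  simpa using h2

end Bounds

/-! ### Comparison of the two flows and of their exponents. -/

section Stability

variable {N : ℕ}

/-- The bounds at the frozen time `t` on which the stability estimate rests. -/
structure FrozenBounds (v : ℝ → Space N → Space N → Space N) (t : ℝ) (p : Space N) (R : ℝ)
    (C : NNReal) : Prop where
  lipschitz_x : ∀ P ∈ Metric.closedBall p R, LipschitzWith C fun x => v t x P
  -- The factor 2 undoes the `1/2` in front of `D_P v` in `stabilityConst`.
  lipschitz_P : ∀ x, LipschitzWith (2 * C) fun P => v t x P
  divergence_x : ∀ P ∈ Metric.closedBall p R, ∃ S : Set (Space N), (∀ᵐ x, x ∈ S) ∧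
    LipschitzOnWith C (divergence fun x => v t x P) S
  divergence_P : ∀ P Q, ∀ᵐ x,
    |divergence (fun x => v t x P) x - divergence (fun x => v t x Q) x| ≤ C * ‖P - Q‖

variable {v : ℝ → Space N → Space N → Space N} {K C : NNReal} {t δ R : ℝ} {p w w' : Space N}
  {X X' : ℝ → ℝ → Space N → Space N}

lemma exists_lipschitzWith_frozenField
    (hv : LipschitzWith K fun z : ℝ × Space N × Space N => v z.1 z.2.1 z.2.2) (t : ℝ)
    (p w : Space N) :
    ∃ K', LipschitzWith K' fun z : ℝ × Space N => frozenField v t p w z.1 z.2 := by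
  have hw : LipschitzWith ‖w‖₊ fun z : ℝ × Space N => p + (z.1 - t) • w := by
    refine LipschitzWith.of_dist_le_mul fun z z' => ?_
    rw [dist_add_left, dist_eq_norm, ← sub_smul, norm_smul, coe_nnnorm, mul_comm,
      sub_sub_sub_cancel_right]
    gcongr
    rw [← dist_eq_norm, Prod.dist_eq]
    exact le_max_left _ _
  have hL : LipschitzWith (max 0 (max 1 ‖w‖₊))
      fun z : ℝ × Space N => (t, z.2, p + (z.1 - t) • w) :=
    (LipschitzWith.const t).prodMk (LipschitzWith.prod_snd.prodMk hw)
  refine ⟨K * max 0 (max 1 ‖w‖₊), fun z z' => ?_⟩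
  exact (hv.comp hL) z z'

lemma add_smul_mem_closedBall (hw : δ * ‖w‖ ≤ R) {s : ℝ} (hs : s ∈ Icc t (t + δ)) :
    p + (s - t) • w ∈ Metric.closedBall p R := by
  rw [mem_closedBall_iff_norm, add_sub_cancel_left, norm_smul, Real.norm_of_nonneg (by linarith [hs.1])]
  refine le_trans ?_ hw
  gcongr
  linarith [hs.2]

lemma norm_frozen_position_sub {s : ℝ} (hs : t ≤ s) :
    ‖(p + (s - t) • w) - (p + (s - t) • w')‖ = (s - t) * ‖w - w'‖ := by
  rw [add_sub_add_left_eq_sub, ← smul_sub, norm_smul, Real.norm_of_nonneg (by linarith)]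

/-- The flows of the frozen fields for two different speeds, run backwards from `t + δ`. -/
lemma FrozenBounds.dist_flow_le (hb : FrozenBounds v t p R C) (hδ : 0 ≤ δ) (hw : δ * ‖w‖ ≤ R)
    (hX : IsGlobalFlow (frozenField v t p w) X) (hX' : IsGlobalFlow (frozenField v t p w') X')
    {s : ℝ} (hs : s ∈ Icc t (t + δ)) (x : Space N) :
    dist (X s (t + δ) x) (X' s (t + δ) x) ≤ C * δ ^ 2 * Real.exp (C * δ) * ‖w - w'‖ := by
  set b := t + δ with hbdef
  -- Time is reversed, `σ = b - s`, so that both curves start at `x` and `e 0 = 0`.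
  set e : ℝ → Space N := fun σ => X (b - σ) b x - X' (b - σ) b x with he
  set e' : ℝ → Space N := fun σ => -(frozenField v t p w (b - σ) (X (b - σ) b x) -
    frozenField v t p w' (b - σ) (X' (b - σ) b x)) with he'
  have hed : ∀ σ, HasDerivAt e (e' σ) σ := by
    intro σ
    have h0 : HasDerivAt (fun σ : ℝ => b - σ) (-1) σ := by
      simpa using (hasDerivAt_id σ).const_sub b
    have h1 := (hX.deriv b x (b - σ)).scomp σ h0
    have h2 := (hX'.deriv b x (b - σ)).scomp σ h0
    have := h1.sub h2
    rw [neg_one_smul, neg_one_smul, ← neg_sub'] at this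
    exact this
  set A : ℝ := C * ‖w - w'‖ with hA
  have hA0 : 0 ≤ A := by positivity
  -- The intermediate value is `v` on the second trajectory with the first leader. Thus the
  -- Lipschitz bound in `x` is needed only for positions of the first leader, and the change of
  -- leader costs `2 C (δ - σ) ‖w - w'‖`.
  have hbound : ∀ σ ∈ Ico 0 δ, ‖e' σ‖ ≤ C * ‖e σ‖ + 2 * A * (δ - σ) := by
    intro σ hσ
    have hσI : b - σ ∈ Icc t (t + δ) := ⟨by linarith [hσ.2], by linarith [hσ.1]⟩
    rw [he', norm_neg]
    refine (norm_sub_le_norm_sub_add_norm_sub _ (v t (X' (b - σ) b x) (p + (b - σ - t) • w)) _).trans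
      (add_le_add ?_ ?_)
    · rw [← dist_eq_norm, he, ← dist_eq_norm]
      exact (hb.lipschitz_x _ (add_smul_mem_closedBall hw hσI)).dist_le_mul _ _
    · rw [← dist_eq_norm]
      refine ((hb.lipschitz_P _).dist_le_mul _ _).trans_eq ?_
      rw [dist_eq_norm, norm_frozen_position_sub hσI.1]
      push_cast
      rw [hA, hbdef]
      ring
  -- The term `2 δ σ - σ ^ 2` is the integral of `2 (δ - σ)`. A positive `η` makes the differential
  -- inequality of the barrier strict, as the comparison principle requires, and is then sent to 0.
  have hres : ∀ η > 0, ∀ σ ∈ Icc 0 δ,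
      ‖e σ‖ ≤ Real.exp (C * σ) * (A * (2 * δ * σ - σ ^ 2) + η * σ + η) := by
    intro η hη
    have hB : ∀ σ, HasDerivAt (fun σ => Real.exp (C * σ) * (A * (2 * δ * σ - σ ^ 2) + η * σ + η))
        (C * (Real.exp (C * σ) * (A * (2 * δ * σ - σ ^ 2) + η * σ + η)) +
          Real.exp (C * σ) * (A * (2 * δ - 2 * σ) + η)) σ := by
      intro σ
      have h1 : HasDerivAt (fun σ : ℝ => Real.exp (C * σ)) (Real.exp (C * σ) * (C * 1)) σ :=
        ((hasDerivAt_id σ).const_mul (C : ℝ)).exp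
      have h2 : HasDerivAt (fun σ : ℝ => A * (2 * δ * σ - σ ^ 2) + η * σ + η)
          (A * (2 * δ * 1 - (2 : ℕ) * σ ^ (2 - 1) * 1) + η * 1) σ :=
        (((((hasDerivAt_id σ).const_mul (2 * δ)).sub ((hasDerivAt_id σ).pow 2)).const_mul A).add
          ((hasDerivAt_id σ).const_mul η)).add_const η
      refine (h1.mul h2).congr_deriv ?_
      push_cast
      ring
    refine fun σ hσ => image_norm_le_of_norm_deriv_right_lt_deriv_boundary'
      (fun σ _ => (hed σ).continuousAt.continuousWithinAt) (fun σ _ => (hed σ).hasDerivWithinAt)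
      (B := fun σ => Real.exp (C * σ) * (A * (2 * δ * σ - σ ^ 2) + η * σ + η)) ?_
      (fun σ _ => (hB σ).continuousAt.continuousWithinAt) (fun σ _ => (hB σ).hasDerivWithinAt)
      (fun σ hσ h => ?_) hσ
    · simp only [he, sub_zero, hX.init, hX'.init, sub_self, norm_zero]
      simpa using hη.le
    · refine (hbound σ hσ).trans_lt ?_
      rw [h]
      have h1 : 1 ≤ Real.exp (C * σ) := Real.one_le_exp (mul_nonneg C.2 hσ.1)
      have h2 : 0 ≤ A * (2 * δ - 2 * σ) := mul_nonneg hA0 (by linarith [hσ.2])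
      nlinarith
  have hσ : b - s ∈ Icc 0 δ := ⟨by linarith [hs.2], by linarith [hs.1]⟩
  have hlim : ‖e (b - s)‖ ≤ Real.exp (C * (b - s)) * (A * (2 * δ * (b - s) - (b - s) ^ 2)) := by
    have ht : Tendsto (fun η : ℝ => Real.exp (C * (b - s)) *
        (A * (2 * δ * (b - s) - (b - s) ^ 2) + η * (b - s) + η)) (𝓝[>] 0)
        (𝓝 (Real.exp (C * (b - s)) * (A * (2 * δ * (b - s) - (b - s) ^ 2) + 0 * (b - s) + 0))) :=
      ((by fun_prop : Continuous fun η : ℝ => Real.exp (C * (b - s)) *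
        (A * (2 * δ * (b - s) - (b - s) ^ 2) + η * (b - s) + η)).tendsto 0).mono_left
        nhdsWithin_le_nhds
    rw [zero_mul, add_zero, add_zero] at ht
    exact ge_of_tendsto ht (eventually_mem_nhdsWithin.mono fun η hη => hres η hη _ hσ)
  have he2 : ‖e (b - s)‖ = dist (X s b x) (X' s b x) := by
    rw [dist_eq_norm, he]
    simp only [sub_sub_cancel]
  rw [← he2]
  refine hlim.trans ?_
  have h1 : Real.exp (C * (b - s)) ≤ Real.exp (C * δ) :=
    Real.exp_le_exp.2 (mul_le_mul_of_nonneg_left hσ.2 C.2)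
  have h2 : 2 * δ * (b - s) - (b - s) ^ 2 ≤ δ ^ 2 := by nlinarith [sq_nonneg (δ - (b - s))]
  calc _ ≤ Real.exp (C * δ) * (A * δ ^ 2) := by
        refine mul_le_mul h1 (mul_le_mul_of_nonneg_left h2 hA0) ?_ (Real.exp_pos _).le
        refine mul_nonneg hA0 ?_
        nlinarith [hσ.1, hσ.2]
    _ = _ := by rw [hA]; ring

/-- The divergence is Lipschitz in `x` only off a null set, but both flows pull null sets back to
null sets. With `κ` the distance of the flows the integrand is at most `C κ + C (s - t) ‖w - w'‖`;
its integral is the stated constant. -/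
lemma FrozenBounds.ae_abs_integral_divergence_sub_le (hb : FrozenBounds v t p R C) (hδ : 0 ≤ δ)
    (hv : LipschitzWith K fun z : ℝ × Space N × Space N => v z.1 z.2.1 z.2.2)
    (hw : δ * ‖w‖ ≤ R)
    (hX : IsGlobalFlow (frozenField v t p w) X) (hX' : IsGlobalFlow (frozenField v t p w') X') :
    ∀ᵐ x, |(∫ s in t..(t + δ), divergence (frozenField v t p w s) (X s (t + δ) x)) -
      ∫ s in t..(t + δ), divergence (frozenField v t p w' s) (X' s (t + δ) x)| ≤
      C * δ ^ 2 * (1 / 2 + C * δ * Real.exp (C * δ)) * ‖w - w'‖ := by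
  obtain ⟨K₁, hV⟩ := exists_lipschitzWith_frozenField hv t p w
  obtain ⟨K₂, hV'⟩ := exists_lipschitzWith_frozenField hv t p w'
  set b := t + δ with hbdef
  set κ : ℝ := C * δ ^ 2 * Real.exp (C * δ) * ‖w - w'‖ with hκ
  have hm := hX.measurable_divergence_comp hV b
  have hm' := hX'.measurable_divergence_comp hV' b
  have h1 : ∀ s : ℝ, ∀ᵐ x, s ∈ Icc t b → |divergence (frozenField v t p w s) (X s b x) -
      divergence (frozenField v t p w' s) (X' s b x)| ≤ C * κ + C * ((s - t) * ‖w - w'‖) := by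
    intro s
    by_cases hs : s ∈ Icc t b
    · obtain ⟨S, hS, hSL⟩ := hb.divergence_x _ (add_smul_mem_closedBall hw hs)
      have h4 := hb.divergence_P (p + (s - t) • w) (p + (s - t) • w')
      filter_upwards [(hX.quasiMeasurePreserving hV s b).ae hS,
        (hX'.quasiMeasurePreserving hV' s b).ae (hS.and h4)] with x hx hx' _
      refine (abs_sub_le _ (divergence (fun x => v t x (p + (s - t) • w)) (X' s b x)) _).trans
        (add_le_add ?_ ?_)
      · refine (hSL.dist_le_mul _ hx _ hx'.1).trans ?_
        exact mul_le_mul_of_nonneg_left (hb.dist_flow_le hδ hw hX hX' hs x) C.2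
      · rw [norm_frozen_position_sub hs.1] at hx'
        exact hx'.2
    · exact Eventually.of_forall fun x h => absurd h hs
  have hms : MeasurableSet {z : ℝ × Space N | z.1 ∈ Icc t b →
      |divergence (frozenField v t p w z.1) (X z.1 b z.2) -
      divergence (frozenField v t p w' z.1) (X' z.1 b z.2)| ≤ C * κ + C * ((z.1 - t) * ‖w - w'‖)} := by
    refine MeasurableSet.imp (measurable_fst measurableSet_Icc) (measurableSet_le ?_ ?_)
    · exact (hm.sub hm').abs
    · fun_prop
  have h2 := (Measure.ae_ae_comm (μ := (volume : Measure ℝ)) (ν := (volume : Measure (Space N)))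
    hms).1 (Eventually.of_forall h1)
  have hi : ∀ x, IntervalIntegrable (fun s => divergence (frozenField v t p w s) (X s b x))
      volume t b := fun x => (lipschitzWith_integral_of_bounded
    (hm.comp (measurable_id.prodMk measurable_const))
    (fun s => abs_divergence_le (lipschitzWith_slice hV s) (X s b x)) t).2.1 t b
  have hi' : ∀ x, IntervalIntegrable (fun s => divergence (frozenField v t p w' s) (X' s b x))
      volume t b := fun x => (lipschitzWith_integral_of_bounded
    (hm'.comp (measurable_id.prodMk measurable_const))
    (fun s => abs_divergence_le (lipschitzWith_slice hV' s) (X' s b x)) t).2.1 t b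
  filter_upwards [h2] with x hx
  rw [← intervalIntegral.integral_sub (hi x) (hi' x), ← Real.norm_eq_abs]
  have hg : ∀ s, HasDerivAt (fun s => C * κ * s + C * ‖w - w'‖ * ((s - t) ^ 2 / 2))
      (C * κ + C * ((s - t) * ‖w - w'‖)) s := by
    intro s
    have := ((hasDerivAt_id s).const_mul (C * κ : ℝ)).add
      (((((hasDerivAt_id s).sub_const t).pow 2).div_const 2).const_mul (C * ‖w - w'‖))
    refine this.congr_deriv ?_
    push_cast
    simp only [id]
    ring
  have hgc : Continuous fun s => (C * κ + C * ((s - t) * ‖w - w'‖) : ℝ) := by fun_prop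
  refine (intervalIntegral.norm_integral_le_of_norm_le (by linarith)
    (hx.mono fun s hs hsI => hs (Ioc_subset_Icc_self hsI)) (hgc.intervalIntegrable t b)).trans_eq ?_
  rw [intervalIntegral.integral_eq_sub_of_hasDerivAt (fun s _ => hg s) (hgc.intervalIntegrable t b),
    hκ, hbdef]
  ring

end Stability

/-! ### The `L^1` stability estimate. -/

section Estimate

variable {N : ℕ}

/-- The gradient is continuous, so its essential supremum bounds every value and is a Lipschitz
constant. If it is infinite, only `x = y` needs an argument. -/
lemma enorm_sub_le_eLpNorm_gradient_mul {r : Space N → ℝ} (hr : ContDiff ℝ 1 r) (x y : Space N) :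
    ‖r x - r y‖ₑ ≤ eLpNorm (gradient r) ⊤ volume * edist x y := by
  set G := eLpNorm (gradient r) ⊤ volume with hG
  by_cases hxy : x = y
  · simp [hxy]
  by_cases hGt : G = ⊤
  · rw [hGt, ENNReal.top_mul (edist_pos.2 hxy).ne']
    exact le_top
  have hae : ∀ᵐ x, x ∈ (univ : Set (Space N)) → ‖fderiv ℝ r x‖ ≤ G.toReal := by
    filter_upwards [ae_le_eLpNormEssSup (f := gradient r) (μ := (volume : Measure (Space N)))]
      with x hx _
    rw [← eLpNorm_exponent_top, ← ofReal_norm, gradient, LinearIsometryEquiv.norm_map] at hx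
    exact (ENNReal.ofReal_le_iff_le_toReal hGt).1 hx
  have hall : ∀ x, ‖fderiv ℝ r x‖ ≤ G.toReal := fun x =>
    le_on_closure_of_ae isOpen_univ (hr.continuous_fderiv (by simp)).norm continuous_const hae x
      (subset_closure (mem_univ _))
  have hL : LipschitzWith G.toNNReal r :=
    lipschitzWith_of_nnnorm_fderiv_le (𝕜 := ℝ) (hr.differentiable (by simp)) fun x => by
      rw [← NNReal.coe_le_coe]
      exact hall x
  have := hL x y
  rwa [ENNReal.coe_toNNReal hGt, edist_eq_enorm_sub] at this

/-- Outside the `ε`-thickening both values vanish, provided `κ < ε`. The alternative `κ = 0` is for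
`C = 0`, where the thickening used later has radius 0 and is empty. -/
lemma enorm_sub_le_indicator_thickening {r : Space N → ℝ} (hr : ContDiff ℝ 1 r) {x y : Space N}
    {κ ε : ℝ} (hxy : dist x y ≤ κ) (hκ : κ < ε ∨ κ = 0) :
    ‖r x - r y‖ₑ ≤ (Metric.thickening ε (tsupport r)).indicator
      (fun _ => eLpNorm (gradient r) ⊤ volume * ENNReal.ofReal κ) x := by
  rcases hκ with hκ | rfl
  · by_cases hx : x ∈ Metric.thickening ε (tsupport r)
    · rw [indicator_of_mem hx]
      refine (enorm_sub_le_eLpNorm_gradient_mul hr x y).trans ?_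
      gcongr
      rw [edist_dist]
      exact ENNReal.ofReal_le_ofReal hxy
    · have hε : 0 < ε := (dist_nonneg.trans hxy).trans_lt hκ
      have h1 : r x = 0 := image_eq_zero_of_notMem_tsupport fun h =>
        hx (Metric.self_subset_thickening hε _ h)
      have h2 : r y = 0 := image_eq_zero_of_notMem_tsupport fun h =>
        hx (Metric.mem_thickening_iff.2 ⟨y, h, hxy.trans_lt hκ⟩)
      simp [h1, h2]
  · have : x = y := dist_le_zero.1 hxy
    simp [this]

variable {v : ℝ → Space N → Space N → Space N} {K C : NNReal} {t δ R : ℝ} {p w w' : Space N}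
  {X X' : ℝ → ℝ → Space N → Space N} {r : Space N → ℝ}

/-- The stability estimate for close speeds. -/
lemma FrozenBounds.eLpNorm_sub_le_of_close (hb : FrozenBounds v t p R C) (hδ : 0 ≤ δ)
    (hv : LipschitzWith K fun z : ℝ × Space N × Space N => v z.1 z.2.1 z.2.2)
    (hw : δ * ‖w‖ ≤ R)
    (hX : IsGlobalFlow (frozenField v t p w) X) (hX' : IsGlobalFlow (frozenField v t p w') X')
    (hr : Integrable r) (hrd : ContDiff ℝ 1 r) {ε : ℝ}
    (hκ : C * δ ^ 2 * Real.exp (C * δ) * ‖w - w'‖ < ε ∨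
      C * δ ^ 2 * Real.exp (C * δ) * ‖w - w'‖ = 0)
    (hl : C * δ ^ 2 * (1 / 2 + C * δ * Real.exp (C * δ)) * ‖w - w'‖ ≤ 1) :
    eLpNorm (fun x => charDensity (frozenField v t p w) X t r (t + δ) x -
        charDensity (frozenField v t p w') X' t r (t + δ) x) 1 volume ≤
      eLpNorm (gradient r) ⊤ volume *
          ENNReal.ofReal (C * δ ^ 2 * Real.exp (C * δ) * ‖w - w'‖) *
          volume (Metric.thickening ε (tsupport r)) +
        ENNReal.ofReal (2 * (C * δ ^ 2 * (1 / 2 + C * δ * Real.exp (C * δ)) * ‖w - w'‖)) *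
          eLpNorm r 1 volume := by
  obtain ⟨K₁, hV⟩ := exists_lipschitzWith_frozenField hv t p w
  obtain ⟨K₂, hV'⟩ := exists_lipschitzWith_frozenField hv t p w'
  set b := t + δ with hbdef
  set κ : ℝ := C * δ ^ 2 * Real.exp (C * δ) * ‖w - w'‖ with hκdef
  set l : ℝ := C * δ ^ 2 * (1 / 2 + C * δ * Real.exp (C * δ)) * ‖w - w'‖ with hldef
  set V := frozenField v t p w with hVdef
  set V' := frozenField v t p w' with hVdef'
  set T := Metric.thickening ε (tsupport r) with hT
  set G := eLpNorm (gradient r) ⊤ volume with hG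
  set I : Space N → ENNReal := T.indicator fun _ => G * ENNReal.ofReal κ with hI
  have hpt : ∀ᵐ x, ‖charDensity V X t r b x - charDensity V' X' t r b x‖ₑ ≤
      I (X t b x) * ENNReal.ofReal (flowJac V X t b (X t b x))⁻¹ +
        ENNReal.ofReal (2 * l) * ‖charDensity V' X' t r b x‖ₑ := by
    filter_upwards [hb.ae_abs_integral_divergence_sub_le hδ hv hw hX hX'] with x hx
    set L := ∫ s in t..b, divergence (V s) (X s b x) with hL
    set L' := ∫ s in t..b, divergence (V' s) (X' s b x) with hL'
    have e1 : (flowJac V X t b (X t b x))⁻¹ = Real.exp (-L) := by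
      rw [flowJac, ← Real.exp_neg]
      simp only [hX.comp hV, hL]
    -- The increment of `r` carries the exponential of the first flow, while the error of the
    -- exponentials multiplies the second density, whose mass is that of `r`.
    have e2 : charDensity V X t r b x - charDensity V' X' t r b x =
        (r (X t b x) - r (X' t b x)) * Real.exp (-L) +
          (Real.exp (L' - L) - 1) * charDensity V' X' t r b x := by
      have h3 : Real.exp (L' - L) * Real.exp (-L') = Real.exp (-L) := by
        rw [← Real.exp_add]; ring_nf
      simp only [charDensity]
      rw [← hL, ← hL', sub_mul (Real.exp (L' - L)), mul_left_comm, h3]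
      ring
    rw [e2, e1]
    refine (enorm_add_le _ _).trans (add_le_add ?_ ?_)
    · rw [enorm_mul, Real.enorm_of_nonneg (Real.exp_pos _).le]
      gcongr
      exact enorm_sub_le_indicator_thickening hrd
        (hb.dist_flow_le hδ hw hX hX' ⟨le_rfl, by linarith⟩ x) hκ
    · rw [enorm_mul]
      gcongr
      rw [Real.enorm_eq_ofReal_abs]
      refine ENNReal.ofReal_le_ofReal ?_
      rw [abs_sub_comm] at hx
      refine (Real.abs_exp_sub_one_le (hx.trans hl)).trans ?_
      linarith
  have hm' : AEMeasurable (fun x => ENNReal.ofReal (2 * l) * ‖charDensity V' X' t r b x‖ₑ) :=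
    (hX'.integrable_charDensity hV' t hr b).1.enorm.const_mul _
  have hTm : MeasurableSet T := Metric.isOpen_thickening.measurableSet
  rw [eLpNorm_one_eq_lintegral_enorm, eLpNorm_one_eq_lintegral_enorm]
  refine (lintegral_mono_ae hpt).trans_eq ?_
  -- The indicator is evaluated at the foot `X t b x` of the first characteristic with weight `1 /
  -- J`, so the change of variables returns exactly the measure of the thickening.
  rw [lintegral_add_right' _ hm', lintegral_const_mul' _ _ ENNReal.ofReal_ne_top,
    hX'.lintegral_enorm_charDensity hV',
    hX.lintegral_comp_inv hV t b (fun y => I y * ENNReal.ofReal (flowJac V X t b y)⁻¹)]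
  congr 1
  rw [← lintegral_indicator_const hTm]
  refine lintegral_congr fun y => ?_
  have hJ := flowJac_pos V X t b y
  rw [mul_left_comm, ← ENNReal.ofReal_mul hJ.le, mul_inv_cancel₀ hJ.ne', ENNReal.ofReal_one, mul_one]

/-- The stability estimate with respect to the speed. -/
theorem FrozenBounds.eLpNorm_sub_le (hb : FrozenBounds v t p R C) (hδ : 0 < δ)
    (hv : LipschitzWith K fun z : ℝ × Space N × Space N => v z.1 z.2.1 z.2.2)
    {X : Space N → ℝ → ℝ → Space N → Space N}
    (hX : ∀ w, IsGlobalFlow (frozenField v t p w) (X w)) (hr : Integrable r) (hrd : ContDiff ℝ 1 r)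
    (hw : δ * ‖w‖ ≤ R) (hw' : δ * ‖w'‖ ≤ R) :
    eLpNorm (fun x => charDensity (frozenField v t p w) (X w) t r (t + δ) x -
        charDensity (frozenField v t p w') (X w') t r (t + δ) x) 1 volume ≤
      (eLpNorm (gradient r) ⊤ volume *
          volume (Metric.thickening (C * Real.exp (C * δ) * δ) (tsupport r)) +
        ENNReal.ofReal (1 + C * δ) * eLpNorm r 1 volume) *
      ENNReal.ofReal (C * Real.exp (2 * C * δ) * δ ^ 2 * ‖w - w'‖) := by
  set ε : ℝ := C * Real.exp (C * δ) * δ with hε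
  set k : ℝ := C * δ ^ 2 * Real.exp (C * δ) with hk
  set l : ℝ := C * δ ^ 2 * (1 / 2 + C * δ * Real.exp (C * δ)) with hl
  set D := ‖w - w'‖ with hD
  set G := eLpNorm (gradient r) ⊤ volume with hG
  set T := volume (Metric.thickening ε (tsupport r)) with hT
  have hk0 : 0 ≤ k := by positivity
  have hl0 : 0 ≤ l := by positivity
  -- With `n` pieces, `k D / n = ε (δ D / n)` is below the fixed radius `ε` unless `C = 0`, and `l D
  -- / n < 1` allows `|exp x - 1| ≤ 2 |x|`. Both error terms are linear in the length of a piece, so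
  -- nothing is lost in the sum.
  obtain ⟨n, hn⟩ := exists_nat_gt (max (δ * D) (l * D))
  have hn1 : δ * D < n := (le_max_left _ _).trans_lt hn
  have hn2 : l * D < n := (le_max_right _ _).trans_lt hn
  have hn0 : (0 : ℝ) < n := (by positivity : 0 ≤ δ * D).trans_lt hn1
  set u : ℕ → Space N := fun i => AffineMap.lineMap w w' ((i : ℝ) / n) with hu
  set f : ℕ → Space N → ℝ := fun i =>
    charDensity (frozenField v t p (u i)) (X (u i)) t r (t + δ) with hf
  have hmem : ∀ y : Space N, y ∈ Metric.closedBall (0 : Space N) (R / δ) ↔ δ * ‖y‖ ≤ R := fun y => by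
    rw [mem_closedBall_zero_iff, le_div_iff₀ hδ, mul_comm]
  have hur : ∀ i ≤ n, δ * ‖u i‖ ≤ R := fun i hi => by
    rw [← hmem]
    refine (convex_closedBall _ _).lineMap_mem ((hmem w).2 hw) ((hmem w').2 hw')
      ⟨by positivity, ?_⟩
    rw [div_le_one hn0]
    exact_mod_cast hi
  have hud : ∀ i, ‖u i - u (i + 1)‖ = D / n := fun i => by
    rw [← dist_eq_norm, hu, dist_lineMap_lineMap, dist_eq_norm w w', Real.dist_eq, ← sub_div]
    push_cast
    rw [sub_add_cancel_left, abs_div, abs_neg, abs_one, abs_of_pos hn0]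
    ring
  have hfi : ∀ i, AEStronglyMeasurable (f i) := fun i => by
    obtain ⟨K', hV⟩ := exists_lipschitzWith_frozenField hv t p (u i)
    exact ((hX (u i)).integrable_charDensity hV t hr (t + δ)).1
  set A : ENNReal := G * ENNReal.ofReal (k * (D / n)) * T +
    ENNReal.ofReal (2 * (l * (D / n))) * eLpNorm r 1 volume with hA
  have hstep : ∀ i < n, eLpNorm (fun x => f i x - f (i + 1) x) 1 volume ≤ A := by
    intro i hi
    have hDn : δ * (D / n) < 1 := by rw [mul_div_assoc', div_lt_one hn0]; exact hn1
    have hln : l * (D / n) < 1 := by rw [mul_div_assoc', div_lt_one hn0]; exact hn2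
    have h1 := hb.eLpNorm_sub_le_of_close hδ.le hv (hur i hi.le) (hX (u i)) (hX (u (i + 1))) hr hrd
      (ε := ε) ?_ ?_
    · rw [hud] at h1
      exact h1
    · rw [hud, ← hk]
      rcases eq_or_lt_of_le C.coe_nonneg with h0 | h0
      · right
        rw [hk, ← h0]
        ring
      · left
        have h2 : k * (D / n) = ε * (δ * (D / n)) := by rw [hk, hε]; ring
        have h3 : 0 < ε := by positivity
        rw [h2]
        nlinarith
    · rw [hud, ← hl]
      exact hln.le
  have hsum : ∀ m ≤ n, eLpNorm (fun x => f 0 x - f m x) 1 volume ≤ m * A := by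
    intro m
    induction m with
    | zero => simp
    | succ m ih =>
      intro hm
      have h1 : (fun x => f 0 x - f (m + 1) x) =
          (fun x => f 0 x - f m x) + fun x => f m x - f (m + 1) x := by
        ext x; simp
      rw [h1]
      refine (eLpNorm_add_le ((hfi 0).sub (hfi m)) ((hfi m).sub (hfi (m + 1))) le_rfl).trans ?_
      push_cast
      rw [add_mul, one_mul]
      exact add_le_add (ih (by omega)) (hstep m (by omega))
  have hfin := hsum n le_rfl
  have hu0 : u 0 = w := by simp [hu]
  have hun : u n = w' := by simp [hu, div_self hn0.ne']
  simp only [hf, hu0, hun] at hfin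
  refine hfin.trans ?_
  have hmul : ∀ c : ℝ, 0 ≤ c → (n : ENNReal) * ENNReal.ofReal (c * (D / n)) = ENNReal.ofReal (c * D) := by
    intro c hc
    rw [← ENNReal.ofReal_natCast, ← ENNReal.ofReal_mul hn0.le]
    congr 1
    field_simp
  set z : ℝ := C * δ with hz
  have hz0 : 0 ≤ z := by positivity
  have hE1 : z + 1 ≤ Real.exp z := Real.add_one_le_exp z
  have hE2 : Real.exp (2 * C * δ) = Real.exp z * Real.exp z := by
    rw [← Real.exp_add]; congr 1; rw [hz]; ring
  calc (n : ENNReal) * A = G * ENNReal.ofReal (k * D) * T +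
        ENNReal.ofReal ((2 * l) * D) * eLpNorm r 1 volume := by
        rw [hA, mul_add, ← hmul k hk0, ← hmul (2 * l) (by positivity), mul_assoc 2 l]
        ring
    _ ≤ G * ENNReal.ofReal (C * Real.exp (2 * C * δ) * δ ^ 2 * D) * T +
        ENNReal.ofReal ((1 + z) * (C * Real.exp (2 * C * δ) * δ ^ 2 * D)) *
          eLpNorm r 1 volume := by
        refine add_le_add (mul_le_mul' (mul_le_mul' le_rfl ?_) le_rfl) (mul_le_mul' ?_ le_rfl)
        · refine ENNReal.ofReal_le_ofReal (mul_le_mul_of_nonneg_right ?_ (norm_nonneg _))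
          rw [hk, hE2]
          have : Real.exp z ≤ Real.exp z * Real.exp z := by nlinarith
          calc C * δ ^ 2 * Real.exp z ≤ C * δ ^ 2 * (Real.exp z * Real.exp z) := by gcongr
            _ = _ := by ring
        · refine ENNReal.ofReal_le_ofReal ?_
          rw [← mul_assoc (1 + z)]
          refine mul_le_mul_of_nonneg_right ?_ (norm_nonneg _)
          rw [hl, hE2]
          -- With `E = exp z ≥ 1 + z ≥ 1`: `(1 + z) E E ≥ (1 + z) ^ 2 E ≥ (1 + 2 z) E ≥ 1 + 2 z E`.
          have : 1 + 2 * z * Real.exp z ≤ (1 + z) * (Real.exp z * Real.exp z) := by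
            nlinarith [mul_nonneg hz0 hz0, mul_nonneg (mul_nonneg hz0 hz0) hz0,
              mul_nonneg hz0 (sub_nonneg.2 hE1), mul_nonneg (sub_nonneg.2 hE1) (sub_nonneg.2 hE1),
              mul_nonneg hz0 (mul_nonneg (sub_nonneg.2 hE1) (sub_nonneg.2 hE1))]
          calc 2 * (C * δ ^ 2 * (1 / 2 + z * Real.exp z)) =
                C * δ ^ 2 * (1 + 2 * z * Real.exp z) := by ring
            _ ≤ C * δ ^ 2 * ((1 + z) * (Real.exp z * Real.exp z)) := by gcongr
            _ = _ := by ring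
    _ = _ := by
        rw [ENNReal.ofReal_mul (show 0 ≤ 1 + z by positivity)]
        ring

end Estimate

/-! ### Reduction to a globally Lipschitz field, and uniqueness of characteristics. -/

section Assembly

variable {N : ℕ} {K : NNReal}

/-- Clamping the time to `[0, T]` is 1-Lipschitz, so it preserves the constant `K`. -/
lemma exists_lipschitz_extension {v : ℝ → Space N → Space N → Space N} {T : ℝ} (hT : 0 ≤ T)
    (hv : LipschitzOnWith K (fun z : ℝ × Space N × Space N => v z.1 z.2.1 z.2.2)
      (Icc 0 T ×ˢ univ)) :
    ∃ v' : ℝ → Space N → Space N → Space N,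
      LipschitzWith K (fun z : ℝ × Space N × Space N => v' z.1 z.2.1 z.2.2) ∧
      ∀ τ ∈ Icc 0 T, v' τ = v τ := by
  refine ⟨fun τ => v (projIcc 0 T hT τ), fun z z' => ?_, fun τ hτ => by simp only [projIcc_of_mem hT hτ]⟩
  refine (hv (x := ((projIcc 0 T hT z.1 : ℝ), z.2)) ⟨(projIcc 0 T hT z.1).2, mem_univ _⟩
    (y := ((projIcc 0 T hT z'.1 : ℝ), z'.2)) ⟨(projIcc 0 T hT z'.1).2, mem_univ _⟩).trans ?_
  gcongr
  rw [Prod.edist_eq, Prod.edist_eq]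
  refine max_le_max ?_ le_rfl
  have := (LipschitzWith.projIcc hT) z.1 z'.1
  rwa [ENNReal.coe_one, one_mul, Subtype.edist_eq] at this

/-- A positive radius makes the closed ball the closure of the open one; this is needed because the
leader may reach the sphere at the final time. -/
lemma frozenBounds_of_stabilityConst {v v' : ℝ → Space N → Space N → Space N} {t δ R : ℝ}
    {p : Space N} {C : NNReal} (hδ : 0 < δ) (hR : 0 < R)
    (hv' : LipschitzWith K (fun z : ℝ × Space N × Space N => v' z.1 z.2.1 z.2.2))
    (hvv' : ∀ τ ∈ Ioo t (t + δ), v' τ = v τ) (hC : stabilityConst v t δ p R ≤ C) :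
    FrozenBounds v' t p R C := by
  simp only [stabilityConst, max_le_iff] at hC
  obtain ⟨-, hDx, hDP, hdP, hdx⟩ := hC
  have hdiv : ∀ {B : Set (Space N)}, ∀ z ∈ slab t δ B, divX v z = divX v' z := fun z hz => by
    simp only [divX, hvv' z.1 hz.1]
  have hcl : ∀ P ∈ Metric.closedBall p R, P ∈ closure (Metric.ball p R) := fun P hP => by
    rwa [closure_ball p hR.ne']
  have hslab : ∀ {B : Set (Space N)}, IsOpen B → MeasurableSet (slab t δ B) := fun hB =>
    (isOpen_slab hB).measurableSet
  refine ⟨fun P hP => lipschitzWith_x_of_ae_le hv' hδ Metric.isOpen_ball ?_ (hcl P hP),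
    fun x => lipschitzWith_P_of_ae_le hv' hδ ?_ x,
    fun P hP => exists_lipschitzOnWith_divergence hv' hδ Metric.isOpen_ball (convex_ball p R) hdiv
      hdx (hcl P hP),
    fun P Q => ae_abs_divergence_sub_le_P hv' hδ hdiv hdP P Q⟩
  · refine (ae_restrict_iff' (hslab Metric.isOpen_ball)).1 ?_
    filter_upwards [ae_le_eLpNormEssSup (f := fun z : ℝ × Space N × Space N =>
        fderiv ℝ (fun x => v z.1 x z.2.2) z.2.1) (μ := volume.restrict (slab t δ (Metric.ball p R))),
      ae_restrict_mem (hslab Metric.isOpen_ball)] with z hz hzm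
    rw [← eLpNorm_exponent_top] at hz
    have := hz.trans hDx
    rw [hvv' z.1 hzm.1]
    rw [enorm_eq_nnnorm] at this
    exact_mod_cast this
  · refine (ae_restrict_iff' (hslab isOpen_univ)).1 ?_
    filter_upwards [ae_le_eLpNormEssSup (f := fun z : ℝ × Space N × Space N =>
        fderiv ℝ (fun P => v z.1 z.2.1 P) z.2.2) (μ := volume.restrict (slab t δ univ)),
      ae_restrict_mem (hslab isOpen_univ)] with z hz hzm
    rw [← eLpNorm_exponent_top] at hz
    rw [ENNReal.div_le_iff (by simp) (by simp)] at hDP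
    have := hz.trans hDP
    rw [hvv' z.1 hzm.1]
    rw [enorm_eq_nnnorm, mul_comm] at this
    exact_mod_cast this

lemma IsGlobalFlow.isFlow {V : ℝ → Space N → Space N} {X : ℝ → ℝ → Space N → Space N}
    (hX : IsGlobalFlow V X) (a b : ℝ) : IsFlow V a b X := fun s _ x =>
  ⟨hX.init s x, fun τ _ => (hX.deriv s x τ).hasDerivWithinAt⟩

/-- The initial time may lie inside the interval, so uniqueness is applied separately forward and
backward, with one-sided derivatives. -/
lemma IsFlow.eq {V : ℝ → Space N → Space N} {X Y : ℝ → ℝ → Space N → Space N} {a b : ℝ}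
    (hY : IsFlow V a b Y) (hX : IsFlow V a b X)
    (hV : LipschitzWith K (fun z : ℝ × Space N => V z.1 z.2)) {τ s : ℝ} (hτ : τ ∈ Icc a b)
    (hs : s ∈ Icc a b) (x : Space N) : Y τ s x = X τ s x := by
  have hc : ∀ {Z : ℝ → ℝ → Space N → Space N}, IsFlow V a b Z →
      ContinuousOn (fun σ => Z σ s x) (Icc a b) := fun hZ σ hσ =>
    ((hZ s hs x).2 σ hσ).continuousWithinAt
  have heq : Y s s x = X s s x := by rw [(hY s hs x).1, (hX s hs x).1]
  rcases le_total s τ with h | h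
  · have hsub : Icc s b ⊆ Icc a b := Icc_subset_Icc_left hs.1
    have hd : ∀ {Z : ℝ → ℝ → Space N → Space N}, IsFlow V a b Z → ∀ σ ∈ Ico s b,
        HasDerivWithinAt (fun σ => Z σ s x) (V σ (Z σ s x)) (Ici σ) σ := fun hZ σ hσ =>
      ((hZ s hs x).2 σ (hsub ⟨hσ.1, hσ.2.le⟩)).mono_of_mem_nhdsWithin
        (Icc_mem_nhdsGE_of_mem ⟨hs.1.trans hσ.1, hσ.2⟩)
    exact ODE_solution_unique_of_mem_Icc_right (s := fun _ => univ)
      (fun σ _ => (lipschitzWith_slice hV σ).lipschitzOnWith) ((hc hY).mono hsub) (hd hY)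
      (fun _ _ => mem_univ _) ((hc hX).mono hsub) (hd hX) (fun _ _ => mem_univ _) heq ⟨h, hτ.2⟩
  · have hsub : Icc a s ⊆ Icc a b := Icc_subset_Icc_right hs.2
    have hd : ∀ {Z : ℝ → ℝ → Space N → Space N}, IsFlow V a b Z → ∀ σ ∈ Ioc a s,
        HasDerivWithinAt (fun σ => Z σ s x) (V σ (Z σ s x)) (Iic σ) σ := fun hZ σ hσ =>
      ((hZ s hs x).2 σ (hsub ⟨hσ.1.le, hσ.2⟩)).mono_of_mem_nhdsWithin
        (Icc_mem_nhdsLE_of_mem ⟨hσ.1, hσ.2.trans hs.2⟩)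
    exact ODE_solution_unique_of_mem_Icc_left (s := fun _ => univ)
      (fun σ _ => (lipschitzWith_slice hV σ).lipschitzOnWith) ((hc hY).mono hsub) (hd hY)
      (fun _ _ => mem_univ _) ((hc hX).mono hsub) (hd hX) (fun _ _ => mem_univ _) heq ⟨hτ.1, h⟩

end Assembly

end

theorem lemma2p3 {N : ℕ} (T U δ : ℝ) (hT : 0 < T) (hU : 0 < U) (hδ : 0 < δ) (hδT : δ < T)
    (v : ℝ → Space N → Space N → Space N)
    (hv : ∃ K : NNReal, LipschitzOnWith K
      (fun z : ℝ × Space N × Space N => v z.1 z.2.1 z.2.2) (Icc 0 T ×ˢ univ))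
    (Pbar : Space N) (u : ℝ → Space N)
    (hu : AEStronglyMeasurable u (volume.restrict (Icc 0 T)))
    (huU : ∀ᵐ s ∂(volume.restrict (Icc 0 T)), ‖u s‖ ≤ U)
    (t : ℝ) (ht : t ∈ Ico 0 (T - δ))
    (r : Space N → ℝ) (hr : Integrable r volume) :
    ∃ X : Space N → ℝ → ℝ → Space N → Space N,
      -- for every `w`: the characteristics, and well-posedness with the explicit formula
      (∀ w : Space N,
        IsFlow (frozenField v t (leaderPos Pbar u t) w) t (t + δ) (X w) ∧
        (∀ Y, IsFlow (frozenField v t (leaderPos Pbar u t) w) t (t + δ) Y →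
          ∀ τ ∈ Icc t (t + δ), ∀ s ∈ Icc t (t + δ), ∀ x, Y τ s x = X w τ s x) ∧
        IsKruzkovSolution (frozenField v t (leaderPos Pbar u t) w) t (t + δ) r
          (charDensity (frozenField v t (leaderPos Pbar u t) w) (X w) t r) ∧
        IsContinuousL1 t (t + δ)
          (charDensity (frozenField v t (leaderPos Pbar u t) w) (X w) t r) ∧
        (∀ ρ : ℝ → Space N → ℝ,
          IsKruzkovSolution (frozenField v t (leaderPos Pbar u t) w) t (t + δ) r ρ →
          ∀ᵐ z ∂((volume : Measure (ℝ × Space N)).restrict (Icc t (t + δ) ×ˢ univ)),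
            ρ z.1 z.2 =
              charDensity (frozenField v t (leaderPos Pbar u t) w) (X w) t r z.1 z.2)) ∧
      -- stability with respect to the speed of the leader
      (IsC11 r → volume (tsupport r) < ⊤ →
        ∀ (w₁ w₂ : Space N) (C : ℝ),
          stabilityConst v t δ (leaderPos Pbar u t) (δ * max U (max ‖w₁‖ ‖w₂‖)) ≠ ⊤ →
          C = (stabilityConst v t δ (leaderPos Pbar u t) (δ * max U (max ‖w₁‖ ‖w₂‖))).toReal →
          eLpNorm (fun x =>
              charDensity (frozenField v t (leaderPos Pbar u t) w₁) (X w₁) t r (t + δ) x -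
              charDensity (frozenField v t (leaderPos Pbar u t) w₂) (X w₂) t r (t + δ) x)
            1 volume ≤
          (eLpNorm (gradient r) ⊤ volume *
              volume (Metric.thickening (C * Real.exp (C * δ) * δ) (tsupport r)) +
            ENNReal.ofReal (1 + C * δ) * eLpNorm r 1 volume) *
          ENNReal.ofReal (C * Real.exp (2 * C * δ) * δ ^ 2 * ‖w₁ - w₂‖)) := by
  obtain ⟨K, hK⟩ := hv
  obtain ⟨v', hv', hvv'⟩ := exists_lipschitz_extension hT.le hK
  have htT : t ∈ Icc 0 T := ⟨ht.1, by linarith [ht.2]⟩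
  set p := leaderPos Pbar u t with hp
  -- The frozen field sees `v` at time `t` only, where the extension agrees with it.
  have hfield : ∀ w, frozenField v t p w = frozenField v' t p w := fun w => by
    unfold frozenField
    rw [hvv' t htT]
  simp only [hfield]
  have hflow : ∀ w, ∃ X, IsGlobalFlow (frozenField v' t p w) X := fun w => by
    obtain ⟨K', hV⟩ := exists_lipschitzWith_frozenField hv' t p w
    exact exists_isGlobalFlow hV
  choose X hX using hflow
  refine ⟨X, fun w => ?_, fun hrC hrs w₁ w₂ C hCt hC => ?_⟩
  · obtain ⟨K', hV⟩ := exists_lipschitzWith_frozenField hv' t p w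
    have hsol := (hX w).isKruzkovSolution_charDensity hV (by linarith : t ≤ t + δ) hr
    exact ⟨(hX w).isFlow _ _,
      fun Y hY τ hτ s hs x => hY.eq ((hX w).isFlow _ _) hV hτ hs x, hsol,
      (hX w).isContinuousL1_charDensity hV t (t + δ) hr,
      fun ρ hρ => hρ.ae_eq hsol (hX w) hV (by linarith) hr.1⟩
  · have hC' : C = ((stabilityConst v t δ p (δ * max U (max ‖w₁‖ ‖w₂‖))).toNNReal : ℝ) := hC
    rw [hC']
    have hb : FrozenBounds v' t p (δ * max U (max ‖w₁‖ ‖w₂‖)) _ :=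
      frozenBounds_of_stabilityConst hδ (mul_pos hδ (lt_max_of_lt_left hU)) hv'
        (fun τ hτ => hvv' τ ⟨ht.1.trans hτ.1.le, by linarith [hτ.2, ht.2]⟩)
        (ENNReal.coe_toNNReal hCt).ge
    refine hb.eLpNorm_sub_le hδ hv' hX hr hrC.1 ?_ ?_
    · gcongr
      exact (le_max_left _ _).trans (le_max_right _ _)
    · gcongr
      exact (le_max_right _ _).trans (le_max_right _ _)
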